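/- Let $X$ be a complex manifold of complex dimension $n$, and put $A=T^{1,0}X\oplus (T^{0,1}X)^*$, $A^*=T^{0,1}X\oplus (T^{1,0}X)^*$, with their standard Lie algebroid structures: the anchors are the projections to $T^{1,0}X$ and $T^{0,1}X$, and in holomorphic coordinates the frames $\partial_{z^i},d\bar z^j$ of $A$ and $\partial_{\bar z^i},dz^j$ of $A^*$ consist of commuting sections. Let $d=\partial$ and $d_*=\bar\partial$ be the Lie algebroid differentials of $A$ (on $\Gamma(\wedge^\bullet A^*)$) and of $A^*$ (on $\Gamma(\wedge^\bullet A)$), and let $[\cdot,\cdot]$ be the Schouten bracket of $A$. Let $H\in\Gamma(\wedge^2A)$ be an extended Poisson structure, i.e. a smooth section with $\bar\partial H+\tfrac12[H,H]=0$, and put $\bar\partial^H=\bar\partial+[H,\cdot]$ on $\Gamma(\wedge^\bullet A)$. Let $A^*_H$ be the bundle $A^*$ with anchor $a_*^H=a_*+a\circ H^\sharp$ and bracket $$[\alpha,\beta]_*^H=[\alpha,\beta]_*+L_{H^\sharp\alpha}\beta-L_{H^\sharp\beta}\alpha-d\langle H^\sharp\alpha,\beta\rangle .$$ It acts on the line bundle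 $Q=\wedge^{2n}A^*\otimes\wedge^{2n}T^*_{\mathbb C}X$ by $$\nabla^H_\alpha(\alpha_1\wedge\dots\wedge\alpha_{2n}\otimes\mu)=\sum_i\alpha_1\wedge\dots\wedge[\alpha,\alpha_i]_*^H\wedge\dots\wedge\alpha_{2n}\otimes\mu+\alpha_1\wedge\dots\wedge\alpha_{2n}\otimes L_{a_*^H(\alpha)}\mu ,$$ hence on its square root $\mathscr L=\wedge^n(T^{1,0}X)^*$ ($\mathscr L\otimes\mathscr L\cong Q$). Define $D^H:\Gamma(\mathscr L)\to\Gamma(A\otimes\mathscr L)$ by $\iota_\alpha D^Hs=\nabla^H_\alpha s$, and $$\bar\partial_*^H(u\otimes s)=(\bar\partial^Hu)\otimes s+(-1)^k\,u\wedge D^Hs,\qquad u\in\Gamma(\wedge^kA),\ s\in\Gamma(\mathscr L).$$ Write $T^{*(i,j)}=\wedge^i(T^{1,0}X)^*\otimes\wedge^j(T^{0,1}X)^*$ and $\Omega^{i,j}=\Gamma(T^{*(i,j)})$. Let $\wedge^\bullet A$ act on forms by the Clifford action, in which $X+\xi\in A$ acts by $\lambda\mapsto\iota_X\lambda+\xi\wedge\lambda$;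 put $\tau(u\otimes s)=u\cdot s$, $\iota_H\lambda=-H\cdot\lambda$ and $[\partial,\iota_H]=\partial\iota_H-\iota_H\partial$. **Theorem.** For every $k\ge0$: 1. $\tau$ is an isomorphism of vector bundles $\wedge^kA\otimes\mathscr L\to\bigoplus_{i-j=n-k}T^{*(i,j)}$ and induces a bijection of smooth sections $\Gamma(\wedge^kA\otimes\mathscr L)\to\bigoplus_{i-j=n-k}\Omega^{i,j}$; 2. $\bar\partial_*^H$ maps $\Gamma(\wedge^kA\otimes\mathscr L)$ to $\Gamma(\wedge^{k+1}A\otimes\mathscr L)$, $\bar\partial+[\partial,\iota_H]$ maps $\bigoplus_{i-j=n-k}\Omega^{i,j}$ to $\bigoplus_{i-j=n-k-1}\Omega^{i,j}$, and both operators have square zero; 3. $\tau\circ\bar\partial_*^H=(\bar\partial+[\partial,\iota_H])\circ\tau$ on $\Gamma(\wedge^kA\otimes\mathscr L)$; 4. consequently $\tau$ induces a linear isomorphism from the $k$-th cohomology of $A^*_H$ with coefficients in $\mathscr L=Q^{1/2}$, i.e. the cohomology of $(\Gamma(\wedge^\bullet A\otimes\mathscr L),\bar\partial_*^H)$, onto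 the $k$-th Koszul–Brylinski homology of $(X,H)$, i.e. the cohomology of $(\bigoplus_{i-j=n-\bullet}\Omega^{i,j},\bar\partial+[\partial,\iota_H])$. -/

import Mathlib

open scoped Manifold ContDiff TensorProduct

set_option linter.unusedSectionVars false

namespace ExtPoisson

noncomputable section

/-! ## Linear algebra of a complex vector space -/

/-- The model space `ℂⁿ`. -/
abbrev Cn (n : ℕ) : Type := Fin n → ℂ

section LinearAlgebra

variable (V : Type*) [AddCommGroup V] [Module ℂ V]

/-- `(T^{0,1})^*` of a complex vector space `V = T^{1,0}`: the conjugate-linear functionals. -/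
abbrev ConjDual : Type _ := V →ₛₗ[starRingEnd ℂ] ℂ

/-- `T^{0,1}`, as the dual of the space of conjugate-linear functionals
(canonically the complex conjugate of `V`). -/
abbrev T01 : Type _ := Module.Dual ℂ (ConjDual V)

/-- `A = T^{1,0} ⊕ (T^{0,1})^*`. -/
abbrev AFib : Type _ := V × ConjDual V

/-- `A^* = T^{0,1} ⊕ (T^{1,0})^*`. -/
abbrev ADual : Type _ := T01 V × Module.Dual ℂ V

/-- `T_ℂ = T^{1,0} ⊕ T^{0,1}`. -/
abbrev TC : Type _ := V × T01 V

/-- `T_ℂ^* = (T^{1,0})^* ⊕ (T^{0,1})^*`. -/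
abbrev TCDual : Type _ := Module.Dual ℂ V × ConjDual V

/-- The line `ℒ = ∧ⁿ (T^{1,0})^*`. -/
abbrev LFib (n : ℕ) : Type _ := ⋀[ℂ]^n (Module.Dual ℂ V)

/-- `∧^• A ⊗ ℒ`. -/
abbrev ALFib (n : ℕ) : Type _ := ExteriorAlgebra ℂ (AFib V) ⊗[ℂ] LFib V n

variable {V}

/-- The duality pairing of `A^*` with `A`. -/
def pairA (α : ADual V) : Module.Dual ℂ (AFib V) := LinearMap.coprod α.2 α.1

/-- The duality pairing of `T_ℂ` with `T_ℂ^*`. -/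
def pairT (Z : TC V) : Module.Dual ℂ (TCDual V) :=
  LinearMap.coprod (Module.Dual.eval ℂ V Z.1) Z.2

/-- The anchor `a : A → T_ℂ`, the projection to `T^{1,0}`. -/
def anchorA (u : AFib V) : TC V := (u.1, 0)

/-- The anchor `a_* : A^* → T_ℂ`, the projection to `T^{0,1}`. -/
def anchorStar (α : ADual V) : TC V := (0, α.1)

/-- `H^♯ : A^* → A`, `H^♯ α = ι_α H`, so that `⟨H^♯ α, β⟩ = H(α, β)` for `H ∈ ∧² A`. -/
def sharp (H : ExteriorAlgebra ℂ (AFib V)) (α : ADual V) : AFib V :=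
  ExteriorAlgebra.ιInv (CliffordAlgebra.contractLeft (pairA α) H)

variable (V) in
/-- The action of `X + ξ ∈ A ⊂ T_ℂ ⊕ T_ℂ^*` on spinors: `λ ↦ ι_X λ + ξ ∧ λ`. -/
def cliffordVec : AFib V →ₗ[ℂ] Module.End ℂ (ExteriorAlgebra ℂ (TCDual V)) :=
  LinearMap.coprod
    (CliffordAlgebra.contractLeft ∘ₗ
      (LinearMap.lcomp ℂ ℂ (LinearMap.fst ℂ (Module.Dual ℂ V) (ConjDual V)) ∘ₗ
        Module.Dual.eval ℂ V))
    (LinearMap.mul ℂ (ExteriorAlgebra ℂ (TCDual V)) ∘ₗ ExteriorAlgebra.ι ℂ ∘ₗ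
      LinearMap.inr ℂ (Module.Dual ℂ V) (ConjDual V))

theorem cliffordVec_apply (u : AFib V) (w : ExteriorAlgebra ℂ (TCDual V)) :
    cliffordVec V u w = CliffordAlgebra.contractLeft (pairT (anchorA u)) w +
      ExteriorAlgebra.ι ℂ ((0, u.2) : TCDual V) * w := by
  have h : pairT (anchorA u) = (Module.Dual.eval ℂ V u.1) ∘ₗ
      (LinearMap.fst ℂ (Module.Dual ℂ V) (ConjDual V)) := by
    refine LinearMap.ext fun x => ?_
    exact add_zero _
  rw [h]
  rfl

theorem cliffordVec_sq (u : AFib V) : cliffordVec V u * cliffordVec V u = 0 := by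
  refine LinearMap.ext fun w => ?_
  simp only [Module.End.mul_apply, cliffordVec_apply, map_add,
    CliffordAlgebra.contractLeft_contractLeft, LinearMap.zero_apply]
  have h1 : CliffordAlgebra.contractLeft (pairT (anchorA u))
      (ExteriorAlgebra.ι ℂ ((0, u.2) : TCDual V) * w) =
      pairT (anchorA u) ((0, u.2) : TCDual V) • w - ExteriorAlgebra.ι ℂ ((0, u.2) : TCDual V) *
        CliffordAlgebra.contractLeft (pairT (anchorA u)) w :=
    CliffordAlgebra.contractLeft_ι_mul _ _ _
  rw [h1, ← mul_assoc, ExteriorAlgebra.ι_sq_zero]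
  simp [pairT, anchorA]

variable (V) in
/-- The Clifford action `u · λ` of `∧^• A` (a subalgebra of the Clifford algebra of
`T_ℂ ⊕ T_ℂ^*`, as `A` is isotropic) on spinors: `x₁ ∧ ⋯ ∧ x_k` acts as the composite of the
actions of `x₁, …, x_k`; thus `W ∧ ξ` sends `λ` to `(-1)^{w(w-1)/2} ι_W (ξ ∧ λ)`. -/
def clifford :
    ExteriorAlgebra ℂ (AFib V) →ₐ[ℂ] Module.End ℂ (ExteriorAlgebra ℂ (TCDual V)) :=
  ExteriorAlgebra.lift ℂ ⟨cliffordVec V, cliffordVec_sq⟩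

theorem clifford_ι (u : AFib V) : clifford V (ExteriorAlgebra.ι ℂ u) = cliffordVec V u := by
  simp [clifford]

variable (V) in
/-- `τ (u ⊗ s) = u · s`. -/
def tauFib (n : ℕ) : ALFib V n →ₗ[ℂ] ExteriorAlgebra ℂ (TCDual V) :=
  TensorProduct.lift
    ((clifford V).toLinearMap.compl₂
      ((ExteriorAlgebra.map (LinearMap.inl ℂ (Module.Dual ℂ V) (ConjDual V))).toLinearMap ∘ₗ
        (⋀[ℂ]^n (Module.Dual ℂ V)).subtype))

variable (V) in
/-- `∧^k A ⊗ ℒ` inside `∧^• A ⊗ ℒ`. -/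
def alDegree (n k : ℕ) : Submodule ℂ (ALFib V n) :=
  LinearMap.range ((⋀[ℂ]^k (AFib V)).subtype.rTensor (LFib V n))

variable (V) in
/-- The covectors of type `(p, q)`, that is `∧^p (T^{1,0})^* ∧ ∧^q (T^{0,1})^*`. -/
def formType (p q : ℕ) : Submodule ℂ (ExteriorAlgebra ℂ (TCDual V)) :=
  (LinearMap.range
      (ExteriorAlgebra.ι ℂ ∘ₗ LinearMap.inl ℂ (Module.Dual ℂ V) (ConjDual V))) ^ p *
    (LinearMap.range
      (ExteriorAlgebra.ι ℂ ∘ₗ LinearMap.inr ℂ (Module.Dual ℂ V) (ConjDual V))) ^ q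

variable (V) in
/-- `⨁_{i - j = n - k} (T^{i,j})^*`. -/
def formDegree (n k : ℕ) : Submodule ℂ (ExteriorAlgebra ℂ (TCDual V)) :=
  ⨆ p : {p : ℕ × ℕ // (p.1 : ℤ) - p.2 = (n : ℤ) - k}, formType V p.1.1 p.1.2

/-! ### Functoriality for a linear isomorphism `g : V → W` with inverse `h` -/

variable {W : Type*} [AddCommGroup W] [Module ℂ W]

/-- `ξ ↦ ξ ∘ h` on conjugate-linear functionals. -/
def conjDualMap (h : W →ₗ[ℂ] V) : ConjDual V →ₗ[ℂ] ConjDual W where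
  toFun ξ := ξ.comp h
  map_add' _ _ := rfl
  map_smul' _ _ := rfl

/-- The map `A(V) → A(W)`. -/
def aMap (g : V →ₗ[ℂ] W) (h : W →ₗ[ℂ] V) : AFib V →ₗ[ℂ] AFib W :=
  LinearMap.prodMap g (conjDualMap h)

/-- The map `T_ℂ^*(V) → T_ℂ^*(W)`. -/
def tMap (h : W →ₗ[ℂ] V) : TCDual V →ₗ[ℂ] TCDual W :=
  LinearMap.prodMap h.dualMap (conjDualMap h)

/-- The map `∧^• A(V) ⊗ ℒ(V) → ∧^• A(W) ⊗ ℒ(W)`. -/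
def alMap (n : ℕ) (g : V →ₗ[ℂ] W) (h : W →ₗ[ℂ] V) : ALFib V n →ₗ[ℂ] ALFib W n :=
  TensorProduct.map (ExteriorAlgebra.map (aMap g h)).toLinearMap (exteriorPower.map n h.dualMap)

theorem clifford_map (g : V →ₗ[ℂ] W) (h : W →ₗ[ℂ] V) (hg : h ∘ₗ g = LinearMap.id)
    (u : ExteriorAlgebra ℂ (AFib V)) (w : ExteriorAlgebra ℂ (TCDual V)) :
    clifford W (ExteriorAlgebra.map (aMap g h) u) (ExteriorAlgebra.map (tMap h) w) =
      ExteriorAlgebra.map (tMap h) (clifford V u w) := by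
  induction u using ExteriorAlgebra.induction generalizing w with
  | algebraMap r => simp
  | add a b ha hb => simp [ha, hb]
  | mul a b ha hb => simp [ha, hb]
  | ι x =>
    have hc : ∀ w : ExteriorAlgebra ℂ (TCDual V),
        CliffordAlgebra.contractLeft (pairT (anchorA (aMap g h x)))
          (ExteriorAlgebra.map (tMap h) w) =
        ExteriorAlgebra.map (tMap h)
          (CliffordAlgebra.contractLeft (pairT (anchorA x)) w) := by
      intro w
      induction w using CliffordAlgebra.left_induction with
      | algebraMap r =>
        have : ExteriorAlgebra.map (tMap h) (algebraMap ℂ (CliffordAlgebra 0) r) =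
          algebraMap ℂ (CliffordAlgebra 0) r := AlgHom.commutes _ _
        rw [this, CliffordAlgebra.contractLeft_algebraMap,
          CliffordAlgebra.contractLeft_algebraMap, map_zero]
      | add a b ha hb => simp only [map_add, ha, hb]
      | ι_mul y m hy =>
        have e1 : ExteriorAlgebra.map (tMap h) (CliffordAlgebra.ι 0 m * y) =
            CliffordAlgebra.ι 0 (tMap h m) * ExteriorAlgebra.map (tMap h) y := by
          rw [map_mul]
          congr 1
          exact ExteriorAlgebra.map_apply_ι _ _
        have e2 : ∀ z, ExteriorAlgebra.map (tMap h) (CliffordAlgebra.ι 0 m * z) =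
            CliffordAlgebra.ι 0 (tMap h m) * ExteriorAlgebra.map (tMap h) z := by
          intro z
          rw [map_mul]
          congr 1
          exact ExteriorAlgebra.map_apply_ι _ _
        have e3 : pairT (anchorA (aMap g h x)) (tMap h m) = pairT (anchorA x) m := by
          have : h (g x.1) = x.1 := LinearMap.congr_fun hg x.1
          simp [pairT, anchorA, aMap, tMap, this]
        rw [e1, CliffordAlgebra.contractLeft_ι_mul, CliffordAlgebra.contractLeft_ι_mul, map_sub,
          map_smul, e2, hy, e3]
    rw [ExteriorAlgebra.map_apply_ι, clifford_ι, clifford_ι, cliffordVec_apply, cliffordVec_apply, hc, map_add,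
      map_mul, ExteriorAlgebra.map_apply_ι]
    simp [tMap, aMap]

end LinearAlgebra

instance conjDual_finite (n : ℕ) : Module.Finite ℂ (ConjDual (Cn n)) := by
  let f : ConjDual (Cn n) →ₗ[ℂ] Cn n :=
    { toFun := fun ξ i => ξ (Pi.single i 1)
      map_add' := fun _ _ => rfl
      map_smul' := fun _ _ => rfl }
  refine Module.Finite.of_injective f fun ξ η h => ?_
  refine LinearMap.ext fun v => ?_
  have hv : v = ∑ i, v i • (Pi.single i 1 : Cn n) := by
    ext j
    simp [Finset.sum_apply, Pi.single_apply]
  rw [hv]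
  simp only [map_sum, LinearMap.map_smulₛₗ]
  exact Finset.sum_congr rfl fun i _ => congrArg _ (congrFun h i)

instance exteriorAlgebra_finite (M : Type*) [AddCommGroup M] [Module ℂ M] [Module.Finite ℂ M] :
    Module.Finite ℂ (ExteriorAlgebra ℂ M) :=
  Module.Finite.of_basis (Module.finBasis ℂ M).ExteriorAlgebra

/-! ## Derivatives of vector-valued functions on `ℂⁿ`

A function `f : ℂⁿ → F` into a finite-dimensional complex vector space is differentiated through
its components in a basis of `F`. -/

section Calculus

variable {n : ℕ}

/-- `∂f/∂z^i = (∂f/∂x^i - i ∂f/∂y^i) / 2`. -/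
def wirtinger (i : Fin n) (f : Cn n → ℂ) (z : Cn n) : ℂ :=
  (fderiv ℝ f z (Pi.single i 1) - Complex.I * fderiv ℝ f z (Pi.single i Complex.I)) / 2

/-- `∂f/∂z̄^i = (∂f/∂x^i + i ∂f/∂y^i) / 2`. -/
def wirtingerBar (i : Fin n) (f : Cn n → ℂ) (z : Cn n) : ℂ :=
  (fderiv ℝ f z (Pi.single i 1) + Complex.I * fderiv ℝ f z (Pi.single i Complex.I)) / 2

variable {F : Type*} [AddCommGroup F] [Module ℂ F]

/-- Real differentiability at a point of a function into a finite-dimensional complex space. -/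
def CDiffAt (f : Cn n → F) (z : Cn n) : Prop :=
  ∀ ℓ : Module.Dual ℂ F, DifferentiableAt ℝ (fun y => ℓ (f y)) z

variable [Module.Finite ℂ F]

/-- `∂/∂z^i` of a vector-valued function. -/
def pd (i : Fin n) (f : Cn n → F) (z : Cn n) : F :=
  ∑ b, wirtinger i (fun y => (Module.finBasis ℂ F).coord b (f y)) z • Module.finBasis ℂ F b

/-- `∂/∂z̄^i` of a vector-valued function. -/
def pdBar (i : Fin n) (f : Cn n → F) (z : Cn n) : F :=
  ∑ b, wirtingerBar i (fun y => (Module.finBasis ℂ F).coord b (f y)) z • Module.finBasis ℂ F b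

theorem pd_add (i : Fin n) {f g : Cn n → F} {z : Cn n} (hf : CDiffAt f z) (hg : CDiffAt g z) :
    pd i (fun y => f y + g y) z = pd i f z + pd i g z := by
  rw [pd, pd, pd, ← Finset.sum_add_distrib]
  refine Finset.sum_congr rfl fun b _ => ?_
  rw [← add_smul]
  congr 1
  simp only [wirtinger, map_add]
  rw [fderiv_fun_add (hf _) (hg _)]
  simp only [add_apply]
  ring

theorem pdBar_add (i : Fin n) {f g : Cn n → F} {z : Cn n} (hf : CDiffAt f z) (hg : CDiffAt g z) :
    pdBar i (fun y => f y + g y) z = pdBar i f z + pdBar i g z := by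
  rw [pdBar, pdBar, pdBar, ← Finset.sum_add_distrib]
  refine Finset.sum_congr rfl fun b _ => ?_
  rw [← add_smul]
  congr 1
  simp only [wirtingerBar, map_add]
  rw [fderiv_fun_add (hf _) (hg _)]
  simp only [add_apply]
  ring

theorem pd_smul (i : Fin n) (c : ℂ) {f : Cn n → F} {z : Cn n} (hf : CDiffAt f z) :
    pd i (fun y => c • f y) z = c • pd i f z := by
  rw [pd, pd, Finset.smul_sum]
  refine Finset.sum_congr rfl fun b _ => ?_
  rw [smul_smul]
  congr 1
  simp only [wirtinger, map_smul, smul_eq_mul]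
  rw [fderiv_const_mul (hf _)]
  simp only [smul_apply, smul_eq_mul]
  ring

theorem pdBar_smul (i : Fin n) (c : ℂ) {f : Cn n → F} {z : Cn n} (hf : CDiffAt f z) :
    pdBar i (fun y => c • f y) z = c • pdBar i f z := by
  rw [pdBar, pdBar, Finset.smul_sum]
  refine Finset.sum_congr rfl fun b _ => ?_
  rw [smul_smul]
  congr 1
  simp only [wirtingerBar, map_smul, smul_eq_mul]
  rw [fderiv_const_mul (hf _)]
  simp only [smul_apply, smul_eq_mul]
  ring

theorem CDiffAt.bilin {G K : Type*} [AddCommGroup G] [Module ℂ G] [Module.Finite ℂ G]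
    [AddCommGroup K] [Module ℂ K] (B : F →ₗ[ℂ] G →ₗ[ℂ] K) {f : Cn n → F} {g : Cn n → G}
    {z : Cn n} (hf : CDiffAt f z) (hg : CDiffAt g z) : CDiffAt (fun y => B (f y) (g y)) z := by
  intro ℓ
  have h : (fun y => ℓ (B (f y) (g y))) = fun y => ∑ b, ∑ c,
      (Module.finBasis ℂ F).coord b (f y) * (Module.finBasis ℂ G).coord c (g y) *
        ℓ (B (Module.finBasis ℂ F b) (Module.finBasis ℂ G c)) := by
    funext y
    conv_lhs => rw [← (Module.finBasis ℂ F).sum_repr (f y), ← (Module.finBasis ℂ G).sum_repr (g y)]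
    simp only [map_sum, map_smul, LinearMap.sum_apply, LinearMap.smul_apply, smul_eq_mul,
      Finset.mul_sum, Module.Basis.coord_apply]
    rw [Finset.sum_comm]
    refine Finset.sum_congr rfl fun b _ => Finset.sum_congr rfl fun c _ => ?_
    ring
  rw [h]
  refine DifferentiableAt.fun_sum fun b _ => DifferentiableAt.fun_sum fun c _ => ?_
  exact ((hf _).mul (hg _)).mul_const _

end Calculus

/-! ## Frames on `ℂⁿ` -/

section Frames

variable (n : ℕ)

/-- `dz^i`. -/
def dz (i : Fin n) : Module.Dual ℂ (Cn n) := LinearMap.proj i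

/-- `dz̄^i`. -/
def dzbar (i : Fin n) : ConjDual (Cn n) where
  toFun v := starRingEnd ℂ (v i)
  map_add' _ _ := by simp
  map_smul' _ _ := by simp

/-- `∂/∂z^i`. -/
def ddz (i : Fin n) : Cn n := Pi.single i 1

/-- `∂/∂z̄^i`. -/
def ddzbar (i : Fin n) : T01 (Cn n) where
  toFun ξ := ξ (Pi.single i 1)
  map_add' _ _ := rfl
  map_smul' _ _ := rfl

/-- The frame `∂/∂z^i, dz̄^i` of `A`. -/
def frameA : Fin n ⊕ Fin n → AFib (Cn n)
  | .inl i => (ddz n i, 0)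
  | .inr i => (0, dzbar n i)

/-- The frame `dz^i, ∂/∂z̄^i` of `A^*`, dual to `frameA`. -/
def coframeA : Fin n ⊕ Fin n → ADual (Cn n)
  | .inl i => (0, dz n i)
  | .inr i => (ddzbar n i, 0)

/-- `dz^i` as an element of `T_ℂ^*`. -/
def dzT (i : Fin n) : TCDual (Cn n) := (dz n i, 0)

/-- `dz̄^i` as an element of `T_ℂ^*`. -/
def dzbarT (i : Fin n) : TCDual (Cn n) := (0, dzbar n i)

/-- `s = dz^1 ∧ ⋯ ∧ dz^n`, a frame of `ℒ`. -/
def holFrame : LFib (Cn n) n := exteriorPower.ιMulti ℂ n (dz n)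

/-- The component of an element of `ℒ` in the frame `dz^1 ∧ ⋯ ∧ dz^n`. -/
def coefL : LFib (Cn n) n →ₗ[ℂ] ℂ :=
  (exteriorPower.pairingDual ℂ (Cn n) n).flip (exteriorPower.ιMulti ℂ n (ddz n))

/-- The component `u` of `v = u ⊗ (dz^1 ∧ ⋯ ∧ dz^n)`. -/
def coefAL : ALFib (Cn n) n →ₗ[ℂ] ExteriorAlgebra ℂ (AFib (Cn n)) :=
  (TensorProduct.rid ℂ _).toLinearMap ∘ₗ (coefL n).lTensor (ExteriorAlgebra ℂ (AFib (Cn n)))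

end Frames

/-! ## Operators in a holomorphic chart

Sections over an open subset of `ℂⁿ` are functions on `ℂⁿ`, used near the point of evaluation. -/

section Local

variable {n : ℕ}

/-- `∂λ = ∑ dz^i ∧ ∂λ/∂z^i` on differential forms. -/
def delLoc (w : Cn n → ExteriorAlgebra ℂ (TCDual (Cn n))) (z : Cn n) :
    ExteriorAlgebra ℂ (TCDual (Cn n)) :=
  ∑ i, ExteriorAlgebra.ι ℂ (dzT n i) * pd i w z

/-- `∂̄λ = ∑ dz̄^i ∧ ∂λ/∂z̄^i` on differential forms. -/
def delbarLoc (w : Cn n → ExteriorAlgebra ℂ (TCDual (Cn n))) (z : Cn n) :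
    ExteriorAlgebra ℂ (TCDual (Cn n)) :=
  ∑ i, ExteriorAlgebra.ι ℂ (dzbarT n i) * pdBar i w z

/-- `∂̄` on sections of `∧^• A`: `∂̄u = ∑ dz̄^i ∧ ∂u/∂z̄^i`, components being taken in the
frame `∂/∂z^i, dz̄^i`. This is the differential `d_*` of the Lie algebroid `A^*`. -/
def dbarMVLoc (u : Cn n → ExteriorAlgebra ℂ (AFib (Cn n))) (z : Cn n) :
    ExteriorAlgebra ℂ (AFib (Cn n)) :=
  ∑ i, ExteriorAlgebra.ι ℂ ((0, dzbar n i) : AFib (Cn n)) * pdBar i u z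

/-- The Schouten bracket of the Lie algebroid `A` on sections `u` of `∧^p A` and `v` of `∧^q A`:
the frame elements `∂/∂z^i, dz̄^i` commute and have anchors `∂/∂z^i, 0`, so
`[u, v] = ∑ (u ⌊ dz^i) ∧ ∂v/∂z^i - (-1)^{(p-1)(q-1)} ∑ (v ⌊ dz^i) ∧ ∂u/∂z^i`. -/
def schoutenLoc (p q : ℕ) (u v : Cn n → ExteriorAlgebra ℂ (AFib (Cn n))) (z : Cn n) :
    ExteriorAlgebra ℂ (AFib (Cn n)) :=
  (∑ i, CliffordAlgebra.contractRight (u z) (pairA (coframeA n (.inl i))) * pd i v z) -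
    (-1 : ℂ) ^ ((p + 1) * (q + 1)) •
      ∑ i, CliffordAlgebra.contractRight (v z) (pairA (coframeA n (.inl i))) * pd i u z

/-- `∂̄^H u = ∂̄u + [H, u]` for a section `u` of `∧^k A`. -/
def dbarHLoc (H : Cn n → ExteriorAlgebra ℂ (AFib (Cn n))) (k : ℕ)
    (u : Cn n → ExteriorAlgebra ℂ (AFib (Cn n))) (z : Cn n) : ExteriorAlgebra ℂ (AFib (Cn n)) :=
  dbarMVLoc u z + schoutenLoc 2 k H u z

/-- The derivative of the components of `f` along a complex tangent vector. -/
def along {F : Type*} [AddCommGroup F] [Module ℂ F] [Module.Finite ℂ F] (Z : TC (Cn n))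
    (f : Cn n → F) (z : Cn n) : F :=
  ∑ i, (dz n i Z.1 • pd i f z + Z.2 (dzbar n i) • pdBar i f z)

/-- The bracket of the Lie algebroid `A`, in which the frame elements commute. -/
def bracketA (u v : Cn n → AFib (Cn n)) (z : Cn n) : AFib (Cn n) :=
  along (anchorA (u z)) v z - along (anchorA (v z)) u z

/-- The bracket `[α, β]_*` of the Lie algebroid `A^*`, in which the frame elements commute. -/
def bracketStar (α β : Cn n → ADual (Cn n)) (z : Cn n) : ADual (Cn n) :=
  along (anchorStar (α z)) β z - along (anchorStar (β z)) α z

/-- The Lie derivative of the Lie algebroid `A`, for sections `u` of `A` and `β` of `A^*`: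
`⟨L_u β, v⟩ = a(u)⟨β, v⟩ - ⟨β, [u, v]⟩`, written out on the frame of `A`. -/
def lieA (u : Cn n → AFib (Cn n)) (β : Cn n → ADual (Cn n)) (z : Cn n) : ADual (Cn n) :=
  ∑ j, (along (anchorA (u z)) (fun y => pairA (β y) (frameA n j)) z -
    pairA (β z) (bracketA u (fun _ => frameA n j) z)) • coframeA n j

/-- The differential `Γ(∧⁰ A^*) → Γ(∧¹ A^*)` of the Lie algebroid `A`: `f ↦ ∂f`. -/
def dFun (f : Cn n → ℂ) (z : Cn n) : ADual (Cn n) := ∑ i, pd i f z • coframeA n (.inl i)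

/-- The anchor `a_*^H = a_* + a ∘ H^♯` of `A^*_H`. -/
def anchorH (H : Cn n → ExteriorAlgebra ℂ (AFib (Cn n))) (α : Cn n → ADual (Cn n)) (z : Cn n) :
    TC (Cn n) :=
  anchorStar (α z) + anchorA (sharp (H z) (α z))

/-- The bracket of `A^*_H`:
`[α, β]_*^H = [α, β]_* + L_{H^♯ α} β - L_{H^♯ β} α - d⟨H^♯ α, β⟩`. -/
def bracketH (H : Cn n → ExteriorAlgebra ℂ (AFib (Cn n))) (α β : Cn n → ADual (Cn n))
    (z : Cn n) : ADual (Cn n) :=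
  bracketStar α β z + lieA (fun y => sharp (H y) (α y)) β z -
    lieA (fun y => sharp (H y) (β y)) α z - dFun (fun y => pairA (β y) (sharp (H y) (α y))) z

/-- The exterior derivative `d = ∂ + ∂̄`. -/
def extdLoc (w : Cn n → ExteriorAlgebra ℂ (TCDual (Cn n))) (z : Cn n) :
    ExteriorAlgebra ℂ (TCDual (Cn n)) := delLoc w z + delbarLoc w z

/-- The Lie derivative `L_Z = d ι_Z + ι_Z d` of forms along a complex vector field. -/
def lieForm (Z : Cn n → TC (Cn n)) (w : Cn n → ExteriorAlgebra ℂ (TCDual (Cn n))) (z : Cn n) :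
    ExteriorAlgebra ℂ (TCDual (Cn n)) :=
  extdLoc (fun y => CliffordAlgebra.contractLeft (pairT (Z y)) (w y)) z +
    CliffordAlgebra.contractLeft (pairT (Z z)) (extdLoc w z)

/-- The Evens-Lu-Weinstein representation of `A^*_H` on `∧^{2n} A^* ⊗ ∧^{2n} T_ℂ^*`:
`∇_α (α₁ ∧ ⋯ ∧ α_{2n} ⊗ μ) = ∑ α₁ ∧ ⋯ ∧ [α, α_i] ∧ ⋯ ∧ α_{2n} ⊗ μ`
`+ α₁ ∧ ⋯ ∧ α_{2n} ⊗ L_{a(α)} μ`. -/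
def nablaQ (H : Cn n → ExteriorAlgebra ℂ (AFib (Cn n))) (α : Cn n → ADual (Cn n))
    (e : Fin (n + n) → Cn n → ADual (Cn n)) (μ : Cn n → ExteriorAlgebra ℂ (TCDual (Cn n)))
    (z : Cn n) : ExteriorAlgebra ℂ (ADual (Cn n)) ⊗[ℂ] ExteriorAlgebra ℂ (TCDual (Cn n)) :=
  (∑ i, ExteriorAlgebra.ιMulti ℂ (n + n)
      (Function.update (fun j => e j z) i (bracketH H α (e i) z)) ⊗ₜ[ℂ] μ z) +
    ExteriorAlgebra.ιMulti ℂ (n + n) (fun j => e j z) ⊗ₜ[ℂ] lieForm (anchorH H α) μ z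

variable (n) in
/-- The frame `∂/∂z̄^1, …, ∂/∂z̄^n, dz^1, …, dz^n` of `A^*`. -/
def frameQ : Fin (n + n) → ADual (Cn n) :=
  Fin.append (fun i => coframeA n (.inr i)) (fun i => coframeA n (.inl i))

variable (n) in
/-- `dz^1 ∧ ⋯ ∧ dz^n ∧ dz̄^1 ∧ ⋯ ∧ dz̄^n`. -/
def volForm : ExteriorAlgebra ℂ (TCDual (Cn n)) :=
  ExteriorAlgebra.ιMulti ℂ (n + n) (Fin.append (dzT n) (dzbarT n))

/-- The function `c_α` such that `∇_α q = c_α q`, where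
`q = (∂/∂z̄^1 ∧ ⋯ ∧ ∂/∂z̄^n ∧ dz^1 ∧ ⋯ ∧ dz^n) ⊗ (dz^1 ∧ ⋯ ∧ dz^n ∧ dz̄^1 ∧ ⋯ ∧ dz̄^n)`
is the coordinate frame of the Evens-Lu-Weinstein module. -/
def elwCoef (H : Cn n → ExteriorAlgebra ℂ (AFib (Cn n))) (α : Cn n → ADual (Cn n)) (z : Cn n) :
    ℂ :=
  Classical.epsilon fun c : ℂ =>
    nablaQ H α (fun j _ => frameQ n j) (fun _ => volForm n) z =
      c • (ExteriorAlgebra.ιMulti ℂ (n + n) (frameQ n) ⊗ₜ[ℂ] volForm n)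

/-- The representation of `A^*_H` on `ℒ = Q^{1/2}`. The isomorphism `ℒ ⊗ ℒ ≅ Q` sends `s ⊗ s` to
the frame `q` of `elwCoef`, where `s = dz^1 ∧ ⋯ ∧ dz^n`. As it intertwines the representations,
`∇_α s = (c_α / 2) s`, and so `∇_α (f s) = (a_*^H(α) f) s + f (c_α / 2) s`. -/
def nablaL (H : Cn n → ExteriorAlgebra ℂ (AFib (Cn n))) (α : Cn n → ADual (Cn n))
    (s : Cn n → LFib (Cn n) n) (z : Cn n) : LFib (Cn n) n :=
  (along (anchorH H α z) (fun y => coefL n (s y)) z + coefL n (s z) * (elwCoef H α z / 2)) •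
    holFrame n

/-- `D^H s`, the section of `A ⊗ ℒ` such that `ι_α D^H s = ∇_α s`. -/
def DLoc (H : Cn n → ExteriorAlgebra ℂ (AFib (Cn n))) (s : Cn n → LFib (Cn n) n) (z : Cn n) :
    ALFib (Cn n) n :=
  ∑ j, ExteriorAlgebra.ι ℂ (frameA n j) ⊗ₜ[ℂ] nablaL H (fun _ => coframeA n j) s z

/-- The operator `u ⊗ s ↦ (∂̄^H u) ⊗ s + (-1)^k u ∧ D^H s` on sections of `∧^k A ⊗ ℒ`. As `ℒ` is a
line bundle with frame `s₀ = dz^1 ∧ ⋯ ∧ dz^n`, a local section is `u ⊗ s₀` for a unique `u`, and the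
rule is applied to that expression; by the Leibniz rules of `∂̄^H` and `D^H` every other
expression `u' ⊗ f s₀` of the section gives the same result. -/
def bdeeLoc (H : Cn n → ExteriorAlgebra ℂ (AFib (Cn n))) (k : ℕ) (v : Cn n → ALFib (Cn n) n)
    (z : Cn n) : ALFib (Cn n) n :=
  dbarHLoc H k (fun y => coefAL n (v y)) z ⊗ₜ[ℂ] holFrame n +
    (-1 : ℂ) ^ k • (LinearMap.mulLeft ℂ (coefAL n (v z))).rTensor (LFib (Cn n) n)
      (DLoc H (fun _ => holFrame n) z)

end Local

/-! ## Sections over a complex manifold -/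

section Global

variable {n : ℕ} {X : Type*} [TopologicalSpace X] [ChartedSpace (Cn n) X]

variable (n) in
/-- The holomorphic tangent space of `X` at `x`. -/
abbrev TX (x : X) : Type := TangentSpace 𝓘(ℂ, Cn n) x

/-- The differential of a chart. -/
def dchart (φ : OpenPartialHomeomorph X (Cn n)) (x : X) : TX n x →L[ℂ] Cn n :=
  mfderiv 𝓘(ℂ, Cn n) 𝓘(ℂ, Cn n) φ x

/-- The inverse of the differential of a chart. -/
def dchartInv (φ : OpenPartialHomeomorph X (Cn n)) (x : X) : Cn n →L[ℂ] TX n x :=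
  (dchart φ x).inverse

/-- Sections of `∧^• A`, not necessarily smooth. -/
abbrev MVField (n : ℕ) (X : Type*) [TopologicalSpace X] [ChartedSpace (Cn n) X] : Type _ :=
  ∀ x : X, ExteriorAlgebra ℂ (AFib (TX n x))

/-- Sections of `∧^• A ⊗ ℒ`, not necessarily smooth. -/
abbrev ALField (n : ℕ) (X : Type*) [TopologicalSpace X] [ChartedSpace (Cn n) X] : Type _ :=
  ∀ x : X, ALFib (TX n x) n

/-- Complex differential forms, not necessarily smooth. -/
abbrev FormField (n : ℕ) (X : Type*) [TopologicalSpace X] [ChartedSpace (Cn n) X] : Type _ :=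
  ∀ x : X, ExteriorAlgebra ℂ (TCDual (TX n x))

/-- The trivialization of `∧^• A` at `x` given by a chart. -/
def mvRep (φ : OpenPartialHomeomorph X (Cn n)) (x : X) :
    ExteriorAlgebra ℂ (AFib (TX n x)) →ₗ[ℂ] ExteriorAlgebra ℂ (AFib (Cn n)) :=
  (ExteriorAlgebra.map
    (aMap (dchart φ x : TX n x →ₗ[ℂ] Cn n) (dchartInv φ x : Cn n →ₗ[ℂ] TX n x))).toLinearMap

/-- The inverse of `mvRep`. -/
def mvRepInv (φ : OpenPartialHomeomorph X (Cn n)) (x : X) :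
    ExteriorAlgebra ℂ (AFib (Cn n)) →ₗ[ℂ] ExteriorAlgebra ℂ (AFib (TX n x)) :=
  (ExteriorAlgebra.map
    (aMap (dchartInv φ x : Cn n →ₗ[ℂ] TX n x) (dchart φ x : TX n x →ₗ[ℂ] Cn n))).toLinearMap

/-- The trivialization of `∧^• A ⊗ ℒ` at `x` given by a chart. -/
def alRep (φ : OpenPartialHomeomorph X (Cn n)) (x : X) :
    ALFib (TX n x) n →ₗ[ℂ] ALFib (Cn n) n :=
  alMap n (dchart φ x : TX n x →ₗ[ℂ] Cn n) (dchartInv φ x : Cn n →ₗ[ℂ] TX n x)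

/-- The inverse of `alRep`. -/
def alRepInv (φ : OpenPartialHomeomorph X (Cn n)) (x : X) :
    ALFib (Cn n) n →ₗ[ℂ] ALFib (TX n x) n :=
  alMap n (dchartInv φ x : Cn n →ₗ[ℂ] TX n x) (dchart φ x : TX n x →ₗ[ℂ] Cn n)

/-- The trivialization of `∧^• T_ℂ^*` at `x` given by a chart. -/
def formRep (φ : OpenPartialHomeomorph X (Cn n)) (x : X) :
    ExteriorAlgebra ℂ (TCDual (TX n x)) →ₗ[ℂ] ExteriorAlgebra ℂ (TCDual (Cn n)) :=
  (ExteriorAlgebra.map (tMap (dchartInv φ x : Cn n →ₗ[ℂ] TX n x))).toLinearMap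

/-- The inverse of `formRep`. -/
def formRepInv (φ : OpenPartialHomeomorph X (Cn n)) (x : X) :
    ExteriorAlgebra ℂ (TCDual (Cn n)) →ₗ[ℂ] ExteriorAlgebra ℂ (TCDual (TX n x)) :=
  (ExteriorAlgebra.map (tMap (dchart φ x : TX n x →ₗ[ℂ] Cn n))).toLinearMap

section Localize

variable {Fib : X → Type*} [∀ x, AddCommGroup (Fib x)] [∀ x, Module ℂ (Fib x)]
  {F : Type*} [AddCommGroup F] [Module ℂ F]

/-- The local expression of a section in a chart, for trivializations `ρ`. -/
def localize (ρ : OpenPartialHomeomorph X (Cn n) → ∀ x : X, Fib x →ₗ[ℂ] F)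
    (s : ∀ x, Fib x) (φ : OpenPartialHomeomorph X (Cn n)) (z : Cn n) : F :=
  ρ φ (φ.symm z) (s (φ.symm z))

/-- Smoothness of a section: its local expression in each chart of the atlas has smooth
components. -/
def IsSmooth (ρ : OpenPartialHomeomorph X (Cn n) → ∀ x : X, Fib x →ₗ[ℂ] F)
    (s : ∀ x, Fib x) : Prop :=
  ∀ φ ∈ atlas (Cn n) X, ∀ ℓ : Module.Dual ℂ F,
    ContDiffOn ℝ ∞ (fun z => ℓ (localize ρ s φ z)) φ.target

variable {ρ : OpenPartialHomeomorph X (Cn n) → ∀ x : X, Fib x →ₗ[ℂ] F}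

theorem localize_add (s t : ∀ x, Fib x) (φ : OpenPartialHomeomorph X (Cn n)) :
    localize ρ (s + t) φ = fun z => localize ρ s φ z + localize ρ t φ z := by
  funext z
  simp [localize]

theorem localize_smul (c : ℂ) (s : ∀ x, Fib x) (φ : OpenPartialHomeomorph X (Cn n)) :
    localize ρ (c • s) φ = fun z => c • localize ρ s φ z := by
  funext z
  simp [localize]

variable (ρ) in
/-- The space of smooth sections. -/
def smoothSections : Submodule ℂ (∀ x, Fib x) where
  carrier := {s | IsSmooth ρ s}
  add_mem' := by
    intro s t hs ht φ hφ ℓ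
    simp only [localize_add, map_add]
    exact (hs φ hφ ℓ).add (ht φ hφ ℓ)
  zero_mem' := by
    intro φ _ ℓ
    simp only [localize, Pi.zero_apply, map_zero]
    exact contDiffOn_const
  smul_mem' := by
    intro c s hs φ hφ ℓ
    simp only [localize_smul, map_smul, smul_eq_mul]
    exact contDiffOn_const.mul (hs φ hφ ℓ)

theorem IsSmooth.cDiffAt {s : ∀ x, Fib x} (hs : IsSmooth ρ s) (x : X) :
    CDiffAt (localize ρ s (chartAt (Cn n) x)) (chartAt (Cn n) x x) := by
  intro ℓ
  have h := hs (chartAt (Cn n) x) (chart_mem_atlas _ _) ℓ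
  have ht : (chartAt (Cn n) x).target ∈ nhds (chartAt (Cn n) x x) :=
    (chartAt (Cn n) x).open_target.mem_nhds (mem_chart_target _ _)
  exact (h.contDiffAt ht).differentiableAt (by simp)

end Localize

/-! ### Operators on sections, evaluated at `x` in the chart at `x` -/

/-- `∂` on forms. -/
def del (w : FormField n X) : FormField n X := fun x =>
  formRepInv (chartAt (Cn n) x) x
    (delLoc (localize formRep w (chartAt (Cn n) x)) (chartAt (Cn n) x x))

/-- `∂̄` on forms. -/
def delbar (w : FormField n X) : FormField n X := fun x =>
  formRepInv (chartAt (Cn n) x) x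
    (delbarLoc (localize formRep w (chartAt (Cn n) x)) (chartAt (Cn n) x x))

/-- `∂̄` on sections of `∧^• A`. -/
def dbarMV (u : MVField n X) : MVField n X := fun x =>
  mvRepInv (chartAt (Cn n) x) x
    (dbarMVLoc (localize mvRep u (chartAt (Cn n) x)) (chartAt (Cn n) x x))

/-- The Schouten bracket of sections of `∧^p A` and `∧^q A`. -/
def schouten (p q : ℕ) (u v : MVField n X) : MVField n X := fun x =>
  mvRepInv (chartAt (Cn n) x) x
    (schoutenLoc p q (localize mvRep u (chartAt (Cn n) x))
      (localize mvRep v (chartAt (Cn n) x)) (chartAt (Cn n) x x))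

/-- `ι_H λ = - H · λ`, pointwise. -/
def iotaH (H : MVField n X) (w : FormField n X) : FormField n X := fun x =>
  -clifford (TX n x) (H x) (w x)

/-- `∂̄ + [∂, ι_H]`, with `[∂, ι_H] = ∂ ∘ ι_H - ι_H ∘ ∂`. -/
def koszul (H : MVField n X) (w : FormField n X) : FormField n X :=
  delbar w + (del (iotaH H w) - iotaH H (del w))

/-- The differential `∂̄_*^H` on sections of `∧^k A ⊗ ℒ`. -/
def bdee (H : MVField n X) (k : ℕ) (v : ALField n X) : ALField n X := fun x =>
  alRepInv (chartAt (Cn n) x) x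
    (bdeeLoc (localize mvRep H (chartAt (Cn n) x)) k (localize alRep v (chartAt (Cn n) x))
      (chartAt (Cn n) x x))

/-- `τ` on sections. -/
def tau (v : ALField n X) : FormField n X := fun x => tauFib (TX n x) n (v x)

variable (n X) in
/-- An extended Poisson structure: a smooth section `H` of `∧² A` with `∂̄H + ½[H, H] = 0`. -/
structure ExtendedPoisson where
  /-- the section -/
  field : MVField n X
  smooth : IsSmooth mvRep field
  degree : ∀ x, field x ∈ ⋀[ℂ]^2 (AFib (TX n x))
  maurerCartan : dbarMV field + (1 / 2 : ℂ) • schouten 2 2 field field = 0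

variable (n X) in
/-- `Γ(∧^k A ⊗ ℒ)`. -/
def alSections (k : ℕ) : Submodule ℂ (ALField n X) :=
  smoothSections (alRep (n := n) (X := X)) ⊓ Submodule.pi Set.univ fun x => alDegree (TX n x) n k

variable (n X) in
/-- `⨁_{i - j = n - k} Ω^{i,j}(X)`. -/
def formSections (k : ℕ) : Submodule ℂ (FormField n X) :=
  smoothSections (formRep (n := n) (X := X)) ⊓
    Submodule.pi Set.univ fun x => formDegree (TX n x) n k

/-! ### Linearity of the differentials on smooth sections -/

theorem dchartInv_comp_dchart [IsManifold 𝓘(ℂ, Cn n) ω X] {φ : OpenPartialHomeomorph X (Cn n)}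
    (hφ : φ ∈ atlas (Cn n) X) {x : X} (hx : x ∈ φ.source) :
    (dchartInv φ x : Cn n →ₗ[ℂ] TX n x) ∘ₗ (dchart φ x : TX n x →ₗ[ℂ] Cn n) =
      LinearMap.id := by
  have hd : φ.MDifferentiable 𝓘(ℂ, Cn n) 𝓘(ℂ, Cn n) := mdifferentiable_of_mem_atlas hφ
  have hinv : (dchart φ x).IsInvertible := ⟨hd.mfderiv hx, rfl⟩
  refine LinearMap.ext fun v => ?_
  exact hinv.inverse_apply_self v

theorem iotaH_cDiffAt [IsManifold 𝓘(ℂ, Cn n) ω X] {H : MVField n X} (hH : IsSmooth mvRep H)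
    {w : FormField n X} (hw : IsSmooth formRep w) (x : X) :
    CDiffAt (localize formRep (iotaH H w) (chartAt (Cn n) x)) (chartAt (Cn n) x x) := by
  have h := CDiffAt.bilin (-(clifford (Cn n)).toLinearMap) (hH.cDiffAt x) (hw.cDiffAt x)
  have ht : (chartAt (Cn n) x).target ∈ nhds (chartAt (Cn n) x x) :=
    (chartAt (Cn n) x).open_target.mem_nhds (mem_chart_target _ _)
  intro ℓ
  refine (h ℓ).congr_of_eventuallyEq ?_
  filter_upwards [ht] with z hz
  congr 1
  have hs : (chartAt (Cn n) x).symm z ∈ (chartAt (Cn n) x).source :=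
    (chartAt (Cn n) x).map_target hz
  simp only [localize, iotaH, map_neg, LinearMap.neg_apply, neg_inj]
  exact (clifford_map _ _ (dchartInv_comp_dchart (chart_mem_atlas _ _) hs) _ _).symm

theorem del_add {w w' : FormField n X} {x : X}
    (hw : CDiffAt (localize formRep w (chartAt (Cn n) x)) (chartAt (Cn n) x x))
    (hw' : CDiffAt (localize formRep w' (chartAt (Cn n) x)) (chartAt (Cn n) x x)) :
    del (w + w') x = del w x + del w' x := by
  simp only [del, localize_add, delLoc, pd_add _ hw hw', mul_add, Finset.sum_add_distrib, map_add]

theorem del_smul (c : ℂ) {w : FormField n X} {x : X}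
    (hw : CDiffAt (localize formRep w (chartAt (Cn n) x)) (chartAt (Cn n) x x)) :
    del (c • w) x = c • del w x := by
  simp only [del, localize_smul, delLoc, pd_smul _ c hw, mul_smul_comm, ← Finset.smul_sum,
    map_smul]

theorem delbar_add {w w' : FormField n X} {x : X}
    (hw : CDiffAt (localize formRep w (chartAt (Cn n) x)) (chartAt (Cn n) x x))
    (hw' : CDiffAt (localize formRep w' (chartAt (Cn n) x)) (chartAt (Cn n) x x)) :
    delbar (w + w') x = delbar w x + delbar w' x := by
  simp only [delbar, localize_add, delbarLoc, pdBar_add _ hw hw', mul_add, Finset.sum_add_distrib,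
    map_add]

theorem delbar_smul (c : ℂ) {w : FormField n X} {x : X}
    (hw : CDiffAt (localize formRep w (chartAt (Cn n) x)) (chartAt (Cn n) x x)) :
    delbar (c • w) x = c • delbar w x := by
  simp only [delbar, localize_smul, delbarLoc, pdBar_smul _ c hw, mul_smul_comm,
    ← Finset.smul_sum, map_smul]

theorem iotaH_add (H : MVField n X) (w w' : FormField n X) :
    iotaH H (w + w') = iotaH H w + iotaH H w' := by
  funext x
  simp only [iotaH, Pi.add_apply, map_add, neg_add]

theorem iotaH_smul (H : MVField n X) (c : ℂ) (w : FormField n X) :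
    iotaH H (c • w) = c • iotaH H w := by
  funext x
  simp [iotaH]

theorem bdeeLoc_add (H : Cn n → ExteriorAlgebra ℂ (AFib (Cn n))) (k : ℕ)
    {v v' : Cn n → ALFib (Cn n) n} {z : Cn n} (hv : CDiffAt v z) (hv' : CDiffAt v' z) :
    bdeeLoc H k (fun y => v y + v' y) z = bdeeLoc H k v z + bdeeLoc H k v' z := by
  have h : CDiffAt (fun y => coefAL n (v y)) z := fun ℓ => hv (ℓ ∘ₗ coefAL n)
  have h' : CDiffAt (fun y => coefAL n (v' y)) z := fun ℓ => hv' (ℓ ∘ₗ coefAL n)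
  have e : ∀ a b : ExteriorAlgebra ℂ (AFib (Cn n)),
      LinearMap.mulLeft ℂ (a + b) = LinearMap.mulLeft ℂ a + LinearMap.mulLeft ℂ b := by
    intro a b
    refine LinearMap.ext fun c => ?_
    exact add_mul a b c
  have hD : dbarHLoc H k (fun y => coefAL n (v y) + coefAL n (v' y)) z =
      dbarHLoc H k (fun y => coefAL n (v y)) z + dbarHLoc H k (fun y => coefAL n (v' y)) z := by
    simp only [dbarHLoc, dbarMVLoc, schoutenLoc, map_add, LinearMap.add_apply, pd_add _ h h',
      pdBar_add _ h h', mul_add _ (pdBar _ _ _), mul_add _ (pd _ _ _), add_mul _ _ (pd _ H _),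
      Finset.sum_add_distrib, smul_add]
    abel
  simp only [bdeeLoc, map_add, hD, e, LinearMap.rTensor_add, LinearMap.add_apply, smul_add,
    TensorProduct.add_tmul]
  abel

theorem bdeeLoc_smul (H : Cn n → ExteriorAlgebra ℂ (AFib (Cn n))) (k : ℕ) (c : ℂ)
    {v : Cn n → ALFib (Cn n) n} {z : Cn n} (hv : CDiffAt v z) :
    bdeeLoc H k (fun y => c • v y) z = c • bdeeLoc H k v z := by
  have h : CDiffAt (fun y => coefAL n (v y)) z := fun ℓ => hv (ℓ ∘ₗ coefAL n)
  have e : ∀ a : ExteriorAlgebra ℂ (AFib (Cn n)),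
      LinearMap.mulLeft ℂ (c • a) = c • LinearMap.mulLeft ℂ a := by
    intro a
    refine LinearMap.ext fun b => ?_
    exact smul_mul_assoc c a b
  simp only [bdeeLoc, dbarHLoc, dbarMVLoc, schoutenLoc, map_smul, pd_smul _ c h, pdBar_smul _ c h,
    mul_smul_comm, smul_mul_assoc, ← Finset.smul_sum, LinearMap.smul_apply, e,
    LinearMap.rTensor_smul]
  rw [smul_comm _ c, smul_comm _ c, ← smul_sub, ← smul_add, ← TensorProduct.smul_tmul', smul_add]

/-- `∂̄_*^H` as a linear map on `Γ(∧^k A ⊗ ℒ)`. -/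
def bdeeLin (H : ExtendedPoisson n X) (k : ℕ) : alSections n X k →ₗ[ℂ] ALField n X where
  toFun v := bdee H.field k v
  map_add' v v' := by
    funext x
    simp only [bdee, Submodule.coe_add, localize_add, Pi.add_apply]
    rw [bdeeLoc_add _ _ (IsSmooth.cDiffAt v.2.1 x) (IsSmooth.cDiffAt v'.2.1 x), map_add]
  map_smul' c v := by
    funext x
    simp only [bdee, Submodule.coe_smul, localize_smul, Pi.smul_apply, RingHom.id_apply]
    rw [bdeeLoc_smul _ _ c (IsSmooth.cDiffAt v.2.1 x), map_smul]

/-- `∂̄ + [∂, ι_H]` as a linear map on `⨁_{i - j = n - k} Ω^{i,j}(X)`. -/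
def koszulLin [IsManifold 𝓘(ℂ, Cn n) ω X] (H : ExtendedPoisson n X) (k : ℕ) :
    formSections n X k →ₗ[ℂ] FormField n X where
  toFun w := koszul H.field w
  map_add' w w' := by
    funext x
    have h1 : del (w.1 + w'.1) = del w.1 + del w'.1 := by
      funext y
      exact del_add (IsSmooth.cDiffAt w.2.1 y) (IsSmooth.cDiffAt w'.2.1 y)
    simp only [koszul, Submodule.coe_add, Pi.add_apply, Pi.sub_apply, h1, iotaH_add]
    rw [delbar_add (IsSmooth.cDiffAt w.2.1 x) (IsSmooth.cDiffAt w'.2.1 x),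
      del_add (iotaH_cDiffAt H.smooth w.2.1 x) (iotaH_cDiffAt H.smooth w'.2.1 x)]
    abel
  map_smul' c w := by
    funext x
    have h1 : del (c • w.1) = c • del w.1 := by
      funext y
      exact del_smul c (IsSmooth.cDiffAt w.2.1 y)
    simp only [koszul, Submodule.coe_smul, Pi.add_apply, Pi.sub_apply, h1, iotaH_smul,
      RingHom.id_apply, Pi.smul_apply]
    rw [delbar_smul c (IsSmooth.cDiffAt w.2.1 x),
      del_smul c (iotaH_cDiffAt H.smooth w.2.1 x), smul_add, smul_sub]

end Global

/-! ## Cohomology of a cochain complex of subspaces of a vector space -/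

section Cohomology

variable {E : Type*} [AddCommGroup E] [Module ℂ E]

/-- The cocycles of degree `k`. -/
def cocycles (C : ℕ → Submodule ℂ E) (d : ∀ k, C k →ₗ[ℂ] E) (k : ℕ) : Submodule ℂ E :=
  (LinearMap.ker (d k)).map (C k).subtype

/-- The coboundaries of degree `k`. -/
def coboundaries (C : ℕ → Submodule ℂ E) (d : ∀ k, C k →ₗ[ℂ] E) : ℕ → Submodule ℂ E
  | 0 => ⊥
  | k + 1 => LinearMap.range (d k)

/-- The cohomology in degree `k`: cocycles modulo coboundaries. -/
abbrev Cohomology (C : ℕ → Submodule ℂ E) (d : ∀ k, C k →ₗ[ℂ] E) (k : ℕ) : Type _ :=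
  cocycles C d k ⧸ (coboundaries C d k).submoduleOf (cocycles C d k)

end Cohomology

section Complexes

variable {n : ℕ} {X : Type*} [TopologicalSpace X] [ChartedSpace (Cn n) X]

/-- The cohomology of the Lie algebroid `A^*_H` with coefficients in the
half `ℒ = Q^{1/2}` of the Evens-Lu-Weinstein module. -/
abbrev ELWCohomology (H : ExtendedPoisson n X) (k : ℕ) : Type _ :=
  Cohomology (alSections n X) (bdeeLin H) k

/-- The Koszul-Brylinski Poisson homology of `(X, H)`. -/
abbrev KBHomology [IsManifold 𝓘(ℂ, Cn n) ω X] (H : ExtendedPoisson n X) (k : ℕ) : Type _ :=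
  Cohomology (formSections n X) (koszulLin H) k

end Complexes
end
end ExtPoisson

open ExtPoisson

/-! In a holomorphic chart put σ = dz^1 ∧ ⋯ ∧ dz^n. A section of `∧^• A ⊗ ℒ` is u ⊗ σ, and `τ` turns
it into the form u · σ. Everything rests on two facts about this pure spinor: it is constant in the
coordinates, and dz^i ∧ σ = 0.

Bijectivity on fibres. Euler's identity Σ dz^i ∧ ι_i w = p w on covectors of type (p, 0) gives Σ ι_i
(dz^i ∧ w) = (n - p) w. Hence type (p, 0) is reached from type (p + 1, 0) by contractions, starting
at σ, and the factors dz̄^j are themselves elements of A (`formType_le_map`). So `τ` is onto, and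
equality of dimensions makes it bijective (`tauFib_bijective`). Each element of A lowers i - j by
one, which matches the gradings (`clifford_mem`).

Intertwining. Moving dz^i past a Clifford action (`ι_mul_clifford`) gives [∂, ι_H] w = Σ (H ⌊ dz^i)
· ∂_i w - dz^i ∧ (∂_i H · w), see `brLoc_eq`. For w = u · σ the same rule, with dz^i ∧ σ = 0, turns
the sum into [H, u] · σ plus (-1)^k (u ∧ Σ ∂_i H ⌊ dz^i) · σ (`clifford_schouten_term`). It remains
to see that D^H σ is the divergence Σ ∂_i H ⌊ dz^i, tensored with σ. On the coordinate frame of Q,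
∇^H_α for constant α is multiplication by twice the divergence of H^♯ α: once from the brackets,
once from the Lie derivative of the volume form (`nablaQ_const`). The square root halves this
(`DLoc_holFrame`).

Square zero. One has [∂̄, ι_H] = -(∂̄H) · and [[∂, ι_H], ι_H] = -[H, H] · as operators, so the
Maurer-Cartan equation says that C = [∂̄, ι_H] + ½ [[∂, ι_H], ι_H] vanishes. From ∂² = ∂̄² = ∂∂̄ +
∂̄∂ = 0 it follows formally that (∂̄ + [∂, ι_H])² = -(∂C + C∂) = 0 (`sq_eq_zero_of_commutator`). For
`∂̄_*^H` both the square and the smoothness of the image are transported through `τ`.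

Globalization. The operators at x are computed in the preferred chart at x, while iterating them
involves the preferred charts of nearby points. This requires invariance of ∂ and ∂̄ under
holomorphic coordinate changes (`dolb_pull`, `localize_dolbeault`). The operator `∂̄_*^H` needs no
separate check: the intertwining relation compares both sides at x in the same chart. -/

open ExtPoisson

namespace ExtPoisson

noncomputable section

/-! ## Wirtinger derivatives of vector-valued functions -/

section WirtingerCalculus

variable {n : ℕ}

/-- The Wirtinger derivative `∂/∂z^i` for `ε = 1` and `∂/∂z̄^i` for `ε = -1`. -/
def wd (ε : ℂ) (i : Fin n) (f : Cn n → ℂ) (z : Cn n) : ℂ :=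
  (fderiv ℝ f z (Pi.single i 1) - ε * Complex.I * fderiv ℝ f z (Pi.single i Complex.I)) / 2

theorem wirtinger_eq (i : Fin n) (f : Cn n → ℂ) (z : Cn n) : wirtinger i f z = wd 1 i f z := by
  simp [wirtinger, wd]

theorem wirtingerBar_eq (i : Fin n) (f : Cn n → ℂ) (z : Cn n) :
    wirtingerBar i f z = wd (-1) i f z := by
  simp [wirtingerBar, wd]

theorem wd_congr {ε : ℂ} {i : Fin n} {f g : Cn n → ℂ} {z : Cn n} (h : f =ᶠ[nhds z] g) :
    wd ε i f z = wd ε i g z := by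
  simp only [wd, h.fderiv_eq]

theorem wd_const (ε : ℂ) (i : Fin n) (c : ℂ) (z : Cn n) : wd ε i (fun _ => c) z = 0 := by
  simp [wd]

theorem wd_add (ε : ℂ) (i : Fin n) {f g : Cn n → ℂ} {z : Cn n} (hf : DifferentiableAt ℝ f z)
    (hg : DifferentiableAt ℝ g z) : wd ε i (fun y => f y + g y) z = wd ε i f z + wd ε i g z := by
  simp only [wd, fderiv_fun_add hf hg, add_apply]
  ring

theorem wd_mul (ε : ℂ) (i : Fin n) {f g : Cn n → ℂ} {z : Cn n} (hf : DifferentiableAt ℝ f z)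
    (hg : DifferentiableAt ℝ g z) :
    wd ε i (fun y => f y * g y) z = wd ε i f z * g z + f z * wd ε i g z := by
  simp only [wd, fderiv_fun_mul hf hg, add_apply, smul_apply, smul_eq_mul]
  ring

theorem wd_const_mul (ε : ℂ) (i : Fin n) (c : ℂ) {f : Cn n → ℂ} {z : Cn n}
    (hf : DifferentiableAt ℝ f z) : wd ε i (fun y => c * f y) z = c * wd ε i f z := by
  simp only [wd, fderiv_const_mul hf, smul_apply, smul_eq_mul]
  ring

theorem wd_sum {ι : Type*} (ε : ℂ) (i : Fin n) (s : Finset ι) {f : ι → Cn n → ℂ} {z : Cn n}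
    (hf : ∀ b ∈ s, DifferentiableAt ℝ (f b) z) :
    wd ε i (fun y => ∑ b ∈ s, f b y) z = ∑ b ∈ s, wd ε i (f b) z := by
  simp only [wd, fderiv_fun_sum hf, sum_apply, Finset.mul_sum, ← Finset.sum_sub_distrib,
    Finset.sum_div]

theorem contDiffAt_wd {ε : ℂ} {i : Fin n} {f : Cn n → ℂ} {z : Cn n} (hf : ContDiffAt ℝ ∞ f z) :
    ContDiffAt ℝ ∞ (wd ε i f) z := by
  have h : ContDiffAt ℝ ∞ (fderiv ℝ f) z := hf.fderiv_right (by simp)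
  unfold wd
  exact ((h.clm_apply contDiffAt_const).sub
    (contDiffAt_const.mul (h.clm_apply contDiffAt_const))).div_const 2

theorem wd_comm (ε δ : ℂ) (i j : Fin n) {f : Cn n → ℂ} {z : Cn n} (hf : ContDiffAt ℝ ∞ f z) :
    wd ε i (wd δ j f) z = wd δ j (wd ε i f) z := by
  have h : DifferentiableAt ℝ (fderiv ℝ f) z :=
    (hf.fderiv_right (m := 1) (by norm_cast)).differentiableAt (by simp)
  have hv : ∀ v : Cn n, DifferentiableAt ℝ (fun y => fderiv ℝ f y v) z :=
    fun v => h.clm_apply (differentiableAt_const v)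
  have key : ∀ (ε : ℂ) (j : Fin n) (w : Cn n), fderiv ℝ (wd ε j f) z w =
      (fderiv ℝ (fderiv ℝ f) z w (Pi.single j 1) -
        ε * Complex.I * fderiv ℝ (fderiv ℝ f) z w (Pi.single j Complex.I)) / 2 := by
    intro ε j w
    have e : wd ε j f = fun y => (fderiv ℝ f y (Pi.single j 1) -
      (ε * Complex.I) * fderiv ℝ f y (Pi.single j Complex.I)) * 2⁻¹ := by
      funext y
      rw [wd, div_eq_mul_inv]
    have hd : ∀ v : Cn n, fderiv ℝ (fun y => fderiv ℝ f y v) z w = fderiv ℝ (fderiv ℝ f) z w v := by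
      intro v
      rw [fderiv_clm_apply h (differentiableAt_const v)]
      simp
    rw [e, fderiv_mul_const ((hv _).fun_sub ((hv _).const_mul _)), fderiv_fun_sub (hv _) ((hv _).const_mul _),
      fderiv_const_mul (hv _)]
    simp only [smul_apply, sub_apply, smul_eq_mul, hd]
    ring
  -- Both iterated derivatives are combinations of second real derivatives; only their symmetry is
  -- used.
  have hs := (hf.isSymmSndFDerivAt (by
    simpa using WithTop.coe_le_coe.2 (le_top (a := (2 : ℕ∞))))).eq
  rw [wd, wd, key, key, key, key, hs (Pi.single i 1) (Pi.single j 1),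
    hs (Pi.single i 1) (Pi.single j Complex.I), hs (Pi.single i Complex.I) (Pi.single j 1),
    hs (Pi.single i Complex.I) (Pi.single j Complex.I)]
  ring

/-- The splitting df = ∂f + ∂̄f evaluated on a real tangent vector. The chain rule `wd_comp` rests
on it. -/
theorem fderiv_eq_sum_wd (f : Cn n → ℂ) (z v : Cn n) :
    fderiv ℝ f z v = ∑ i, (v i * wd 1 i f z + starRingEnd ℂ (v i) * wd (-1) i f z) := by
  have hv : v = ∑ i, ((v i).re • (Pi.single i 1 : Cn n) +
      (v i).im • (Pi.single i Complex.I : Cn n)) := by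
    ext j
    simp only [Finset.sum_apply, Pi.add_apply, Pi.smul_apply, Pi.single_apply]
    rw [Finset.sum_eq_single j]
    · simp
    · intro b _ hb
      simp [Ne.symm hb]
    · simp
  conv_lhs => rw [hv]
  simp only [map_sum, map_add, map_smul]
  refine Finset.sum_congr rfl fun i _ => ?_
  have h1 : starRingEnd ℂ (v i) = (v i).re - (v i).im * Complex.I := by
    apply Complex.ext <;> simp
  have h2 : v i = (v i).re + (v i).im * Complex.I := (Complex.re_add_im (v i)).symm
  rw [h1, wd, wd, Complex.real_smul, Complex.real_smul]
  generalize (v i).re = x at *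
  generalize (v i).im = y at *
  rw [h2]
  linear_combination (y * fderiv ℝ f z (Pi.single i Complex.I) : ℂ) * Complex.I_sq

variable {F : Type*} [AddCommGroup F] [Module ℂ F]

/-- Smoothness at a point of a function into a finite-dimensional complex space. -/
def CSmoothAt (f : Cn n → F) (z : Cn n) : Prop :=
  ∀ ℓ : Module.Dual ℂ F, ContDiffAt ℝ ∞ (fun y => ℓ (f y)) z

theorem CSmoothAt.cDiffAt {f : Cn n → F} {z : Cn n} (h : CSmoothAt f z) : CDiffAt f z :=
  fun ℓ => (h ℓ).differentiableAt (by simp)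

theorem CSmoothAt.congr {f g : Cn n → F} {z : Cn n} (h : CSmoothAt f z) (e : g =ᶠ[nhds z] f) :
    CSmoothAt g z :=
  fun ℓ => (h ℓ).congr_of_eventuallyEq (by filter_upwards [e] with y hy; rw [hy])

theorem cSmoothAt_const (c : F) (z : Cn n) : CSmoothAt (fun _ : Cn n => c) z :=
  fun _ => contDiffAt_const

theorem cSmoothAt_scalar {f : Cn n → ℂ} {z : Cn n} : CSmoothAt f z ↔ ContDiffAt ℝ ∞ f z := by
  refine ⟨fun h => h LinearMap.id, fun h ℓ => ?_⟩
  have : (fun y => ℓ (f y)) = fun y => f y * ℓ 1 := by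
    funext y
    rw [← smul_eq_mul, ← map_smul, smul_eq_mul, mul_one]
  rw [this]
  exact h.mul contDiffAt_const

theorem CSmoothAt.add {f g : Cn n → F} {z : Cn n} (hf : CSmoothAt f z) (hg : CSmoothAt g z) :
    CSmoothAt (fun y => f y + g y) z := by
  intro ℓ
  simp only [map_add]
  exact (hf ℓ).add (hg ℓ)

theorem CSmoothAt.sum {ι : Type*} (s : Finset ι) {f : ι → Cn n → F} {z : Cn n}
    (hf : ∀ b ∈ s, CSmoothAt (f b) z) : CSmoothAt (fun y => ∑ b ∈ s, f b y) z := by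
  intro ℓ
  simp only [map_sum]
  exact ContDiffAt.sum fun b hb => hf b hb ℓ

section Linear

variable {G : Type*} [AddCommGroup G] [Module ℂ G]

theorem CSmoothAt.linear (L : F →ₗ[ℂ] G) {f : Cn n → F} {z : Cn n} (hf : CSmoothAt f z) :
    CSmoothAt (fun y => L (f y)) z :=
  fun ℓ => hf (ℓ ∘ₗ L)

theorem CDiffAt.linear (L : F →ₗ[ℂ] G) {f : Cn n → F} {z : Cn n} (hf : CDiffAt f z) :
    CDiffAt (fun y => L (f y)) z :=
  fun ℓ => hf (ℓ ∘ₗ L)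

end Linear

variable [Module.Finite ℂ F]

/-- The Wirtinger derivative of a vector-valued function. -/
def wdv (ε : ℂ) (i : Fin n) (f : Cn n → F) (z : Cn n) : F :=
  ∑ b, wd ε i (fun y => (Module.finBasis ℂ F).coord b (f y)) z • Module.finBasis ℂ F b

theorem pd_eq (i : Fin n) (f : Cn n → F) (z : Cn n) : pd i f z = wdv 1 i f z := by
  simp only [pd, wdv, wirtinger_eq]

theorem pdBar_eq (i : Fin n) (f : Cn n → F) (z : Cn n) : pdBar i f z = wdv (-1) i f z := by
  simp only [pdBar, wdv, wirtingerBar_eq]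

theorem wdv_congr {ε : ℂ} {i : Fin n} {f g : Cn n → F} {z : Cn n} (h : f =ᶠ[nhds z] g) :
    wdv ε i f z = wdv ε i g z := by
  refine Finset.sum_congr rfl fun b _ => ?_
  rw [wd_congr]
  filter_upwards [h] with y hy
  rw [hy]

/-- Since ℓ is a combination of the coordinates in the chosen basis, the derivative does not depend
on that basis. Together with `dual_ext` this reduces every rule for `wdv` to the scalar one. -/
theorem dual_wdv (ε : ℂ) (i : Fin n) {f : Cn n → F} {z : Cn n} (hf : CDiffAt f z)
    (ℓ : Module.Dual ℂ F) : ℓ (wdv ε i f z) = wd ε i (fun y => ℓ (f y)) z := by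
  have h : (fun y => ℓ (f y)) = fun y => ∑ b, ℓ (Module.finBasis ℂ F b) *
      (Module.finBasis ℂ F).coord b (f y) := by
    funext y
    conv_lhs => rw [← (Module.finBasis ℂ F).sum_repr (f y)]
    simp only [map_sum, map_smul, smul_eq_mul, mul_comm, Module.Basis.coord_apply]
  rw [h, wd_sum _ _ _ fun b _ => (hf _).const_mul _, wdv, map_sum]
  refine Finset.sum_congr rfl fun b _ => ?_
  rw [wd_const_mul _ _ _ (hf _), map_smul, smul_eq_mul, mul_comm]

theorem wdv_const (ε : ℂ) (i : Fin n) (c : F) (z : Cn n) : wdv ε i (fun _ => c) z = 0 := by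
  simp [wdv, wd_const]

theorem wdv_add (ε : ℂ) (i : Fin n) {f g : Cn n → F} {z : Cn n} (hf : CDiffAt f z)
    (hg : CDiffAt g z) : wdv ε i (fun y => f y + g y) z = wdv ε i f z + wdv ε i g z := by
  simp only [wdv, ← Finset.sum_add_distrib, map_add, wd_add _ _ (hf _) (hg _), add_smul]

/-- A subspace is the common kernel of the functionals vanishing on it, and these commute with
differentiation. It keeps the derivatives of H in `∧²` and those of a form in its bidegrees. -/
theorem wdv_mem (ε : ℂ) (i : Fin n) {f : Cn n → F} {z : Cn n} (hf : CDiffAt f z)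
    (N : Submodule ℂ F) (h : ∀ᶠ y in nhds z, f y ∈ N) : wdv ε i f z ∈ N := by
  by_contra hN
  obtain ⟨ℓ, h1, h2⟩ := Submodule.exists_le_ker_of_notMem hN
  apply h1
  rw [dual_wdv _ _ hf]
  have : (fun y => ℓ (f y)) =ᶠ[nhds z] fun _ => 0 := by
    filter_upwards [h] with y hy
    exact h2 hy
  rw [wd_congr this, wd_const]

theorem CSmoothAt.wdv {ε : ℂ} {i : Fin n} {f : Cn n → F} {z : Cn n} (hf : CSmoothAt f z) :
    CSmoothAt (wdv ε i f) z := by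
  intro ℓ
  have : (fun y => ℓ (ExtPoisson.wdv ε i f y)) = fun y => ∑ b,
      wd ε i (fun y => (Module.finBasis ℂ F).coord b (f y)) y * ℓ (Module.finBasis ℂ F b) := by
    funext y
    simp [ExtPoisson.wdv]
  rw [this]
  exact ContDiffAt.sum fun b _ => (contDiffAt_wd (hf _)).mul contDiffAt_const

/-- The neighbourhood must not depend on ℓ; intersecting those of the finitely many basis
coordinates gives one that works for all functionals. -/
theorem CSmoothAt.eventually {f : Cn n → F} {z : Cn n} (hf : CSmoothAt f z) :
    ∀ᶠ y in nhds z, CDiffAt f y := by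
  have h : ∀ b, ∀ᶠ y in nhds z,
      DifferentiableAt ℝ (fun y => (Module.finBasis ℂ F).coord b (f y)) y := fun b =>
    (((hf ((Module.finBasis ℂ F).coord b)).of_le (m := 1) (by norm_cast)).eventually
      (by simp)).mono fun y hy => hy.differentiableAt (by simp)
  filter_upwards [Filter.eventually_all.2 h] with y hy ℓ
  have e : (fun y => ℓ (f y)) = fun y => ∑ b, ℓ (Module.finBasis ℂ F b) *
      (Module.finBasis ℂ F).coord b (f y) := by
    funext y
    conv_lhs => rw [← (Module.finBasis ℂ F).sum_repr (f y)]
    simp only [map_sum, map_smul, smul_eq_mul, mul_comm, Module.Basis.coord_apply]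
  rw [e]
  exact DifferentiableAt.fun_sum fun b _ => (hy b).const_mul _

theorem dual_ext {x y : F} (h : ∀ ℓ : Module.Dual ℂ F, ℓ x = ℓ y) : x = y :=
  (Module.forall_dual_apply_eq_zero_iff ℂ (x - y)).1 (fun ℓ => by rw [map_sub, h, sub_self]) |>
    sub_eq_zero.1

theorem wdv_comm (ε δ : ℂ) (i j : Fin n) {f : Cn n → F} {z : Cn n} (hf : CSmoothAt f z) :
    wdv ε i (wdv δ j f) z = wdv δ j (wdv ε i f) z := by
  refine dual_ext fun ℓ => ?_
  have e : ∀ (ε : ℂ) (i : Fin n), (fun y => ℓ (wdv ε i f y)) =ᶠ[nhds z]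
      wd ε i (fun y => ℓ (f y)) := by
    intro ε i
    filter_upwards [hf.eventually] with y hy
    exact dual_wdv _ _ hy _
  rw [dual_wdv _ _ hf.wdv.cDiffAt, dual_wdv _ _ hf.wdv.cDiffAt, wd_congr (e _ _),
    wd_congr (e _ _), wd_comm _ _ _ _ (hf ℓ)]

variable {G K : Type*} [AddCommGroup G] [Module ℂ G] [Module.Finite ℂ G]
    [AddCommGroup K] [Module ℂ K] [Module.Finite ℂ K]

theorem wdv_linear (ε : ℂ) (i : Fin n) (L : F →ₗ[ℂ] G) {f : Cn n → F} {z : Cn n}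
    (hf : CDiffAt f z) : wdv ε i (fun y => L (f y)) z = L (wdv ε i f z) := by
  refine dual_ext fun ℓ => ?_
  rw [dual_wdv _ _ (hf.linear L)]
  exact (dual_wdv ε i hf (ℓ ∘ₗ L)).symm

theorem wdv_bilin (ε : ℂ) (i : Fin n) (B : F →ₗ[ℂ] G →ₗ[ℂ] K) {f : Cn n → F} {g : Cn n → G}
    {z : Cn n} (hf : CDiffAt f z) (hg : CDiffAt g z) :
    wdv ε i (fun y => B (f y) (g y)) z = B (wdv ε i f z) (g z) + B (f z) (wdv ε i g z) := by
  refine dual_ext fun ℓ => ?_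
  have h : (fun y => ℓ (B (f y) (g y))) = fun y => ∑ b,
      (Module.finBasis ℂ F).coord b (f y) * (ℓ ∘ₗ B (Module.finBasis ℂ F b)) (g y) := by
    funext y
    conv_lhs => rw [← (Module.finBasis ℂ F).sum_repr (f y)]
    simp only [map_sum, map_smul, smul_eq_mul, LinearMap.sum_apply, LinearMap.smul_apply,
      Module.Basis.coord_apply, LinearMap.comp_apply]
  rw [dual_wdv _ _ (hf.bilin B hg), h, wd_sum _ _ _ fun b _ => (hf _).fun_mul (hg _)]
  simp only [wd_mul _ _ (hf _) (hg _), Finset.sum_add_distrib]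
  rw [map_add]
  congr 1
  · rw [wdv]
    simp
  · conv_rhs => rw [← (Module.finBasis ℂ F).sum_repr (f z)]
    simp only [map_sum, map_smul, LinearMap.sum_apply, LinearMap.smul_apply]
    refine Finset.sum_congr rfl fun b _ => ?_
    rw [← dual_wdv _ _ hg]
    simp

theorem CSmoothAt.bilin (B : F →ₗ[ℂ] G →ₗ[ℂ] K) {f : Cn n → F} {g : Cn n → G}
    {z : Cn n} (hf : CSmoothAt f z) (hg : CSmoothAt g z) :
    CSmoothAt (fun y => B (f y) (g y)) z := by
  intro ℓ
  have h : (fun y => ℓ (B (f y) (g y))) = fun y => ∑ b,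
      (Module.finBasis ℂ F).coord b (f y) * (ℓ ∘ₗ B (Module.finBasis ℂ F b)) (g y) := by
    funext y
    conv_lhs => rw [← (Module.finBasis ℂ F).sum_repr (f y)]
    simp only [map_sum, map_smul, smul_eq_mul, LinearMap.sum_apply, LinearMap.smul_apply,
      Module.Basis.coord_apply, LinearMap.comp_apply]
  rw [h]
  exact ContDiffAt.sum fun b _ => (hf _).mul (hg _)

end WirtingerCalculus

/-! ## Commutation rules for the Clifford action -/

section CliffordRules

variable {V : Type*} [AddCommGroup V] [Module ℂ V]

theorem contractLeft_ι_mul' {M : Type*} [AddCommGroup M] [Module ℂ M] (d : Module.Dual ℂ M) (a : M)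
    (b : ExteriorAlgebra ℂ M) :
    CliffordAlgebra.contractLeft d (ExteriorAlgebra.ι ℂ a * b) =
      d a • b - ExteriorAlgebra.ι ℂ a * CliffordAlgebra.contractLeft d b :=
  CliffordAlgebra.contractLeft_ι_mul _ _ _

theorem contractRight_mul_ι' {M : Type*} [AddCommGroup M] [Module ℂ M] (d : Module.Dual ℂ M) (a : M)
    (b : ExteriorAlgebra ℂ M) :
    CliffordAlgebra.contractRight (b * ExteriorAlgebra.ι ℂ a) d =
      d a • b - CliffordAlgebra.contractRight b d * ExteriorAlgebra.ι ℂ a :=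
  CliffordAlgebra.contractRight_mul_ι _ _ _

@[elab_as_elim]
theorem exteriorPower_succ_induction {M : Type*} [AddCommGroup M] [Module ℂ M] {k : ℕ}
    {p : ExteriorAlgebra ℂ M → Prop}
    (hmul : ∀ a ∈ ⋀[ℂ]^k M, ∀ x : M, p (a * ExteriorAlgebra.ι ℂ x))
    (hadd : ∀ a b, p a → p b → p (a + b)) {a : ExteriorAlgebra ℂ M} (ha : a ∈ ⋀[ℂ]^(k + 1) M) :
    p a := by
  rw [ExteriorAlgebra.exteriorPower, pow_succ] at ha
  refine Submodule.mul_induction_on ha ?_ fun x y => hadd x y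
  rintro a ha _ ⟨x, rfl⟩
  exact hmul a ha x

@[elab_as_elim]
theorem exteriorPower_two_induction {M : Type*} [AddCommGroup M] [Module ℂ M]
    {p : ExteriorAlgebra ℂ M → Prop}
    (hmul : ∀ x y : M, p (ExteriorAlgebra.ι ℂ x * ExteriorAlgebra.ι ℂ y))
    (hadd : ∀ a b, p a → p b → p (a + b)) {a : ExteriorAlgebra ℂ M} (ha : a ∈ ⋀[ℂ]^2 M) :
    p a := by
  refine @exteriorPower_succ_induction M _ _ 1 p ?_ hadd a ha
  intro a ha x
  rw [ExteriorAlgebra.exteriorPower, pow_one] at ha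
  obtain ⟨y, rfl⟩ := ha
  exact hmul y x

theorem mem_exteriorPower_zero {M : Type*} [AddCommGroup M] [Module ℂ M]
    {a : ExteriorAlgebra ℂ M} (ha : a ∈ ⋀[ℂ]^0 M) : ∃ r : ℂ, a = algebraMap ℂ _ r := by
  rw [ExteriorAlgebra.exteriorPower, pow_zero] at ha
  obtain ⟨r, rfl⟩ := Submodule.mem_one.1 ha
  exact ⟨r, rfl⟩

theorem ι_mul_ι_comm {M : Type*} [AddCommGroup M] [Module ℂ M] (x y : M) :
    ExteriorAlgebra.ι ℂ x * ExteriorAlgebra.ι ℂ y =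
      -(ExteriorAlgebra.ι ℂ y * ExteriorAlgebra.ι ℂ x) :=
  eq_neg_of_add_eq_zero_left (ExteriorAlgebra.ι_add_mul_swap x y)

/-- Passing a vector costs two signs, which cancel. In particular H commutes with every Clifford
factor. -/
theorem commute_of_mem_exteriorPower_two {M : Type*} [AddCommGroup M] [Module ℂ M]
    {a : ExteriorAlgebra ℂ M} (ha : a ∈ ⋀[ℂ]^2 M) (b : ExteriorAlgebra ℂ M) : Commute a b := by
  refine exteriorPower_two_induction (fun x y => ?_) (fun _ _ h h' => h.add_left h') ha
  induction b using ExteriorAlgebra.induction with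
  | algebraMap r => exact (Algebra.commutes _ _).symm
  | add a b ha hb => exact ha.add_right hb
  | mul a b ha hb => exact ha.mul_right hb
  | ι z =>
    rw [Commute, SemiconjBy, mul_assoc, ι_mul_ι_comm y z, mul_neg, ← mul_assoc, ι_mul_ι_comm x z]
    simp [mul_assoc]

theorem ι_mul_cliffordVec (e : Module.Dual ℂ V) (x : AFib V) (w : ExteriorAlgebra ℂ (TCDual V)) :
    ExteriorAlgebra.ι ℂ ((e, 0) : TCDual V) * cliffordVec V x w =
      e x.1 • w - cliffordVec V x (ExteriorAlgebra.ι ℂ ((e, 0) : TCDual V) * w) := by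
  have h : pairT (anchorA x) ((e, 0) : TCDual V) = e x.1 := by simp [pairT, anchorA]
  rw [cliffordVec_apply, cliffordVec_apply, contractLeft_ι_mul', h, mul_add, ← mul_assoc,
    ← mul_assoc, ι_mul_ι_comm]
  simp only [neg_mul]
  abel

/-- In the Clifford algebra a covector e of type (1, 0) anticommutes with x ∈ A up to the scalar
e(x). Moving it past k factors therefore produces the contraction by e and a sign. This is the only
relation behind the computations with [∂, ι_H]. -/
theorem ι_mul_clifford (e : Module.Dual ℂ V) {k : ℕ} {a : ExteriorAlgebra ℂ (AFib V)}
    (ha : a ∈ ⋀[ℂ]^k (AFib V)) (w : ExteriorAlgebra ℂ (TCDual V)) :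
    ExteriorAlgebra.ι ℂ ((e, 0) : TCDual V) * clifford V a w =
      (-1 : ℂ) ^ (k + 1) • clifford V (CliffordAlgebra.contractRight a (pairA (0, e))) w +
        (-1 : ℂ) ^ k • clifford V a (ExteriorAlgebra.ι ℂ ((e, 0) : TCDual V) * w) := by
  induction k generalizing a w with
  | zero =>
    obtain ⟨r, rfl⟩ := mem_exteriorPower_zero ha
    have : CliffordAlgebra.contractRight (algebraMap ℂ (ExteriorAlgebra ℂ (AFib V)) r)
        (pairA (0, e)) = 0 := CliffordAlgebra.contractRight_algebraMap _ _ _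
    rw [this]
    simp [Algebra.algebraMap_eq_smul_one]
  | succ k ih =>
    refine exteriorPower_succ_induction (fun a ha x => ?_) (fun a b h h' => ?_) ha
    · have hp : pairA (0, e) x = e x.1 := by simp [pairA]
      rw [map_mul, Module.End.mul_apply, Module.End.mul_apply, clifford_ι, ih ha,
        ι_mul_cliffordVec, contractRight_mul_ι', hp]
      simp only [map_sub, map_smul, map_mul, LinearMap.sub_apply, LinearMap.smul_apply,
        Module.End.mul_apply, clifford_ι, pow_succ]
      module
    · simp only [map_add, LinearMap.add_apply, mul_add, h, h', smul_add]
      abel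

theorem clifford_ι_inr (ξ : ConjDual V) (w : ExteriorAlgebra ℂ (TCDual V)) :
    clifford V (ExteriorAlgebra.ι ℂ (0, ξ)) w = ExteriorAlgebra.ι ℂ ((0, ξ) : TCDual V) * w := by
  have h : pairT (anchorA ((0, ξ) : AFib V)) = 0 := by
    refine LinearMap.ext fun x => ?_
    simp [pairT, anchorA]
  rw [clifford_ι, cliffordVec_apply, h]
  simp

theorem clifford_ι_inl (X : V) (w : ExteriorAlgebra ℂ (TCDual V)) :
    clifford V (ExteriorAlgebra.ι ℂ (X, 0)) w =
      CliffordAlgebra.contractLeft (pairT ((X, 0) : TC V)) w := by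
  rw [clifford_ι, cliffordVec_apply]
  have : ((0, (0 : ConjDual V)) : TCDual V) = 0 := rfl
  simp [anchorA, this]

theorem contractRight_mul {M : Type*} [AddCommGroup M] [Module ℂ M] (d : Module.Dual ℂ M) {k : ℕ}
    (a : ExteriorAlgebra ℂ M) {b : ExteriorAlgebra ℂ M} (hb : b ∈ ⋀[ℂ]^k M) :
    CliffordAlgebra.contractRight (a * b) d = a * CliffordAlgebra.contractRight b d +
      (-1 : ℂ) ^ k • (CliffordAlgebra.contractRight a d * b) := by
  induction k generalizing b with
  | zero =>
    obtain ⟨r, rfl⟩ := mem_exteriorPower_zero hb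
    have h1 : CliffordAlgebra.contractRight (algebraMap ℂ (ExteriorAlgebra ℂ M) r) d = 0 :=
      CliffordAlgebra.contractRight_algebraMap _ _ _
    have h2 : CliffordAlgebra.contractRight (a * algebraMap ℂ (ExteriorAlgebra ℂ M) r) d =
      CliffordAlgebra.contractRight a d * algebraMap ℂ (ExteriorAlgebra ℂ M) r :=
      CliffordAlgebra.contractRight_mul_algebraMap _ _ _
    rw [h1, h2]
    simp
  | succ k ih =>
    refine exteriorPower_succ_induction (fun b hb x => ?_) (fun b b' h h' => ?_) hb
    · rw [← mul_assoc, contractRight_mul_ι', contractRight_mul_ι', ih hb]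
      simp only [mul_sub, add_mul, mul_smul_comm, smul_mul_assoc, mul_assoc, pow_succ]
      module
    · simp only [mul_add, map_add, LinearMap.add_apply, h, h', smul_add]
      abel

/-- Consequently H ⌊ dz^i is odd of degree one, and moving it past u of degree k costs exactly
(-1)^k. -/
theorem contractRight_mem_range {M : Type*} [AddCommGroup M] [Module ℂ M] (d : Module.Dual ℂ M)
    {a : ExteriorAlgebra ℂ M} (ha : a ∈ ⋀[ℂ]^2 M) :
    CliffordAlgebra.contractRight a d ∈ LinearMap.range (ExteriorAlgebra.ι ℂ (M := M)) := by
  refine exteriorPower_two_induction (fun x y => ?_) (fun a b h h' => ?_) ha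
  · have : CliffordAlgebra.contractRight (ExteriorAlgebra.ι ℂ x) d = algebraMap ℂ _ (d x) :=
      CliffordAlgebra.contractRight_ι _ _ _
    rw [contractRight_mul_ι', this, ← Algebra.smul_def]
    exact ⟨d y • x - d x • y, by simp⟩
  · rw [map_add]
    exact add_mem h h'

theorem sharp_ι_mul_ι (x y : AFib V) (α : ADual V) :
    sharp (ExteriorAlgebra.ι ℂ x * ExteriorAlgebra.ι ℂ y) α =
      pairA α x • y - pairA α y • x := by
  have : CliffordAlgebra.contractLeft (pairA α) (ExteriorAlgebra.ι ℂ y) =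
    algebraMap ℂ _ (pairA α y) := CliffordAlgebra.contractLeft_ι _ _ _
  rw [sharp, contractLeft_ι_mul', this, ← Algebra.commutes, ← Algebra.smul_def, map_sub, map_smul,
    map_smul, ExteriorAlgebra.ι_leftInverse, ExteriorAlgebra.ι_leftInverse]

/-- `H ↦ H^♯ α` as a linear map. -/
def sharpLin (α : ADual V) : ExteriorAlgebra ℂ (AFib V) →ₗ[ℂ] AFib V :=
  ExteriorAlgebra.ιInv ∘ₗ CliffordAlgebra.contractLeft (pairA α)

theorem sharp_add (a b : ExteriorAlgebra ℂ (AFib V)) (α : ADual V) :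
    sharp (a + b) α = sharp a α + sharp b α :=
  map_add (sharpLin α) a b

end CliffordRules

/-! ## The bigrading of covectors -/

section Bigrading

variable (V : Type*) [AddCommGroup V] [Module ℂ V]

/-- The covectors of type `(1, 0)` in the exterior algebra. -/
def holSub : Submodule ℂ (ExteriorAlgebra ℂ (TCDual V)) :=
  LinearMap.range (ExteriorAlgebra.ι ℂ ∘ₗ LinearMap.inl ℂ (Module.Dual ℂ V) (ConjDual V))

/-- The covectors of type `(0, 1)` in the exterior algebra. -/
def antiholSub : Submodule ℂ (ExteriorAlgebra ℂ (TCDual V)) :=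
  LinearMap.range (ExteriorAlgebra.ι ℂ ∘ₗ LinearMap.inr ℂ (Module.Dual ℂ V) (ConjDual V))

theorem formType_eq (p q : ℕ) : formType V p q = holSub V ^ p * antiholSub V ^ q := rfl

/-- The sum of the covectors of type `(p, q)` with `p - q = m`. -/
def formDegZ (m : ℤ) : Submodule ℂ (ExteriorAlgebra ℂ (TCDual V)) :=
  ⨆ p : {p : ℕ × ℕ // (p.1 : ℤ) - p.2 = m}, formType V p.1.1 p.1.2

theorem formType_le_formDegZ {p q : ℕ} {m : ℤ} (h : (p : ℤ) - q = m) :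
    formType V p q ≤ formDegZ V m :=
  le_iSup (fun p : {p : ℕ × ℕ // (p.1 : ℤ) - p.2 = m} => formType V p.1.1 p.1.2) ⟨(p, q), h⟩

theorem range_ι_mul_le {M N N' : Type*} [AddCommGroup M] [Module ℂ M] [AddCommGroup N] [Module ℂ N]
    [AddCommGroup N'] [Module ℂ N'] (f : N →ₗ[ℂ] M) (g : N' →ₗ[ℂ] M) :
    LinearMap.range (ExteriorAlgebra.ι ℂ ∘ₗ f) * LinearMap.range (ExteriorAlgebra.ι ℂ ∘ₗ g) ≤
      LinearMap.range (ExteriorAlgebra.ι ℂ ∘ₗ g) * LinearMap.range (ExteriorAlgebra.ι ℂ ∘ₗ f) := by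
  rw [Submodule.mul_le]
  rintro _ ⟨a, rfl⟩ _ ⟨b, rfl⟩
  simp only [LinearMap.comp_apply]
  rw [ι_mul_ι_comm]
  exact neg_mem (Submodule.mul_mem_mul ⟨b, rfl⟩ ⟨a, rfl⟩)

theorem holSub_antiholSub_commute : Commute (holSub V) (antiholSub V) :=
  le_antisymm (range_ι_mul_le _ _) (range_ι_mul_le _ _)

variable {V}

theorem ι_inl_mul_mem (a : Module.Dual ℂ V) {m : ℤ} {w : ExteriorAlgebra ℂ (TCDual V)}
    (hw : w ∈ formDegZ V m) :
    ExteriorAlgebra.ι ℂ ((a, 0) : TCDual V) * w ∈ formDegZ V (m + 1) := by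
  suffices h : formDegZ V m ≤ (formDegZ V (m + 1)).comap
      (LinearMap.mulLeft ℂ (ExteriorAlgebra.ι ℂ ((a, 0) : TCDual V))) from h hw
  refine iSup_le ?_
  rintro ⟨⟨p, q⟩, h⟩ w hw
  change (p : ℤ) - q = m at h
  refine formType_le_formDegZ V (p := p + 1) (q := q) (by push_cast; omega) ?_
  rw [formType_eq, pow_succ', mul_assoc]
  exact Submodule.mul_mem_mul ⟨a, rfl⟩ hw

theorem ι_inr_mul_mem (a : ConjDual V) {m : ℤ} {w : ExteriorAlgebra ℂ (TCDual V)}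
    (hw : w ∈ formDegZ V m) :
    ExteriorAlgebra.ι ℂ ((0, a) : TCDual V) * w ∈ formDegZ V (m - 1) := by
  suffices h : formDegZ V m ≤ (formDegZ V (m - 1)).comap
      (LinearMap.mulLeft ℂ (ExteriorAlgebra.ι ℂ ((0, a) : TCDual V))) from h hw
  refine iSup_le ?_
  rintro ⟨⟨p, q⟩, h⟩ w hw
  change (p : ℤ) - q = m at h
  refine formType_le_formDegZ V (p := p) (q := q + 1) (by push_cast; omega) ?_
  rw [formType_eq, pow_succ', ← mul_assoc, ((holSub_antiholSub_commute V).pow_left p).eq, mul_assoc]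
  exact Submodule.mul_mem_mul ⟨a, rfl⟩ hw

/-- A vector of type (1, 0) pairs to zero with every dz̄^j. This is the base case for contracting
mixed types. -/
theorem contractLeft_antihol (X : V) (q : ℕ) {w : ExteriorAlgebra ℂ (TCDual V)}
    (hw : w ∈ antiholSub V ^ q) : CliffordAlgebra.contractLeft (pairT ((X, 0) : TC V)) w = 0 := by
  induction q generalizing w with
  | zero =>
    rw [pow_zero] at hw
    obtain ⟨r, rfl⟩ := Submodule.mem_one.1 hw
    exact CliffordAlgebra.contractLeft_algebraMap (0 : QuadraticForm ℂ (TCDual V)) _ r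
  | succ q ih =>
    rw [pow_succ'] at hw
    refine Submodule.mul_induction_on hw ?_ fun x y hx hy => by rw [map_add, hx, hy, add_zero]
    rintro _ ⟨a, rfl⟩ w hw
    rw [LinearMap.comp_apply, contractLeft_ι_mul', ih hw]
    simp [pairT]

theorem contractLeft_mem (X : V) {m : ℤ} {w : ExteriorAlgebra ℂ (TCDual V)}
    (hw : w ∈ formDegZ V m) :
    CliffordAlgebra.contractLeft (pairT ((X, 0) : TC V)) w ∈ formDegZ V (m - 1) := by
  suffices h : formDegZ V m ≤ (formDegZ V (m - 1)).comap
      (CliffordAlgebra.contractLeft (pairT ((X, 0) : TC V))) from h hw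
  refine iSup_le ?_
  rintro ⟨⟨p, q⟩, h⟩
  change (p : ℤ) - q = m at h
  change formType V p q ≤ _
  clear hw w
  induction p generalizing m with
  | zero =>
    intro w hw
    rw [formType_eq, pow_zero, one_mul] at hw
    rw [Submodule.mem_comap, contractLeft_antihol X q hw]
    exact zero_mem _
  | succ p ih =>
    rw [formType_eq, pow_succ', mul_assoc, Submodule.mul_le]
    rintro _ ⟨a, rfl⟩ w hw
    have h1 : CliffordAlgebra.contractLeft (pairT ((X, 0) : TC V)) w ∈
        formDegZ V (m - 1 - 1) := ih (m := m - 1) (by push_cast at h; omega) hw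
    rw [Submodule.mem_comap, LinearMap.comp_apply, contractLeft_ι_mul']
    refine sub_mem (Submodule.smul_mem _ _ (formType_le_formDegZ V (by push_cast at h; omega) hw)) ?_
    have h2 := ι_inl_mul_mem a h1
    rwa [sub_add_cancel] at h2

theorem cliffordVec_mem (u : AFib V) {m : ℤ} {w : ExteriorAlgebra ℂ (TCDual V)}
    (hw : w ∈ formDegZ V m) : cliffordVec V u w ∈ formDegZ V (m - 1) := by
  rw [cliffordVec_apply]
  exact add_mem (contractLeft_mem u.1 hw) (ι_inr_mul_mem u.2 hw)

/-- The two halves of A have the same effect on i - j: contraction by T^{1,0} lowers i,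
multiplication by (T^{0,1})^* raises j. Each of the k factors therefore contributes -1. -/
theorem clifford_mem {k : ℕ} {a : ExteriorAlgebra ℂ (AFib V)} (ha : a ∈ ⋀[ℂ]^k (AFib V)) {m : ℤ}
    {w : ExteriorAlgebra ℂ (TCDual V)} (hw : w ∈ formDegZ V m) :
    clifford V a w ∈ formDegZ V (m - k) := by
  induction k generalizing a m w with
  | zero =>
    obtain ⟨r, rfl⟩ := mem_exteriorPower_zero ha
    simpa [Algebra.algebraMap_eq_smul_one] using Submodule.smul_mem _ r hw
  | succ k ih =>
    refine exteriorPower_succ_induction (fun a ha x => ?_) (fun a b h h' => ?_) ha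
    · rw [map_mul, Module.End.mul_apply, clifford_ι]
      have := ih ha (cliffordVec_mem x hw)
      rwa [sub_sub, add_comm (1 : ℤ), ← Nat.cast_add_one] at this
    · rw [map_add]
      exact add_mem h h'

theorem map_tMap_mem {W : Type*} [AddCommGroup W] [Module ℂ W] (h : W →ₗ[ℂ] V) {m : ℤ}
    {w : ExteriorAlgebra ℂ (TCDual V)} (hw : w ∈ formDegZ V m) :
    ExteriorAlgebra.map (tMap h) w ∈ formDegZ W m := by
  suffices H : formDegZ V m ≤ (formDegZ W m).comap (ExteriorAlgebra.map (tMap h)).toLinearMap from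
    H hw
  refine iSup_le fun ⟨⟨p, q⟩, hpq⟩ => ?_
  rw [← Submodule.map_le_iff_le_comap, formType_eq, Submodule.map_mul, Submodule.map_pow,
    Submodule.map_pow]
  refine le_trans (mul_le_mul' (pow_le_pow_left' ?_ p) (pow_le_pow_left' ?_ q))
    (formType_le_formDegZ W hpq)
  · rintro _ ⟨_, ⟨a, rfl⟩, rfl⟩
    refine ⟨h.dualMap a, ?_⟩
    simp [tMap]
  · rintro _ ⟨_, ⟨a, rfl⟩, rfl⟩
    refine ⟨conjDualMap h a, ?_⟩
    simp [tMap]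

end Bigrading

/-! ## The map `τ` on fibres -/

section TauFibre

variable {V : Type*} [AddCommGroup V] [Module ℂ V]

theorem tauFib_tmul (n : ℕ) (u : ExteriorAlgebra ℂ (AFib V)) (s : LFib V n) :
    tauFib V n (u ⊗ₜ[ℂ] s) = clifford V u
      (ExteriorAlgebra.map (LinearMap.inl ℂ (Module.Dual ℂ V) (ConjDual V)) s) := rfl

/-- `τ` is a map of `∧^• A`-modules, so its image is stable under the Clifford action. -/
theorem tauFib_mulLeft (n : ℕ) (a : ExteriorAlgebra ℂ (AFib V)) (v : ALFib V n) :
    tauFib V n ((LinearMap.mulLeft ℂ a).rTensor (LFib V n) v) = clifford V a (tauFib V n v) := by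
  induction v using TensorProduct.induction_on with
  | zero => simp
  | tmul u s => simp [tauFib_tmul]
  | add v w hv hw => simp only [map_add, hv, hw]

theorem tmul_mem_alDegree (n : ℕ) {k : ℕ} {u : ExteriorAlgebra ℂ (AFib V)}
    (hu : u ∈ ⋀[ℂ]^k (AFib V)) (s : LFib V n) : u ⊗ₜ[ℂ] s ∈ alDegree V n k :=
  ⟨(⟨u, hu⟩ : ⋀[ℂ]^k (AFib V)) ⊗ₜ[ℂ] s, rfl⟩

theorem alDegree_induction {n k : ℕ} {p : ALFib V n → Prop} (hz : p 0)
    (hmul : ∀ u ∈ ⋀[ℂ]^k (AFib V), ∀ s : LFib V n, p (u ⊗ₜ[ℂ] s))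
    (hadd : ∀ a b, p a → p b → p (a + b)) {a : ALFib V n} (ha : a ∈ alDegree V n k) : p a := by
  obtain ⟨t, rfl⟩ := ha
  induction t using TensorProduct.induction_on with
  | zero => simpa using hz
  | tmul u s => exact hmul u u.2 s
  | add v w hv hw => rw [map_add]; exact hadd _ _ hv hw

theorem mulLeft_mem_alDegree (n : ℕ) {k : ℕ} (x : AFib V) {v : ALFib V n}
    (hv : v ∈ alDegree V n k) :
    (LinearMap.mulLeft ℂ (ExteriorAlgebra.ι ℂ x)).rTensor (LFib V n) v ∈
      alDegree V n (k + 1) := by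
  refine alDegree_induction (p := fun v => (LinearMap.mulLeft ℂ (ExteriorAlgebra.ι ℂ x)).rTensor
    (LFib V n) v ∈ alDegree V n (k + 1)) ?_ (fun u hu s => ?_) (fun a b ha hb => ?_) hv
  · simp
  · refine tmul_mem_alDegree n ?_ s
    rw [ExteriorAlgebra.exteriorPower, pow_succ']
    exact Submodule.mul_mem_mul ⟨x, rfl⟩ hu
  · simp only [map_add]
    exact add_mem ha hb

theorem map_inl_exteriorPower (p : ℕ) :
    (⋀[ℂ]^p (Module.Dual ℂ V)).map
      (ExteriorAlgebra.map (LinearMap.inl ℂ (Module.Dual ℂ V) (ConjDual V))).toLinearMap =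
      holSub V ^ p := by
  rw [ExteriorAlgebra.exteriorPower, Submodule.map_pow]
  congr 1
  rw [holSub, ← LinearMap.range_comp]
  congr 1
  refine LinearMap.ext fun a => ?_
  simp

theorem tauFib_mem_formDegree {n k : ℕ} {v : ALFib V n} (hv : v ∈ alDegree V n k) :
    tauFib V n v ∈ formDegree V n k := by
  refine alDegree_induction (p := fun v => tauFib V n v ∈ formDegree V n k) ?_
    (fun u hu s => ?_) (fun a b ha hb => ?_) hv
  · simp
  · rw [tauFib_tmul]
    refine clifford_mem hu (formType_le_formDegZ V (p := n) (q := 0) (by simp) ?_)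
    rw [formType_eq, pow_zero, mul_one, ← map_inl_exteriorPower]
    exact Submodule.mem_map_of_mem s.2
  · rw [map_add]
    exact add_mem ha hb

/-- Naturality under linear isomorphisms: in the trivializations given by a chart, `τ` becomes the
constant map `tauFib (Cn n) n`. -/
theorem tauFib_alMap {W : Type*} [AddCommGroup W] [Module ℂ W] (n : ℕ) (g : V →ₗ[ℂ] W)
    (h : W →ₗ[ℂ] V) (hg : h ∘ₗ g = LinearMap.id) (v : ALFib V n) :
    tauFib W n (alMap n g h v) = ExteriorAlgebra.map (tMap h) (tauFib V n v) := by
  induction v using TensorProduct.induction_on with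
  | zero => simp
  | add v w hv hw => simp only [map_add, hv, hw]
  | tmul u s =>
    rw [alMap, TensorProduct.map_tmul, tauFib_tmul, tauFib_tmul, ← clifford_map g h hg]
    congr 1
    have e : (ExteriorAlgebra.map (LinearMap.inl ℂ (Module.Dual ℂ W) (ConjDual W))).comp
        (ExteriorAlgebra.map h.dualMap) = (ExteriorAlgebra.map (tMap h)).comp
          (ExteriorAlgebra.map (LinearMap.inl ℂ (Module.Dual ℂ V) (ConjDual V))) := by
      rw [ExteriorAlgebra.map_comp_map, ExteriorAlgebra.map_comp_map]
      congr 1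
    have e2 : ((exteriorPower.map n h.dualMap s : LFib W n) : ExteriorAlgebra ℂ _) =
        ExteriorAlgebra.map h.dualMap (s : ExteriorAlgebra ℂ (Module.Dual ℂ V)) := by
      have : (⋀[ℂ]^n (Module.Dual ℂ W)).subtype ∘ₗ exteriorPower.map n h.dualMap =
          (ExteriorAlgebra.map h.dualMap).toLinearMap ∘ₗ (⋀[ℂ]^n (Module.Dual ℂ V)).subtype := by
        ext x
        simp [ExteriorAlgebra.map_apply_ιMulti]
      exact LinearMap.congr_fun this s
    rw [e2]
    exact DFunLike.congr_fun e _

end TauFibre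

/-! ### Bijectivity of `τ` on the model fibre, and the frame of `ℒ`. -/

section TauModel

variable (n : ℕ)

theorem dual_eq_sum (a : Module.Dual ℂ (Cn n)) : a = ∑ i, a (ddz n i) • dz n i := by
  refine LinearMap.ext fun v => ?_
  have hv : v = ∑ i, v i • (Pi.single i 1 : Cn n) := by
    ext j
    simp [Finset.sum_apply, Pi.single_apply]
  conv_lhs => rw [hv]
  simp [ddz, dz, mul_comm]

theorem conjDual_eq_sum (a : ConjDual (Cn n)) : a = ∑ i, a (ddz n i) • dzbar n i := by
  refine LinearMap.ext fun v => ?_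
  have hv : v = ∑ i, v i • (Pi.single i 1 : Cn n) := by
    ext j
    simp [Finset.sum_apply, Pi.single_apply]
  conv_lhs => rw [hv]
  simp [ddz, dzbar, mul_comm]

/-- Euler's formula on covectors of type `(p, 0)`. -/
theorem sum_dz_mul_contractLeft (p : ℕ) {w : ExteriorAlgebra ℂ (TCDual (Cn n))}
    (hw : w ∈ holSub (Cn n) ^ p) :
    ∑ i, ExteriorAlgebra.ι ℂ (dzT n i) *
      CliffordAlgebra.contractLeft (pairT ((ddz n i, 0) : TC (Cn n))) w = (p : ℂ) • w := by
  induction p generalizing w with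
  | zero =>
    rw [pow_zero] at hw
    obtain ⟨r, rfl⟩ := Submodule.mem_one.1 hw
    have h : ∀ d : Module.Dual ℂ (TCDual (Cn n)), CliffordAlgebra.contractLeft d
      (algebraMap ℂ (ExteriorAlgebra ℂ (TCDual (Cn n))) r) = 0 := fun d =>
      CliffordAlgebra.contractLeft_algebraMap (0 : QuadraticForm ℂ (TCDual (Cn n))) _ r
    simp [h]
  | succ p ih =>
    rw [pow_succ'] at hw
    refine Submodule.mul_induction_on hw ?_ fun x y hx hy => ?_
    · rintro _ ⟨a, rfl⟩ w hw
      rw [LinearMap.comp_apply]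
      have h2 : ∑ i, a (ddz n i) • (ExteriorAlgebra.ι ℂ (dzT n i)) =
          ExteriorAlgebra.ι ℂ ((a, 0) : TCDual (Cn n)) := by
        conv_rhs => rw [dual_eq_sum n a]
        have : ((∑ i, a (ddz n i) • dz n i, 0) : TCDual (Cn n)) =
            ∑ i, a (ddz n i) • dzT n i := by
          refine Prod.ext ?_ ?_ <;> simp [dzT, Prod.fst_sum, Prod.snd_sum]
        rw [this, map_sum]
        simp
      have h3 : ∀ i, pairT ((ddz n i, 0) : TC (Cn n)) ((a, 0) : TCDual (Cn n)) = a (ddz n i) := by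
        intro i
        simp [pairT]
      simp only [LinearMap.inl_apply, contractLeft_ι_mul', h3, mul_sub, mul_smul_comm,
        Finset.sum_sub_distrib]
      simp only [← smul_mul_assoc, ← Finset.sum_mul, h2]
      have h4 : ∀ i, ExteriorAlgebra.ι ℂ (dzT n i) * (ExteriorAlgebra.ι ℂ ((a, 0) : TCDual (Cn n)) *
          CliffordAlgebra.contractLeft (pairT ((ddz n i, 0) : TC (Cn n))) w) =
          -(ExteriorAlgebra.ι ℂ ((a, 0) : TCDual (Cn n)) * (ExteriorAlgebra.ι ℂ (dzT n i) *
            CliffordAlgebra.contractLeft (pairT ((ddz n i, 0) : TC (Cn n))) w)) := by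
        intro i
        rw [← mul_assoc, ι_mul_ι_comm, neg_mul, mul_assoc]
      simp only [h4, Finset.sum_neg_distrib, ← Finset.mul_sum]
      rw [ih hw]
      push_cast
      simp only [mul_smul_comm, smul_mul_assoc]
      module
    · simp only [map_add, mul_add, Finset.sum_add_distrib, hx, hy, smul_add]

/-- Since ι_i (dz^i ∧ w) = w - dz^i ∧ ι_i w, summation over i and Euler's formula leave n - p = j.
-/
theorem sum_contractLeft_dz_mul {p j : ℕ} (h : p + j = n) {w : ExteriorAlgebra ℂ (TCDual (Cn n))}
    (hw : w ∈ holSub (Cn n) ^ p) :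
    ∑ i, CliffordAlgebra.contractLeft (pairT ((ddz n i, 0) : TC (Cn n)))
      (ExteriorAlgebra.ι ℂ (dzT n i) * w) = (j : ℂ) • w := by
  have h3 : ∀ i, pairT ((ddz n i, 0) : TC (Cn n)) (dzT n i) = 1 := by
    intro i
    simp [pairT, dzT, dz, ddz]
  simp only [contractLeft_ι_mul', h3, Finset.sum_sub_distrib, sum_dz_mul_contractLeft n p hw]
  subst h
  simp only [one_smul, Finset.sum_const, Finset.card_univ, Fintype.card_fin]
  rw [← Nat.cast_smul_eq_nsmul ℂ]
  push_cast
  module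

theorem clifford_mem_map_alDegree {k : ℕ} (x : AFib (Cn n))
    {w : ExteriorAlgebra ℂ (TCDual (Cn n))}
    (hw : w ∈ (alDegree (Cn n) n k).map (tauFib (Cn n) n)) :
    clifford (Cn n) (ExteriorAlgebra.ι ℂ x) w ∈
      (alDegree (Cn n) n (k + 1)).map (tauFib (Cn n) n) := by
  obtain ⟨v, hv, rfl⟩ := hw
  exact ⟨_, mulLeft_mem_alDegree n x hv, tauFib_mulLeft n _ v⟩

/-- Descending induction on the type: at p = n the covectors are 1 · s with s ∈ `ℒ`, and each lower
p is reached by contracting covectors of type (p + 1, 0). -/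
theorem holSub_pow_le {p j : ℕ} (h : p + j = n) :
    holSub (Cn n) ^ p ≤ (alDegree (Cn n) n j).map (tauFib (Cn n) n) := by
  induction j generalizing p with
  | zero =>
    intro w hw
    obtain rfl : p = n := h
    rw [← map_inl_exteriorPower] at hw
    obtain ⟨s, hs, rfl⟩ := hw
    refine ⟨1 ⊗ₜ[ℂ] (⟨s, hs⟩ : LFib (Cn p) p), tmul_mem_alDegree p ?_ _, ?_⟩
    · exact Submodule.one_le.1 (le_of_eq (pow_zero _).symm)
    · rw [tauFib_tmul, map_one]
      rfl
  | succ j ih =>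
    intro w hw
    -- Here n - p = j + 1 is nonzero, so the preceding identity can be solved for w.
    have h0 : w = ((j + 1 : ℕ) : ℂ)⁻¹ • ((j + 1 : ℕ) : ℂ) • w := by
      rw [inv_smul_smul₀ (Nat.cast_ne_zero.2 (Nat.succ_ne_zero j))]
    rw [h0, ← sum_contractLeft_dz_mul n h hw]
    refine Submodule.smul_mem _ _ (sum_mem fun i _ => ?_)
    rw [← clifford_ι_inl]
    refine clifford_mem_map_alDegree n _ (ih (p := p + 1) (by omega) ?_)
    rw [pow_succ']
    exact Submodule.mul_mem_mul ⟨dz n i, rfl⟩ hw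

/-- With the holomorphic part reached in degree j = n - p, each factor from (T^{0,1})^* ⊂ A raises
the degree in `∧^• A` by one, ending at k = n - p + q. -/
theorem formType_le_map {p j : ℕ} (q : ℕ) (h : p + j = n) :
    formType (Cn n) p q ≤ (alDegree (Cn n) n (j + q)).map (tauFib (Cn n) n) := by
  rw [formType_eq, ((holSub_antiholSub_commute (Cn n)).pow_left p).pow_right q |>.eq]
  induction q with
  | zero => simpa using holSub_pow_le n h
  | succ q ih =>
    rw [pow_succ', mul_assoc, Submodule.mul_le]
    rintro _ ⟨a, rfl⟩ w hw
    rw [LinearMap.comp_apply, LinearMap.inr_apply, ← clifford_ι_inr]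
    exact clifford_mem_map_alDegree n _ (ih hw)

theorem holSub_pow_eq_bot {p : ℕ} (h : n < p) : holSub (Cn n) ^ p = ⊥ := by
  have h1 : Module.finrank ℂ (⋀[ℂ]^p (Module.Dual ℂ (Cn n))) = 0 := by
    rw [exteriorPower.finrank_eq, Subspace.dual_finrank_eq, Module.finrank_fin_fun,
      Nat.choose_eq_zero_of_lt h]
  rw [← map_inl_exteriorPower, Submodule.finrank_eq_zero.1 h1, Submodule.map_bot]

theorem formDegree_le_map (k : ℕ) :
    formDegree (Cn n) n k ≤ (alDegree (Cn n) n k).map (tauFib (Cn n) n) := by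
  refine iSup_le ?_
  rintro ⟨⟨p, q⟩, h⟩
  change (p : ℤ) - q = n - k at h
  change formType (Cn n) p q ≤ _
  -- The index set allows p > n, where n - p is not a natural number; such types vanish.
  rcases lt_or_ge n p with hp | hp
  · rw [formType_eq, holSub_pow_eq_bot n hp, Submodule.bot_mul]
    exact bot_le
  · have := formType_le_map n (p := p) (j := n - p) q (by omega)
    rwa [show n - p + q = k by omega] at this

theorem iSup_formType_eq_top : (⨆ p : ℕ × ℕ, formType (Cn n) p.1 p.2) = ⊤ := by
  have hle : ∀ p q, formType (Cn n) p q ≤ ⨆ p : ℕ × ℕ, formType (Cn n) p.1 p.2 := fun p q =>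
    le_iSup (fun p : ℕ × ℕ => formType (Cn n) p.1 p.2) (p, q)
  refine eq_top_iff.2 fun w _ => ?_
  induction w using CliffordAlgebra.left_induction with
  | algebraMap r =>
    refine hle 0 0 ?_
    rw [formType_eq, pow_zero, pow_zero, mul_one]
    exact Submodule.mem_one.2 ⟨r, rfl⟩
  | add x y hx hy => exact add_mem (hx trivial) (hy trivial)
  | ι_mul x m hx =>
    have e : (CliffordAlgebra.ι 0 m : ExteriorAlgebra ℂ (TCDual (Cn n))) =
        ExteriorAlgebra.ι ℂ ((m.1, 0) : TCDual (Cn n)) +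
          ExteriorAlgebra.ι ℂ ((0, m.2) : TCDual (Cn n)) := by
      rw [← map_add]
      simp [ExteriorAlgebra.ι]
    have h1 : ∀ a : TCDual (Cn n), ∀ x ∈ ⨆ p : ℕ × ℕ, formType (Cn n) p.1 p.2, (∀ p q, ∀ w ∈ formType (Cn n) p q,
        ExteriorAlgebra.ι ℂ a * w ∈ ⨆ p : ℕ × ℕ, formType (Cn n) p.1 p.2) →
        ExteriorAlgebra.ι ℂ a * x ∈ ⨆ p : ℕ × ℕ, formType (Cn n) p.1 p.2 := by
      intro a x hx h
      have : (⨆ p : ℕ × ℕ, formType (Cn n) p.1 p.2) ≤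
          (⨆ p : ℕ × ℕ, formType (Cn n) p.1 p.2).comap
            (LinearMap.mulLeft ℂ (ExteriorAlgebra.ι ℂ a)) :=
        iSup_le fun p w hw => h p.1 p.2 w hw
      exact this hx
    rw [e, add_mul]
    refine add_mem (h1 _ x (hx trivial) fun p q w hw => ?_)
      (h1 _ x (hx trivial) fun p q w hw => ?_)
    · refine hle (p + 1) q ?_
      rw [formType_eq, pow_succ', mul_assoc]
      exact Submodule.mul_mem_mul ⟨m.1, rfl⟩ hw
    · refine hle p (q + 1) ?_
      rw [formType_eq, pow_succ', ← mul_assoc, ((holSub_antiholSub_commute (Cn n)).pow_left p).eq,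
        mul_assoc]
      exact Submodule.mul_mem_mul ⟨m.2, rfl⟩ hw

theorem tauFib_surjective : Function.Surjective (tauFib (Cn n) n) := by
  rw [← LinearMap.range_eq_top, ← top_le_iff, ← iSup_formType_eq_top]
  refine iSup_le fun ⟨p, q⟩ => ?_
  rcases lt_or_ge n p with hp | hp
  · simp only [formType_eq, holSub_pow_eq_bot n hp, Submodule.bot_mul, bot_le]
  · exact (formType_le_map n (p := p) (j := n - p) q (by omega)).trans LinearMap.map_le_range

theorem finrank_exteriorAlgebra (M : Type*) [AddCommGroup M] [Module ℂ M] [Module.Finite ℂ M] :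
    Module.finrank ℂ (ExteriorAlgebra ℂ M) = 2 ^ Module.finrank ℂ M := by
  rw [Module.finrank_eq_card_basis (Module.finBasis ℂ M).ExteriorAlgebra]
  simp

theorem finrank_LFib : Module.finrank ℂ (LFib (Cn n) n) = 1 := by
  rw [exteriorPower.finrank_eq, Subspace.dual_finrank_eq, Module.finrank_fin_fun, Nat.choose_self]

/-- Since `ℒ` is a line, both sides have dimension 2 to the power n plus that of (T^{0,1})^*, so
surjectivity suffices. -/
theorem tauFib_bijective : Function.Bijective (tauFib (Cn n) n) := by
  refine ⟨?_, tauFib_surjective n⟩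
  refine (LinearMap.injective_iff_surjective_of_finrank_eq_finrank ?_).2 (tauFib_surjective n)
  rw [Module.finrank_tensorProduct, finrank_LFib, mul_one, finrank_exteriorAlgebra,
    finrank_exteriorAlgebra, Module.finrank_prod, Module.finrank_prod, Subspace.dual_finrank_eq]

/-- `τ` on the fibre of the model space. -/
def tauEquiv : ALFib (Cn n) n ≃ₗ[ℂ] ExteriorAlgebra ℂ (TCDual (Cn n)) :=
  LinearEquiv.ofBijective _ (tauFib_bijective n)

theorem tauFib_bijOn (k : ℕ) :
    Set.BijOn (tauFib (Cn n) n) (alDegree (Cn n) n k) (formDegree (Cn n) n k) :=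
  ⟨fun _ hv => tauFib_mem_formDegree hv, (tauFib_bijective n).1.injOn,
    fun _ hw => formDegree_le_map n k hw⟩

theorem coefL_holFrame : coefL n (holFrame n) = 1 := by
  rw [coefL, LinearMap.flip_apply, holFrame, exteriorPower.pairingDual_ιMulti_ιMulti]
  have : Matrix.of (fun i j => dz n j (ddz n i)) = (1 : Matrix (Fin n) (Fin n) ℂ) := by
    ext i j
    simp [dz, ddz, Matrix.one_apply, Pi.single_apply, eq_comm]
  rw [this, Matrix.det_one]

theorem coefL_smul_holFrame (s : LFib (Cn n) n) : coefL n s • holFrame n = s := by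
  have h0 : holFrame n ≠ 0 := by
    intro h
    have := coefL_holFrame n
    rw [h, map_zero] at this
    exact zero_ne_one this
  obtain ⟨c, rfl⟩ := (finrank_eq_one_iff_of_nonzero' _ h0).1 (finrank_LFib n) s
  rw [map_smul, coefL_holFrame, smul_eq_mul, mul_one]

/-- It reduces a computation with an arbitrary element of `∧^• A ⊗ ℒ` to a pure tensor with the
coordinate frame. -/
theorem coefAL_tmul (v : ALFib (Cn n) n) : coefAL n v ⊗ₜ[ℂ] holFrame n = v := by
  induction v using TensorProduct.induction_on with
  | zero => simp
  | add v w hv hw => rw [map_add, TensorProduct.add_tmul, hv, hw]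
  | tmul u s =>
    have : coefAL n (u ⊗ₜ[ℂ] s) = coefL n s • u := by simp [coefAL]
    rw [this, TensorProduct.smul_tmul, coefL_smul_holFrame]

theorem coefAL_mem {k : ℕ} {v : ALFib (Cn n) n} (hv : v ∈ alDegree (Cn n) n k) :
    coefAL n v ∈ ⋀[ℂ]^k (AFib (Cn n)) := by
  refine alDegree_induction (p := fun v => coefAL n v ∈ ⋀[ℂ]^k (AFib (Cn n))) ?_
    (fun u hu s => ?_) (fun a b ha hb => ?_) hv
  · simp
  · have : coefAL n (u ⊗ₜ[ℂ] s) = coefL n s • u := by simp [coefAL]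
    rw [this]
    exact Submodule.smul_mem _ _ hu
  · rw [map_add]
    exact add_mem ha hb

end TauModel

/-! ## The Dolbeault operators in a chart -/

section Dolbeault

variable {n : ℕ}

/-- The sign selecting `∂/∂z^i` (`true`) or `∂/∂z̄^i` (`false`). -/
def sg : Bool → ℂ
  | true => 1
  | false => -1

/-- The covectors `dz^i` (`true`) and `dz̄^i` (`false`). -/
def cof : Bool → Fin n → TCDual (Cn n)
  | true => dzT n
  | false => dzbarT n

/-- The operators `∂` (`true`) and `∂̄` (`false`) on differential forms. -/
def dolb (b : Bool) (w : Cn n → ExteriorAlgebra ℂ (TCDual (Cn n))) (z : Cn n) :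
    ExteriorAlgebra ℂ (TCDual (Cn n)) :=
  ∑ i, ExteriorAlgebra.ι ℂ (cof b i) * wdv (sg b) i w z

theorem delLoc_eq (w : Cn n → ExteriorAlgebra ℂ (TCDual (Cn n))) : delLoc w = dolb true w := by
  funext z
  simp only [delLoc, dolb, pd_eq, cof, sg]

theorem delbarLoc_eq (w : Cn n → ExteriorAlgebra ℂ (TCDual (Cn n))) :
    delbarLoc w = dolb false w := by
  funext z
  simp only [delbarLoc, dolb, pdBar_eq, cof, sg]

theorem dolb_congr {b : Bool} {w w' : Cn n → ExteriorAlgebra ℂ (TCDual (Cn n))} {z : Cn n}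
    (h : w =ᶠ[nhds z] w') : dolb b w z = dolb b w' z := by
  simp only [dolb, wdv_congr h]

theorem dolb_add {b : Bool} {w w' : Cn n → ExteriorAlgebra ℂ (TCDual (Cn n))} {z : Cn n}
    (h : CDiffAt w z) (h' : CDiffAt w' z) :
    dolb b (fun y => w y + w' y) z = dolb b w z + dolb b w' z := by
  simp only [dolb, wdv_add _ _ h h', mul_add, Finset.sum_add_distrib]

theorem dolb_smul {b : Bool} (c : ℂ) {w : Cn n → ExteriorAlgebra ℂ (TCDual (Cn n))} {z : Cn n}
    (h : CDiffAt w z) : dolb b (fun y => c • w y) z = c • dolb b w z := by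
  have e : ∀ i, wdv (sg b) i (fun y => c • w y) z = c • wdv (sg b) i w z := by
    intro i
    simp only [wdv, map_smul, smul_eq_mul, wd_const_mul _ _ _ (h _), mul_smul, Finset.smul_sum]
  simp only [dolb, e, mul_smul_comm, Finset.smul_sum]

theorem CSmoothAt.dolb (b : Bool) {w : Cn n → ExteriorAlgebra ℂ (TCDual (Cn n))} {z : Cn n}
    (h : CSmoothAt w z) : CSmoothAt (dolb b w) z :=
  CSmoothAt.sum _ fun _ _ => h.wdv.linear (LinearMap.mulLeft ℂ _)

theorem eq_zero_of_eq_neg_self {E : Type*} [AddCommGroup E] [Module ℂ E] {x : E} (h : x = -x) :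
    x = 0 := by
  have h2 : (2 : ℂ) • x = 0 := by
    rw [two_smul]
    nth_rewrite 1 [h]
    exact neg_add_cancel _
  exact (smul_eq_zero.1 h2).resolve_left two_ne_zero

theorem sum_sum_eq_zero_of_antisymm {E : Type*} [AddCommGroup E] [Module ℂ E]
    {f : Fin n → Fin n → E} (h : ∀ i j, f i j = -f j i) : ∑ i, ∑ j, f i j = 0 := by
  have h1 : ∑ i, ∑ j, f i j = -∑ i, ∑ j, f i j := by
    conv_lhs => rw [Finset.sum_comm]
    simp only [← Finset.sum_neg_distrib]
    exact Finset.sum_congr rfl fun i _ => Finset.sum_congr rfl fun j _ => h j i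
  exact eq_zero_of_eq_neg_self h1

/-- Derivatives commute and covectors anticommute. With b = b' it gives ∂² = 0 and ∂̄² = 0, with b ≠
b' the relation ∂∂̄ + ∂̄∂ = 0. -/
theorem dolb_anticomm (b b' : Bool) {w : Cn n → ExteriorAlgebra ℂ (TCDual (Cn n))} {z : Cn n}
    (h : CSmoothAt w z) : dolb b (dolb b' w) z = -dolb b' (dolb b w) z := by
  have e : ∀ (b b' : Bool), dolb b (dolb b' w) z = ∑ i, ∑ j, ExteriorAlgebra.ι ℂ (cof b i) *
      (ExteriorAlgebra.ι ℂ (cof b' j) * wdv (sg b) i (wdv (sg b') j w) z) := by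
    intro b b'
    refine Finset.sum_congr rfl fun i _ => ?_
    have : wdv (sg b) i (dolb b' w) z = ∑ j, ExteriorAlgebra.ι ℂ (cof b' j) *
        wdv (sg b) i (wdv (sg b') j w) z := by
      refine dual_ext fun ℓ => ?_
      rw [dual_wdv _ _ (h.dolb b').cDiffAt]
      simp only [dolb, map_sum]
      rw [wd_sum (sg b) i Finset.univ (f := fun j y => ℓ (ExteriorAlgebra.ι ℂ (cof b' j) *
        wdv (sg b') j w y)) fun j _ => (h.wdv.linear (LinearMap.mulLeft ℂ
          (ExteriorAlgebra.ι ℂ (cof b' j)))).cDiffAt ℓ]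
      refine Finset.sum_congr rfl fun j _ => ?_
      exact (dual_wdv _ _ h.wdv.cDiffAt
        (ℓ ∘ₗ LinearMap.mulLeft ℂ (ExteriorAlgebra.ι ℂ (cof b' j)))).symm
    rw [this, Finset.mul_sum]
  rw [e, e, Finset.sum_comm, ← Finset.sum_neg_distrib]
  refine Finset.sum_congr rfl fun j _ => ?_
  rw [← Finset.sum_neg_distrib]
  refine Finset.sum_congr rfl fun i _ => ?_
  rw [wdv_comm _ _ _ _ h, ← mul_assoc, ι_mul_ι_comm, neg_mul, mul_assoc]

theorem dolb_ι_mul (b : Bool) {a : Cn n → TCDual (Cn n)}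
    {w : Cn n → ExteriorAlgebra ℂ (TCDual (Cn n))} {z : Cn n} (ha : CDiffAt a z)
    (hw : CDiffAt w z) :
    dolb b (fun y => ExteriorAlgebra.ι ℂ (a y) * w y) z =
      dolb b (fun y => ExteriorAlgebra.ι ℂ (a y)) z * w z -
        ExteriorAlgebra.ι ℂ (a z) * dolb b w z := by
  have e : ∀ i, wdv (sg b) i (fun y => ExteriorAlgebra.ι ℂ (a y) * w y) z =
      wdv (sg b) i (fun y => ExteriorAlgebra.ι ℂ (a y)) z * w z +
        ExteriorAlgebra.ι ℂ (a z) * wdv (sg b) i w z := fun i =>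
    wdv_bilin _ _ (LinearMap.mul ℂ (ExteriorAlgebra ℂ (TCDual (Cn n))))
      (ha.linear (ExteriorAlgebra.ι ℂ)) hw
  simp only [dolb, e, mul_add, Finset.sum_add_distrib, Finset.sum_mul, Finset.mul_sum, mul_assoc,
    sub_eq_add_neg, ← Finset.sum_neg_distrib]
  congr 1
  refine Finset.sum_congr rfl fun i _ => ?_
  rw [← mul_assoc, ι_mul_ι_comm, neg_mul, mul_assoc]

theorem tcDual_induction {p : TCDual (Cn n) → Prop} (hz : p 0) (hc : ∀ b i, p (cof b i))
    (hadd : ∀ a a', p a → p a' → p (a + a')) (hsmul : ∀ (c : ℂ) a, p a → p (c • a))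
    (a : TCDual (Cn n)) : p a := by
  have hsum : ∀ (f : Fin n → TCDual (Cn n)), (∀ i, p (f i)) → p (∑ i, f i) := fun f hf =>
    Finset.sum_induction _ p hadd hz fun i _ => hf i
  have : a = (∑ i, a.1 (ddz n i) • cof true i) + ∑ i, a.2 (ddz n i) • cof false i := by
    refine Prod.ext ?_ ?_
    · conv_lhs => rw [dual_eq_sum n a.1]
      simp [cof, dzT, dzbarT, Prod.fst_sum]
    · conv_lhs => rw [conjDual_eq_sum n a.2]
      simp [cof, dzT, dzbarT, Prod.snd_sum]
  rw [this]
  exact hadd _ _ (hsum _ fun i => hsmul _ _ (hc _ _)) (hsum _ fun i => hsmul _ _ (hc _ _))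

/-! ### Pullback by holomorphic maps -/

/-- The component `F^j` (`true`) or its conjugate (`false`). -/
def cmp : Bool → (Cn n → Cn n) → Fin n → Cn n → ℂ
  | true, F, j => fun y => F y j
  | false, F, j => fun y => starRingEnd ℂ (F y j)

/-- The pullback of a differential form by a map. -/
def pull (F : Cn n → Cn n) (w : Cn n → ExteriorAlgebra ℂ (TCDual (Cn n))) (z : Cn n) :
    ExteriorAlgebra ℂ (TCDual (Cn n)) :=
  ExteriorAlgebra.map (tMap (fderiv ℂ F z : Cn n →ₗ[ℂ] Cn n)) (w (F z))

theorem fderiv_cmp (b : Bool) {F : Cn n → Cn n} {z : Cn n} (hF : DifferentiableAt ℂ F z)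
    (j : Fin n) (v : Cn n) :
    fderiv ℝ (cmp b F j) z v = cmp b (fderiv ℂ F z) j v := by
  have h1 : HasFDerivAt (fun y => F y j)
      (((ContinuousLinearMap.proj (R := ℝ) (φ := fun _ : Fin n => ℂ) j)).comp
        ((fderiv ℂ F z).restrictScalars ℝ)) z :=
    (ContinuousLinearMap.proj (R := ℝ) (φ := fun _ : Fin n => ℂ) j).hasFDerivAt.comp z
      (hF.hasFDerivAt.restrictScalars ℝ)
  cases b with
  | true => simp only [cmp, h1.fderiv]; rfl
  | false =>
    have h2 : HasFDerivAt (fun y => starRingEnd ℂ (F y j)) _ z :=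
      ((Complex.conjCLE : ℂ →L[ℝ] ℂ).hasFDerivAt (x := F z j)).comp z h1
    simp only [cmp, h2.fderiv]
    rfl

theorem map_single_I (L : Cn n →L[ℂ] Cn n) (i : Fin n) :
    L (Pi.single i Complex.I) = Complex.I • L (Pi.single i 1) := by
  rw [← map_smul]
  congr 1
  ext j
  simp [Pi.single_apply]

theorem wd_cmp (b : Bool) {F : Cn n → Cn n} {z : Cn n} (hF : DifferentiableAt ℂ F z)
    (i j : Fin n) : wd (sg b) i (cmp b F j) z = cmp b (fderiv ℂ F z) j (ddz n i) := by
  rw [wd, fderiv_cmp b hF, fderiv_cmp b hF]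
  cases b with
  | true =>
    simp only [sg, cmp, map_single_I, Pi.smul_apply, smul_eq_mul, ddz]
    linear_combination (-(fderiv ℂ F z) (Pi.single i 1) j / 2) * Complex.I_sq
  | false =>
    simp only [sg, cmp, map_single_I, Pi.smul_apply, smul_eq_mul, ddz, map_mul, Complex.conj_I]
    linear_combination (-(starRingEnd ℂ ((fderiv ℂ F z) (Pi.single i 1) j)) / 2) * Complex.I_sq

/-- The Cauchy-Riemann equations: ∂̄F^j = 0, and ∂ of the conjugate of F^j is zero. -/
theorem wd_cmp_of_ne {b b' : Bool} (hb : b ≠ b') {F : Cn n → Cn n} {z : Cn n}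
    (hF : DifferentiableAt ℂ F z) (i j : Fin n) : wd (sg b) i (cmp b' F j) z = 0 := by
  rw [wd, fderiv_cmp b' hF, fderiv_cmp b' hF]
  cases b <;> cases b' <;> try exact absurd rfl hb
  · simp only [sg, cmp, map_single_I, Pi.smul_apply, smul_eq_mul]
    linear_combination ((fderiv ℂ F z) (Pi.single i 1) j / 2) * Complex.I_sq
  · simp only [sg, cmp, map_single_I, Pi.smul_apply, smul_eq_mul, map_mul, Complex.conj_I]
    linear_combination (starRingEnd ℂ ((fderiv ℂ F z) (Pi.single i 1) j) / 2) * Complex.I_sq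

theorem tMap_cof (b : Bool) (L : Cn n →L[ℂ] Cn n) (j : Fin n) :
    tMap (L : Cn n →ₗ[ℂ] Cn n) (cof b j) = ∑ i, cmp b L j (ddz n i) • cof b i := by
  cases b with
  | true =>
    refine Prod.ext ?_ ?_
    · have := dual_eq_sum n ((dz n j) ∘ₗ (L : Cn n →ₗ[ℂ] Cn n))
      rw [show dz n j ∘ₗ (L : Cn n →ₗ[ℂ] Cn n) = (L : Cn n →ₗ[ℂ] Cn n).dualMap (dz n j) from rfl]
        at this
      simpa [tMap, cof, dzT, Prod.fst_sum, cmp, dz] using this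
    · simp [tMap, cof, dzT, Prod.snd_sum]
  | false =>
    refine Prod.ext ?_ ?_
    · simp [tMap, cof, dzbarT, Prod.fst_sum]
    · have := conjDual_eq_sum n ((dzbar n j).comp (L : Cn n →ₗ[ℂ] Cn n))
      simpa [tMap, cof, dzbarT, Prod.snd_sum, cmp, dzbar, conjDualMap] using this

/-- By complex linearity of dF, composition with a holomorphic map does not mix the derivatives in z
with those in z̄. -/
theorem wd_comp (b : Bool) {F : Cn n → Cn n} {z : Cn n} (hF : DifferentiableAt ℂ F z)
    {g : Cn n → ℂ} (hg : DifferentiableAt ℝ g (F z)) (i : Fin n) :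
    wd (sg b) i (fun y => g (F y)) z =
      ∑ j, cmp b (fderiv ℂ F z) j (ddz n i) * wd (sg b) j g (F z) := by
  have h : ∀ v, fderiv ℝ (fun y => g (F y)) z v = fderiv ℝ g (F z) (fderiv ℂ F z v) := by
    intro v
    have := hg.hasFDerivAt.comp z (hF.hasFDerivAt.restrictScalars ℝ)
    have h2 : fderiv ℝ (fun y => g (F y)) z = _ := this.fderiv
    rw [h2]
    rfl
  rw [wd, h, h, fderiv_eq_sum_wd, fderiv_eq_sum_wd, Finset.mul_sum, ← Finset.sum_sub_distrib,
    Finset.sum_div]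
  refine Finset.sum_congr rfl fun j _ => ?_
  cases b with
  | true =>
    simp only [sg, cmp, map_single_I, Pi.smul_apply, smul_eq_mul, ddz, map_mul, Complex.conj_I]
    linear_combination (-(fderiv ℂ F z (Pi.single i 1) j * wd 1 j g (F z) -
      starRingEnd ℂ (fderiv ℂ F z (Pi.single i 1) j) * wd (-1) j g (F z)) / 2) * Complex.I_sq
  | false =>
    simp only [sg, cmp, map_single_I, Pi.smul_apply, smul_eq_mul, ddz, map_mul, Complex.conj_I]
    linear_combination ((fderiv ℂ F z (Pi.single i 1) j * wd 1 j g (F z) -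
      starRingEnd ℂ (fderiv ℂ F z (Pi.single i 1) j) * wd (-1) j g (F z)) / 2) * Complex.I_sq

theorem contDiffAt_cmp (b : Bool) {F : Cn n → Cn n} {z : Cn n} (hF : ContDiffAt ℂ ω F z)
    (j : Fin n) : ContDiffAt ℝ ∞ (cmp b F j) z := by
  have h0 : ContDiffAt ℝ ∞ F z := (hF.restrict_scalars ℝ).of_le (by simp)
  have h1 : ContDiffAt ℝ ∞ (fun y => F y j) z := contDiffAt_pi.1 h0 j
  cases b with
  | true => exact h1
  | false => exact (Complex.conjCLE : ℂ →L[ℝ] ℂ).contDiff.contDiffAt.comp z h1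

theorem eventually_differentiableAt {F : Cn n → Cn n} {z : Cn n} (hF : ContDiffAt ℂ ω F z) :
    ∀ᶠ y in nhds z, DifferentiableAt ℂ F y :=
  ((hF.of_le (m := 1) (by simp)).eventually (by simp)).mono fun _ hy =>
    hy.differentiableAt (by simp)

/-- The pullback of dz^j is ∂F^j and that of dz̄^j is ∂̄ of the conjugate of F^j. Both are closed
under ∂ and ∂̄, so the pulled-back coframe behaves like a coordinate coframe. -/
theorem dolb_pull_covector (b : Bool) {F : Cn n → Cn n} {z : Cn n} (hF : ContDiffAt ℂ ω F z)
    (a : TCDual (Cn n)) :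
    CSmoothAt (fun y => tMap (fderiv ℂ F y : Cn n →ₗ[ℂ] Cn n) a) z ∧
      dolb b (fun y => ExteriorAlgebra.ι ℂ (tMap (fderiv ℂ F y : Cn n →ₗ[ℂ] Cn n) a)) z = 0 := by
  induction a using tcDual_induction with
  | hz =>
    simp only [map_zero]
    refine ⟨cSmoothAt_const _ _, ?_⟩
    simp [dolb, wdv_const]
  | hadd a a' h h' =>
    simp only [map_add]
    refine ⟨h.1.add h'.1, ?_⟩
    rw [dolb_add (h.1.linear _).cDiffAt (h'.1.linear _).cDiffAt, h.2, h'.2, add_zero]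
  | hsmul c a h =>
    simp only [map_smul]
    refine ⟨h.1.linear (c • (LinearMap.id : _ →ₗ[ℂ] _)), ?_⟩
    rw [dolb_smul _ (h.1.linear _).cDiffAt, h.2, smul_zero]
  | hc b' j =>
    have e : (fun y => tMap (fderiv ℂ F y : Cn n →ₗ[ℂ] Cn n) (cof b' j)) =ᶠ[nhds z]
        fun y => ∑ i, wd (sg b') i (cmp b' F j) y • cof b' i := by
      filter_upwards [eventually_differentiableAt hF] with y hy
      rw [tMap_cof]
      exact Finset.sum_congr rfl fun i _ => by rw [wd_cmp b' hy]
    have hs : ∀ i, ContDiffAt ℝ ∞ (wd (sg b') i (cmp b' F j)) z := fun i =>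
      contDiffAt_wd (contDiffAt_cmp b' hF j)
    have hs' : CSmoothAt (fun y => ∑ i, wd (sg b') i (cmp b' F j) y • cof (n := n) b' i) z := by
      refine CSmoothAt.sum _ fun i _ => ?_
      exact (cSmoothAt_scalar.2 (hs i)).linear (LinearMap.toSpanSingleton ℂ _ (cof b' i))
    refine ⟨hs'.congr e, ?_⟩
    have e' : (fun y => ExteriorAlgebra.ι ℂ (tMap (fderiv ℂ F y : Cn n →ₗ[ℂ] Cn n) (cof b' j)))
        =ᶠ[nhds z] fun y => ∑ i, wd (sg b') i (cmp b' F j) y • ExteriorAlgebra.ι ℂ (cof b' i) := by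
      filter_upwards [e] with y hy
      rw [hy]
      simp
    have e2 : ∀ k, wdv (sg b) k (fun y => ∑ i, wd (sg b') i (cmp b' F j) y •
        ExteriorAlgebra.ι ℂ (cof b' i)) z =
        ∑ i, wd (sg b) k (wd (sg b') i (cmp b' F j)) z • ExteriorAlgebra.ι ℂ (cof b' i) := by
      intro k
      have hd : CDiffAt (fun y => ∑ i, wd (sg b') i (cmp b' F j) y •
          ExteriorAlgebra.ι ℂ (cof (n := n) b' i)) z := by
        refine (CSmoothAt.sum _ fun i _ => ?_).cDiffAt
        exact (cSmoothAt_scalar.2 (hs i)).linear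
          (LinearMap.toSpanSingleton ℂ _ (ExteriorAlgebra.ι ℂ (cof b' i)))
      refine dual_ext fun ℓ => ?_
      rw [dual_wdv _ _ hd]
      simp only [map_sum, map_smul, smul_eq_mul, mul_comm _ (ℓ _)]
      rw [wd_sum _ _ _ fun i _ => ((hs i).differentiableAt (by simp)).const_mul _]
      exact Finset.sum_congr rfl fun i _ => wd_const_mul _ _ _ ((hs i).differentiableAt (by simp))
    rw [dolb_congr e', dolb]
    simp only [e2, Finset.mul_sum, mul_smul_comm]
    by_cases hb : b = b'
    -- Equal types: symmetric second derivatives are paired with anticommuting covectors.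
    · subst hb
      refine sum_sum_eq_zero_of_antisymm fun k i => ?_
      rw [wd_comm _ _ _ _ (contDiffAt_cmp b hF j), ι_mul_ι_comm, smul_neg]
    · refine Finset.sum_eq_zero fun k _ => Finset.sum_eq_zero fun i _ => ?_
      -- Opposite types: after exchanging the derivatives, the inner one vanishes near z by the
      -- Cauchy-Riemann equations.
      rw [wd_comm _ _ _ _ (contDiffAt_cmp b' hF j)]
      have : wd (sg b) k (cmp b' F j) =ᶠ[nhds z] fun _ => 0 := by
        filter_upwards [eventually_differentiableAt hF] with y hy
        exact wd_cmp_of_ne hb hy _ _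
      rw [wd_congr this, wd_const, zero_smul]

/-- Induction on the number of factors of the constant covector E: scalars are the chain rule, and
an extra factor passes through by the Leibniz rule because its pullback is closed. Differentiability
is carried along since the Leibniz rule needs it. -/
theorem dolb_pull_smul (b : Bool) {F : Cn n → Cn n} {z : Cn n} (hF : ContDiffAt ℂ ω F z)
    {f : Cn n → ℂ} (hf : DifferentiableAt ℝ f (F z)) (E : ExteriorAlgebra ℂ (TCDual (Cn n))) :
    CDiffAt (pull F (fun y => f y • E)) z ∧ dolb b (pull F (fun y => f y • E)) z =
      ExteriorAlgebra.map (tMap (fderiv ℂ F z : Cn n →ₗ[ℂ] Cn n))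
        (dolb b (fun y => f y • E) (F z)) := by
  have hF1 : DifferentiableAt ℂ F z := hF.differentiableAt (by simp)
  have hfF : DifferentiableAt ℝ (fun y => f (F y)) z :=
    hf.comp z (hF1.restrictScalars ℝ)
  have hC : ∀ {g : Cn n → ℂ} {x : Cn n} (E : ExteriorAlgebra ℂ (TCDual (Cn n))),
      DifferentiableAt ℝ g x → CDiffAt (fun y => g y • E) x := by
    intro g x E hg ℓ
    simp only [map_smul, smul_eq_mul]
    exact hg.mul_const _
  have hD : ∀ {g : Cn n → ℂ} {x : Cn n} (E : ExteriorAlgebra ℂ (TCDual (Cn n))) (i : Fin n),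
      DifferentiableAt ℝ g x → wdv (sg b) i (fun y => g y • E) x = wd (sg b) i g x • E := by
    intro g x E i hg
    refine dual_ext fun ℓ => ?_
    rw [dual_wdv _ _ (hC E hg)]
    simp only [map_smul, smul_eq_mul, mul_comm _ (ℓ _)]
    exact wd_const_mul _ _ _ hg
  induction E using CliffordAlgebra.left_induction with
  | algebraMap r =>
    have e : pull F (fun y => f y • algebraMap ℂ (CliffordAlgebra (0 : QuadraticForm ℂ _)) r) =
        fun y => f (F y) • algebraMap ℂ (ExteriorAlgebra ℂ (TCDual (Cn n))) r := by
      funext y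
      rw [pull, map_smul]
      congr 1
      exact AlgHom.commutes _ r
    rw [e]
    refine ⟨hC _ hfF, ?_⟩
    simp only [dolb, hD _ _ hfF, wd_comp b hF1 hf, map_sum, map_mul, ExteriorAlgebra.map_apply_ι,
      tMap_cof]
    have e2 : ∀ j, wdv (sg b) j (fun y => f y • algebraMap ℂ
      (CliffordAlgebra (0 : QuadraticForm ℂ (TCDual (Cn n)))) r) (F z) =
      wd (sg b) j f (F z) • algebraMap ℂ (ExteriorAlgebra ℂ (TCDual (Cn n))) r := fun j => hD _ _ hf
    simp only [e2, map_smul, AlgHom.commutes, Finset.sum_mul, Finset.sum_smul, Finset.mul_sum]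
    rw [Finset.sum_comm]
    refine Finset.sum_congr rfl fun j _ => Finset.sum_congr rfl fun i _ => ?_
    simp only [smul_mul_assoc, mul_smul_comm, smul_smul, mul_comm (wd _ _ _ _)]
  | add x y hx hy =>
    have e : pull F (fun u => f u • (x + y)) =
        fun u => pull F (fun u => f u • x) u + pull F (fun u => f u • y) u := by
      funext u
      simp only [pull, smul_add, map_add]
    refine ⟨?_, ?_⟩
    · rw [e]
      intro ℓ
      simp only [map_add]
      exact (hx.1 ℓ).fun_add (hy.1 ℓ)
    · rw [e, dolb_add hx.1 hy.1, hx.2, hy.2, ← map_add, ← dolb_add (hC _ hf) (hC _ hf)]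
      simp only [smul_add]
  | ι_mul x m hx =>
    have h0 := dolb_pull_covector b hF m
    have e : pull F (fun u => f u • (CliffordAlgebra.ι 0 m * x)) = fun u =>
        ExteriorAlgebra.ι ℂ (tMap (fderiv ℂ F u : Cn n →ₗ[ℂ] Cn n) m) *
          pull F (fun u => f u • x) u := by
      funext u
      simp only [pull, map_smul, mul_smul_comm]
      congr 1
      rw [map_mul]
      congr 1
      exact ExteriorAlgebra.map_apply_ι _ _
    have e1 : (fun u => f u • (CliffordAlgebra.ι 0 m * x)) = fun u =>
        ExteriorAlgebra.ι ℂ m * (f u • x) := by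
      funext u
      rw [mul_smul_comm]
    refine ⟨?_, ?_⟩
    · rw [e]
      exact CDiffAt.bilin (LinearMap.mul ℂ (ExteriorAlgebra ℂ (TCDual (Cn n))))
        (h0.1.cDiffAt.linear (ExteriorAlgebra.ι ℂ)) hx.1
    · rw [e, dolb_ι_mul b h0.1.cDiffAt hx.1, h0.2, e1,
        dolb_ι_mul b (cSmoothAt_const m _).cDiffAt (hC _ hf), hx.2]
      have : dolb b (fun _ : Cn n => ExteriorAlgebra.ι ℂ m) (F z) = 0 := by
        simp [dolb, wdv_const]
      rw [this]
      simp

theorem dolb_pull (b : Bool) {F : Cn n → Cn n} {z : Cn n} (hF : ContDiffAt ℂ ω F z)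
    {w : Cn n → ExteriorAlgebra ℂ (TCDual (Cn n))} (hw : CDiffAt w (F z)) :
    dolb b (pull F w) z = ExteriorAlgebra.map (tMap (fderiv ℂ F z : Cn n →ₗ[ℂ] Cn n))
      (dolb b w (F z)) := by
  set B := Module.finBasis ℂ (ExteriorAlgebra ℂ (TCDual (Cn n)))
  -- A form is expanded in a basis of constant covectors. Additivity of `dolb` holds for
  -- differentiable summands, so differentiability of the partial sums is part of the induction.
  have key : ∀ s : Finset (Fin (Module.finrank ℂ (ExteriorAlgebra ℂ (TCDual (Cn n))))),
      CDiffAt (fun y => ∑ c ∈ s, B.coord c (w y) • B c) (F z) ∧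
      CDiffAt (pull F (fun y => ∑ c ∈ s, B.coord c (w y) • B c)) z ∧
      dolb b (pull F (fun y => ∑ c ∈ s, B.coord c (w y) • B c)) z =
        ExteriorAlgebra.map (tMap (fderiv ℂ F z : Cn n →ₗ[ℂ] Cn n))
          (dolb b (fun y => ∑ c ∈ s, B.coord c (w y) • B c) (F z)) := by
    intro s
    induction s using Finset.induction_on with
    | empty =>
      have : pull F (fun _ => 0) = fun _ => 0 := by
        funext y
        simp [pull]
      simp only [Finset.sum_empty, this]
      refine ⟨(cSmoothAt_const _ _).cDiffAt, (cSmoothAt_const _ _).cDiffAt, ?_⟩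
      simp [dolb, wdv_const]
    | insert c s hc ih =>
      have h1 := dolb_pull_smul b hF (hw (B.coord c)) (B c)
      have h2 : CDiffAt (fun y => B.coord c (w y) • B c) (F z) :=
        hw.linear ((LinearMap.toSpanSingleton ℂ _ (B c)).comp (B.coord c))
      have e : pull F (fun y => B.coord c (w y) • B c + ∑ c ∈ s, B.coord c (w y) • B c) =
          fun y => pull F (fun y => B.coord c (w y) • B c) y +
            pull F (fun y => ∑ c ∈ s, B.coord c (w y) • B c) y := by
        funext y
        simp only [pull, map_add]
      have hadd : ∀ {f g : Cn n → ExteriorAlgebra ℂ (TCDual (Cn n))} {x : Cn n}, CDiffAt f x →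
          CDiffAt g x → CDiffAt (fun y => f y + g y) x := by
        intro f g x hf hg ℓ
        simp only [map_add]
        exact (hf ℓ).fun_add (hg ℓ)
      simp only [Finset.sum_insert hc]
      refine ⟨hadd h2 ih.1, ?_, ?_⟩
      · rw [e]
        exact hadd h1.1 ih.2.1
      · rw [e, dolb_add h1.1 ih.2.1, dolb_add h2 ih.1, h1.2, ih.2.2, map_add]
  have hsum : (fun y => ∑ c, B.coord c (w y) • B c) = w := by
    funext y
    exact B.sum_repr (w y)
  have := (key Finset.univ).2.2
  rwa [hsum] at this

end Dolbeault

/-! ## The Koszul operator in a chart -/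

section KoszulLocal

variable {n : ℕ}

/-- The commutator `[∂, ι_H]` in a chart. -/
def brLoc (H : Cn n → ExteriorAlgebra ℂ (AFib (Cn n)))
    (w : Cn n → ExteriorAlgebra ℂ (TCDual (Cn n))) (z : Cn n) : ExteriorAlgebra ℂ (TCDual (Cn n)) :=
  dolb true (fun y => -clifford (Cn n) (H y) (w y)) z - -clifford (Cn n) (H z) (dolb true w z)

theorem clifford_mul_apply (a b : ExteriorAlgebra ℂ (AFib (Cn n)))
    (w : ExteriorAlgebra ℂ (TCDual (Cn n))) :
    clifford (Cn n) (a * b) w = clifford (Cn n) a (clifford (Cn n) b w) := by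
  rw [map_mul, Module.End.mul_apply]

theorem CDiffAt.clifford {u : Cn n → ExteriorAlgebra ℂ (AFib (Cn n))}
    {w : Cn n → ExteriorAlgebra ℂ (TCDual (Cn n))} {z : Cn n} (hu : CDiffAt u z)
    (hw : CDiffAt w z) : CDiffAt (fun y => clifford (Cn n) (u y) (w y)) z :=
  CDiffAt.bilin (ExtPoisson.clifford (Cn n)).toLinearMap hu hw

theorem wdv_clifford (ε : ℂ) (i : Fin n) {u : Cn n → ExteriorAlgebra ℂ (AFib (Cn n))}
    {w : Cn n → ExteriorAlgebra ℂ (TCDual (Cn n))} {z : Cn n} (hu : CDiffAt u z)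
    (hw : CDiffAt w z) : wdv ε i (fun y => clifford (Cn n) (u y) (w y)) z =
      clifford (Cn n) (wdv ε i u z) (w z) + clifford (Cn n) (u z) (wdv ε i w z) :=
  wdv_bilin ε i (clifford (Cn n)).toLinearMap hu hw

theorem CDiffAt.neg {F : Type*} [AddCommGroup F] [Module ℂ F] {f : Cn n → F} {z : Cn n}
    (hf : CDiffAt f z) : CDiffAt (fun y => -f y) z :=
  hf.linear (-(LinearMap.id : F →ₗ[ℂ] F))

theorem wdv_neg {F : Type*} [AddCommGroup F] [Module ℂ F] [Module.Finite ℂ F] (ε : ℂ) (i : Fin n)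
    {f : Cn n → F} {z : Cn n} (hf : CDiffAt f z) : wdv ε i (fun y => -f y) z = -wdv ε i f z :=
  wdv_linear ε i (-(LinearMap.id : F →ₗ[ℂ] F)) hf

theorem ι_dzT_mul_clifford (i : Fin n) {k : ℕ} {a : ExteriorAlgebra ℂ (AFib (Cn n))}
    (ha : a ∈ ⋀[ℂ]^k (AFib (Cn n))) (w : ExteriorAlgebra ℂ (TCDual (Cn n))) :
    ExteriorAlgebra.ι ℂ (dzT n i) * clifford (Cn n) a w =
      (-1 : ℂ) ^ (k + 1) • clifford (Cn n)
        (CliffordAlgebra.contractRight a (pairA (coframeA n (.inl i)))) w +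
        (-1 : ℂ) ^ k • clifford (Cn n) a (ExteriorAlgebra.ι ℂ (dzT n i) * w) :=
  ι_mul_clifford (dz n i) ha w

/-- Leibniz on ∂_i (H · w), then `ι_mul_clifford` with k = 2: the terms H · (dz^i ∧ ∂_i w) cancel in
the commutator. What is left is of first order in w, with coefficients H ⌊ dz^i. -/
theorem brLoc_eq {H : Cn n → ExteriorAlgebra ℂ (AFib (Cn n))}
    {w : Cn n → ExteriorAlgebra ℂ (TCDual (Cn n))} {z : Cn n} (hH : CDiffAt H z)
    (hH2 : H z ∈ ⋀[ℂ]^2 (AFib (Cn n))) (hw : CDiffAt w z) :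
    brLoc H w z = ∑ i, (clifford (Cn n)
        (CliffordAlgebra.contractRight (H z) (pairA (coframeA n (.inl i)))) (wdv 1 i w z) -
      ExteriorAlgebra.ι ℂ (dzT n i) * clifford (Cn n) (wdv 1 i H z) (w z)) := by
  rw [brLoc, dolb, dolb, map_sum, sub_neg_eq_add, ← Finset.sum_add_distrib]
  refine Finset.sum_congr rfl fun i _ => ?_
  simp only [sg, cof]
  rw [wdv_neg _ _ (hH.clifford hw), wdv_clifford _ _ hH hw, mul_neg, mul_add,
    ι_dzT_mul_clifford i hH2]
  module

/-- Unlike dz^i, the covector dz̄^i lies in A and commutes with the even element H. The derivatives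
of w thus cancel and only ∂̄H remains. -/
theorem commutator_dolb_false {H : Cn n → ExteriorAlgebra ℂ (AFib (Cn n))}
    {w : Cn n → ExteriorAlgebra ℂ (TCDual (Cn n))} {z : Cn n} (hH : CDiffAt H z)
    (hH2 : H z ∈ ⋀[ℂ]^2 (AFib (Cn n))) (hw : CDiffAt w z) :
    dolb false (fun y => -clifford (Cn n) (H y) (w y)) z -
      -clifford (Cn n) (H z) (dolb false w z) = -clifford (Cn n) (dbarMVLoc H z) (w z) := by
  rw [dolb, dolb, dbarMVLoc, map_sum, map_sum, LinearMap.sum_apply, sub_neg_eq_add,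
    ← Finset.sum_add_distrib, ← Finset.sum_neg_distrib]
  refine Finset.sum_congr rfl fun i _ => ?_
  simp only [sg, cof, pdBar_eq]
  have c : ∀ v, clifford (Cn n) (H z) (ExteriorAlgebra.ι ℂ (dzbarT n i) * v) =
      ExteriorAlgebra.ι ℂ (dzbarT n i) * clifford (Cn n) (H z) v := by
    intro v
    rw [dzbarT, ← clifford_ι_inr, ← clifford_ι_inr, ← Module.End.mul_apply,
      ← Module.End.mul_apply, ← map_mul, ← map_mul, (commute_of_mem_exteriorPower_two hH2 _).eq]
  rw [wdv_neg _ _ (hH.clifford hw), wdv_clifford _ _ hH hw, map_mul (clifford (Cn n)),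
    Module.End.mul_apply, clifford_ι_inr, c, mul_neg, mul_add, dzbarT]
  abel

/-- H commutes with H ⌊ dz^i, which removes the derivatives of w. The two remaining contributions
are equal, each -(H ⌊ dz^i) ∧ ∂_i H, and together they form -[H, H]. -/
theorem commutator_brLoc {H : Cn n → ExteriorAlgebra ℂ (AFib (Cn n))}
    {w : Cn n → ExteriorAlgebra ℂ (TCDual (Cn n))} {z : Cn n} (hH : CDiffAt H z)
    (hH2 : ∀ᶠ y in nhds z, H y ∈ ⋀[ℂ]^2 (AFib (Cn n))) (hw : CDiffAt w z) :
    brLoc H (fun y => -clifford (Cn n) (H y) (w y)) z - -clifford (Cn n) (H z) (brLoc H w z) =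
      -clifford (Cn n) (schoutenLoc 2 2 H H z) (w z) := by
  have h2 := hH2.self_of_nhds
  have hd : ∀ i, wdv 1 i H z ∈ ⋀[ℂ]^2 (AFib (Cn n)) := fun i => wdv_mem _ _ hH _ hH2
  rw [brLoc_eq hH h2 (hH.clifford hw).neg, brLoc_eq hH h2 hw, schoutenLoc, map_sum,
    sub_neg_eq_add, ← Finset.sum_add_distrib]
  -- For p = q = 2 the sign makes the two halves of the Schouten bracket add up.
  have hs : ((-1 : ℂ) ^ ((2 + 1) * (2 + 1))) = -1 := by norm_num
  rw [hs, neg_one_smul, sub_neg_eq_add, ← Finset.sum_add_distrib, map_sum, LinearMap.sum_apply,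
    ← Finset.sum_neg_distrib]
  refine Finset.sum_congr rfl fun i _ => ?_
  simp only [pd_eq]
  rw [wdv_neg _ _ (hH.clifford hw), wdv_clifford _ _ hH hw]
  simp only [map_neg, map_add, map_sub, mul_neg, map_mul, LinearMap.add_apply,
    Module.End.mul_apply]
  have c1 : ∀ a v, clifford (Cn n) (H z) (clifford (Cn n) a v) =
      clifford (Cn n) a (clifford (Cn n) (H z) v) := by
    intro a v
    rw [← Module.End.mul_apply, ← map_mul, (commute_of_mem_exteriorPower_two h2 a).eq, map_mul,
      Module.End.mul_apply]
  have c2 := ι_dzT_mul_clifford i h2 (clifford (Cn n) (wdv 1 i H z) (w z))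
  rw [c1 (CliffordAlgebra.contractRight _ _), ← c1 (wdv 1 i H z) (w z), c2]
  module

/-- The commutator relation between the Maurer-Cartan expression and the operators on forms. -/
theorem maurerCartan_commutator {H : Cn n → ExteriorAlgebra ℂ (AFib (Cn n))}
    {w : Cn n → ExteriorAlgebra ℂ (TCDual (Cn n))} {z : Cn n} (hH : CDiffAt H z)
    (hH2 : ∀ᶠ y in nhds z, H y ∈ ⋀[ℂ]^2 (AFib (Cn n))) (hw : CDiffAt w z) :
    (dolb false (fun y => -clifford (Cn n) (H y) (w y)) z -
      -clifford (Cn n) (H z) (dolb false w z)) + (1 / 2 : ℂ) •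
    (brLoc H (fun y => -clifford (Cn n) (H y) (w y)) z - -clifford (Cn n) (H z) (brLoc H w z)) =
      -clifford (Cn n) (dbarMVLoc H z + (1 / 2 : ℂ) • schoutenLoc 2 2 H H z) (w z) := by
  rw [commutator_dolb_false hH hH2.self_of_nhds hw, commutator_brLoc hH hH2 hw]
  simp only [map_add, map_smul, LinearMap.add_apply, LinearMap.smul_apply]
  module

end KoszulLocal

/-! ## The Evens-Lu-Weinstein module in a chart -/

section ELW

variable {n : ℕ}

theorem pd_const {F : Type*} [AddCommGroup F] [Module ℂ F] [Module.Finite ℂ F] (i : Fin n) (c : F)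
    (z : Cn n) : pd i (fun _ => c) z = 0 := by
  rw [pd_eq, wdv_const]

theorem pdBar_const {F : Type*} [AddCommGroup F] [Module ℂ F] [Module.Finite ℂ F] (i : Fin n)
    (c : F) (z : Cn n) : pdBar i (fun _ => c) z = 0 := by
  rw [pdBar_eq, wdv_const]

theorem along_const {F : Type*} [AddCommGroup F] [Module ℂ F] [Module.Finite ℂ F] (Z : TC (Cn n))
    (c : F) (z : Cn n) : along Z (fun _ => c) z = 0 := by
  simp [along, pd_const, pdBar_const]

theorem along_anchorA_frameA {F : Type*} [AddCommGroup F] [Module ℂ F] [Module.Finite ℂ F]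
    (u : Cn n → F) (z : Cn n) (j : Fin n ⊕ Fin n) :
    along (anchorA (frameA n j)) u z = Sum.elim (fun i => pd i u z) (fun _ => 0) j := by
  cases j with
  | inl j =>
    simp [along, anchorA, frameA, dz, ddz, Pi.single_apply]
  | inr j => simp [along, anchorA, frameA]

theorem lieA_const (u : Cn n → AFib (Cn n)) (β : ADual (Cn n)) (z : Cn n) :
    lieA u (fun _ => β) z = ∑ j, pairA β (pd j u z) • coframeA n (.inl j) := by
  simp only [lieA, bracketA, along_const, along_anchorA_frameA, Fintype.sum_sum_type]
  simp

/-- For constant α and β the term L_{H^♯ α} β equals d⟨H^♯ α, β⟩ and cancels it, and [α, β]_* is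
zero; only -L_{H^♯ β} α survives. -/
theorem bracketH_const {H : Cn n → ExteriorAlgebra ℂ (AFib (Cn n))} {z : Cn n} (hH : CDiffAt H z)
    (α β : ADual (Cn n)) : bracketH H (fun _ => α) (fun _ => β) z =
      -∑ j, pairA α (sharp (wdv 1 j H z) β) • coframeA n (.inl j) := by
  have h1 : ∀ (γ : ADual (Cn n)) j, pd j (fun y => sharp (H y) γ) z = sharp (wdv 1 j H z) γ :=
    fun γ j => by
      rw [pd_eq]
      exact wdv_linear 1 j (sharpLin γ) hH
  have h2 : ∀ j, pd j (fun y => pairA β (sharp (H y) α)) z =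
      pairA β (sharp (wdv 1 j H z) α) := fun j => by
    rw [pd_eq]
    exact wdv_linear 1 j (pairA β ∘ₗ sharpLin α) hH
  simp only [bracketH, bracketStar, along_const, lieA_const, h1, dFun, h2]
  abel

theorem pairA_sharp_antisymm {V : Type*} [AddCommGroup V] [Module ℂ V]
    {G : ExteriorAlgebra ℂ (AFib V)} (hG : G ∈ ⋀[ℂ]^2 (AFib V)) (α β : ADual V) :
    pairA α (sharp G β) = -pairA β (sharp G α) := by
  refine exteriorPower_two_induction (fun x y => ?_) (fun a b ha hb => ?_) hG
  · simp only [sharp_ι_mul_ι, map_sub, map_smul, smul_eq_mul]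
    ring
  · simp only [sharp_add, map_add, ha, hb, neg_add]

theorem sum_pairA_coframeA_smul (x : AFib (Cn n)) :
    ∑ j, pairA (coframeA n j) x • frameA n j = x := by
  rw [Fintype.sum_sum_type]
  refine Prod.ext ?_ ?_
  · ext i
    simp [frameA, coframeA, pairA, dz, ddz, ddzbar, Prod.fst_sum, Pi.single_apply,
      Finset.sum_apply]
  · conv_rhs => rw [conjDual_eq_sum n x.2]
    simp [frameA, coframeA, pairA, dz, ddz, ddzbar, Prod.snd_sum]

/-- The expansion of H ⌊ e in the frame of A. It reassembles the components of D^H, computed on the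
coframe, into a contraction. -/
theorem contractRight_eq_sum {G : ExteriorAlgebra ℂ (AFib (Cn n))}
    (hG : G ∈ ⋀[ℂ]^2 (AFib (Cn n))) (e : ADual (Cn n)) :
    CliffordAlgebra.contractRight G (pairA e) =
      ∑ j, pairA e (sharp G (coframeA n j)) • ExteriorAlgebra.ι ℂ (frameA n j) := by
  refine exteriorPower_two_induction (fun x y => ?_) (fun a b ha hb => ?_) hG
  · have h1 : CliffordAlgebra.contractRight (ExteriorAlgebra.ι ℂ x) (pairA e) =
        algebraMap ℂ _ (pairA e x) := CliffordAlgebra.contractRight_ι _ _ _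
    have h2 : ∀ x : AFib (Cn n), ExteriorAlgebra.ι ℂ x =
        ∑ j, pairA (coframeA n j) x • ExteriorAlgebra.ι ℂ (frameA n j) := by
      intro x
      conv_lhs => rw [← sum_pairA_coframeA_smul x]
      simp only [map_sum, map_smul]
    rw [contractRight_mul_ι', h1, ← Algebra.smul_def]
    conv_lhs => rw [h2 x, h2 y]
    rw [Finset.smul_sum, Finset.smul_sum, ← Finset.sum_sub_distrib]
    refine Finset.sum_congr rfl fun j _ => ?_
    simp only [sharp_ι_mul_ι, map_sub, map_smul, smul_eq_mul]
    module
  · simp only [map_add, LinearMap.add_apply, ha, hb, sharp_add, add_smul, Finset.sum_add_distrib]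

theorem ιMulti_ne_zero_of_dual {M : Type*} [AddCommGroup M] [Module ℂ M] {m : ℕ} (v : Fin m → M)
    (φ : Fin m → Module.Dual ℂ M) (h : ∀ i j, φ j (v i) = if i = j then 1 else 0) :
    ExteriorAlgebra.ιMulti ℂ m v ≠ 0 := by
  intro h0
  let f : M [⋀^Fin m]→ₗ[ℂ] ℂ := Matrix.detRowAlternating.compLinearMap (LinearMap.pi φ)
  -- The determinant of the dual functionals, placed in degree m and extended by zero to the other
  -- degrees, is a functional on the exterior algebra taking the value 1 on the product.
  let g : ∀ i, M [⋀^Fin i]→ₗ[ℂ] ℂ := Function.update (fun _ => 0) m f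
  have h1 : ExteriorAlgebra.liftAlternating (R := ℂ) g (ExteriorAlgebra.ιMulti ℂ m v) = f v := by
    rw [ExteriorAlgebra.liftAlternating_apply_ιMulti]
    simp [g]
  have h2 : f v = 1 := by
    have : (fun i j => φ j (v i)) = (1 : Matrix (Fin m) (Fin m) ℂ) := by
      ext i j
      rw [h, Matrix.one_apply]
    change Matrix.det (fun i j => φ j (v i)) = 1
    rw [this, Matrix.det_one]
  rw [h0, map_zero, h2] at h1
  exact zero_ne_one h1

theorem ι_mul_ιMulti_eq_zero {M : Type*} [AddCommGroup M] [Module ℂ M] {m : ℕ} (v : Fin m → M)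
    (i : Fin m) : ExteriorAlgebra.ι ℂ (v i) * ExteriorAlgebra.ιMulti ℂ m v = 0 := by
  have h : ExteriorAlgebra.ιMulti ℂ (m + 1) (Fin.cons (v i) v) =
      ExteriorAlgebra.ι ℂ (v i) * ExteriorAlgebra.ιMulti ℂ m v := by
    rw [ExteriorAlgebra.ιMulti_succ_apply]
    rfl
  rw [← h]
  exact AlternatingMap.map_eq_zero_of_eq _ _ (i := 0) (j := i.succ) (by simp)
    (Fin.succ_ne_zero i).symm

theorem append_dual_append {M : Type*} [AddCommGroup M] [Module ℂ M] {p q : ℕ} (v : Fin p → M)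
    (w : Fin q → M) (φ : Fin p → Module.Dual ℂ M) (ψ : Fin q → Module.Dual ℂ M)
    (h1 : ∀ i j, φ j (v i) = if i = j then 1 else 0) (h2 : ∀ i j, ψ j (v i) = 0)
    (h3 : ∀ i j, φ j (w i) = 0) (h4 : ∀ i j, ψ j (w i) = if i = j then 1 else 0)
    (i j : Fin (p + q)) :
    Fin.append φ ψ j (Fin.append v w i) = if i = j then 1 else 0 := by
  refine Fin.addCases (fun i => ?_) (fun i => ?_) i <;>
  refine Fin.addCases (fun j => ?_) (fun j => ?_) j
  · simp [h1]
  · rw [Fin.append_left, Fin.append_right, h2, if_neg]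
    intro h
    have := congrArg Fin.val h
    simp only [Fin.val_castAdd, Fin.val_natAdd] at this
    omega
  · rw [Fin.append_left, Fin.append_right, h3, if_neg]
    intro h
    have := congrArg Fin.val h
    simp only [Fin.val_castAdd, Fin.val_natAdd] at this
    omega
  · simp [h4]

theorem frameQ_natAdd (j : Fin n) : frameQ n (Fin.natAdd n j) = coframeA n (.inl j) := by
  rw [frameQ, Fin.append_right]

theorem frameQ_ιMulti_ne_zero : ExteriorAlgebra.ιMulti ℂ (n + n) (frameQ n) ≠ 0 := by
  refine ιMulti_ne_zero_of_dual _ _ (append_dual_append _ _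
    (fun i => Module.Dual.eval ℂ _ (dzbar n i) ∘ₗ LinearMap.fst ℂ _ _)
    (fun i => Module.Dual.eval ℂ _ (ddz n i) ∘ₗ LinearMap.snd ℂ _ _) ?_ ?_ ?_ ?_) <;> intro i j
  · simp [coframeA, ddzbar, dzbar, Pi.single_apply, eq_comm, apply_ite]
  · simp [coframeA]
  · simp [coframeA]
  · simp [coframeA, ddz, dz, Pi.single_apply]

theorem volForm_ne_zero : volForm n ≠ 0 := by
  refine ιMulti_ne_zero_of_dual _ _ (append_dual_append _ _
    (fun i => Module.Dual.eval ℂ _ (ddz n i) ∘ₗ LinearMap.fst ℂ _ _)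
    (fun i => ddzbar n i ∘ₗ LinearMap.snd ℂ _ _) ?_ ?_ ?_ ?_) <;> intro i j
  · simp [dzT, ddz, dz, Pi.single_apply]
  · simp [dzT]
  · simp [dzbarT]
  · simp [dzbarT, ddzbar, dzbar, Pi.single_apply, apply_ite]

/-- The divergence of the vector field `a(H^♯ α)` for constant `α`. -/
def divSharp (H : Cn n → ExteriorAlgebra ℂ (AFib (Cn n))) (α : ADual (Cn n)) (z : Cn n) : ℂ :=
  ∑ i, pairA (coframeA n (.inl i)) (sharp (wdv 1 i H z) α)

/-- Replacing a frame element by dz^j repeats the factor dz^j unless that element was dz^j itself.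
This makes the bracket part of `nablaQ` a trace. -/
theorem ιMulti_update_frameQ (i : Fin (n + n)) (j : Fin n) :
    ExteriorAlgebra.ιMulti ℂ (n + n) (Function.update (frameQ n) i (coframeA n (.inl j))) =
      if i = Fin.natAdd n j then ExteriorAlgebra.ιMulti ℂ (n + n) (frameQ n) else 0 := by
  rw [← frameQ_natAdd]
  split_ifs with h
  · subst h
    rw [Function.update_eq_self]
  · exact AlternatingMap.map_update_self _ _ h

/-- By Cartan's formula only d ι_Z vol remains, vol being constant. The part of Z coming from a_* is
constant as well, so the answer is the divergence of the (1, 0) field a(H^♯ α). -/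
theorem lieForm_volForm {H : Cn n → ExteriorAlgebra ℂ (AFib (Cn n))} {z : Cn n} (hH : CDiffAt H z)
    (α : ADual (Cn n)) :
    lieForm (anchorH H fun _ => α) (fun _ => volForm n) z = divSharp H α z • volForm n := by
  have hvol : ∀ i, ExteriorAlgebra.ι ℂ (dzT n i) * volForm n = 0 := by
    intro i
    have := ι_mul_ιMulti_eq_zero (Fin.append (dzT n) (dzbarT n)) (Fin.castAdd n i)
    rwa [Fin.append_left] at this
  have hvol' : ∀ i, ExteriorAlgebra.ι ℂ (dzbarT n i) * volForm n = 0 := by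
    intro i
    have := ι_mul_ιMulti_eq_zero (Fin.append (dzT n) (dzbarT n)) (Fin.natAdd n i)
    rwa [Fin.append_right] at this
  -- Contraction of vol as a linear function of the vector, so that derivatives pass to H.
  let L : AFib (Cn n) →ₗ[ℂ] ExteriorAlgebra ℂ (TCDual (Cn n)) :=
    (cliffordVec (Cn n)).flip (volForm n) ∘ₗ LinearMap.inl ℂ _ _ ∘ₗ LinearMap.fst ℂ _ _
  have hL : ∀ x : AFib (Cn n),
      L x = CliffordAlgebra.contractLeft (pairT ((x.1, 0) : TC (Cn n))) (volForm n) := by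
    intro x
    rw [← clifford_ι_inl, clifford_ι]
    rfl
  have hZ : (fun y => CliffordAlgebra.contractLeft (pairT (anchorH H (fun _ => α) y))
      (volForm n)) = fun y => CliffordAlgebra.contractLeft (pairT (anchorStar α)) (volForm n) +
        (L ∘ₗ sharpLin α) (H y) := by
    funext y
    rw [LinearMap.comp_apply, hL, ← LinearMap.add_apply, ← map_add]
    congr 2
    refine LinearMap.ext fun a => ?_
    simp [pairT, anchorH, anchorStar, anchorA, sharpLin, sharp]
    exact add_comm _ _
  have hd : ∀ ε i, wdv ε i (fun y => CliffordAlgebra.contractLeft (pairT (anchorStar α))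
      (volForm n) + (L ∘ₗ sharpLin α) (H y)) z = L (sharp (wdv ε i H z) α) := by
    intro ε i
    rw [wdv_add _ _ (cSmoothAt_const _ _).cDiffAt (hH.linear _), wdv_const, zero_add,
      wdv_linear _ _ _ hH]
    rfl
  have e0 : extdLoc (fun _ => volForm n) z = 0 := by
    simp [extdLoc, delLoc, delbarLoc, pd_const, pdBar_const]
  rw [lieForm, e0, map_zero, add_zero, hZ, extdLoc, delLoc, delbarLoc]
  simp only [pd_eq, pdBar_eq, hd]
  -- Contracting dz^i ∧ vol = 0 by x gives dz^i ∧ ι_x vol = dz^i(x) vol.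
  have t1 : ∀ i x, ExteriorAlgebra.ι ℂ (dzT n i) * L x =
      pairA (coframeA n (.inl i)) x • volForm n := by
    intro i x
    have h0 := contractLeft_ι_mul' (pairT ((x.1, 0) : TC (Cn n))) (dzT n i) (volForm n)
    rw [hvol, map_zero, ← hL] at h0
    rw [← sub_eq_zero.1 h0.symm]
    congr 1
  have t2 : ∀ i x, ExteriorAlgebra.ι ℂ (dzbarT n i) * L x = 0 := by
    intro i x
    have h0 := contractLeft_ι_mul' (pairT ((x.1, 0) : TC (Cn n))) (dzbarT n i) (volForm n)
    rw [hvol', map_zero, ← hL] at h0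
    rw [← sub_eq_zero.1 h0.symm]
    simp [pairT, dzbarT]
  simp only [t1, t2, Finset.sum_const_zero, add_zero, divSharp, Finset.sum_smul]

/-- The trace of β ↦ [α, β]_*^H on A^* and the divergence from the Lie derivative are equal, whence
the factor 2. -/
theorem nablaQ_const {H : Cn n → ExteriorAlgebra ℂ (AFib (Cn n))} {z : Cn n} (hH : CDiffAt H z)
    (hH2 : ∀ᶠ y in nhds z, H y ∈ ⋀[ℂ]^2 (AFib (Cn n))) (α : ADual (Cn n)) :
    nablaQ H (fun _ => α) (fun j _ => frameQ n j) (fun _ => volForm n) z =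
      (2 * divSharp H α z) •
        (ExteriorAlgebra.ιMulti ℂ (n + n) (frameQ n) ⊗ₜ[ℂ] volForm n) := by
  have hd : ∀ i, wdv 1 i H z ∈ ⋀[ℂ]^2 (AFib (Cn n)) := fun i => wdv_mem _ _ hH _ hH2
  rw [nablaQ, lieForm_volForm hH]
  have h1 : ∀ i, ExteriorAlgebra.ιMulti ℂ (n + n) (Function.update (fun j => frameQ n j) i
      (bracketH H (fun _ => α) (fun _ => frameQ n i) z)) =
      ∑ j, if i = Fin.natAdd n j then (-pairA α (sharp (wdv 1 j H z) (frameQ n i))) •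
        ExteriorAlgebra.ιMulti ℂ (n + n) (frameQ n) else 0 := by
    intro i
    rw [bracketH_const hH, ← Finset.sum_neg_distrib, AlternatingMap.map_update_sum]
    refine Finset.sum_congr rfl fun j _ => ?_
    rw [← neg_smul, AlternatingMap.map_update_smul]
    have := ιMulti_update_frameQ i j
    rw [this]
    split_ifs <;> simp
  simp only [h1]
  rw [← TensorProduct.sum_tmul, Finset.sum_comm]
  simp only [Finset.sum_ite_eq', Finset.mem_univ, if_true]
  -- Antisymmetry of ∂_j H, which again lies in `∧²`, turns the trace of the bracket into the
  -- divergence of H^♯ α.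
  have h2 : ∀ j, -pairA α (sharp (wdv 1 j H z) (frameQ n (Fin.natAdd n j))) =
      pairA (coframeA n (.inl j)) (sharp (wdv 1 j H z) α) := by
    intro j
    rw [pairA_sharp_antisymm (hd j), neg_neg, frameQ_natAdd]
  simp only [h2, ← Finset.sum_smul]
  rw [two_mul, add_smul, TensorProduct.tmul_smul, ← TensorProduct.smul_tmul']
  rfl

theorem tmul_ne_zero {M N : Type*} [AddCommGroup M] [Module ℂ M] [AddCommGroup N] [Module ℂ N]
    {x : M} {y : N} (hx : x ≠ 0) (hy : y ≠ 0) : x ⊗ₜ[ℂ] y ≠ 0 := by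
  intro h
  have hf := mt (Module.forall_dual_apply_eq_zero_iff ℂ x).1 hx
  have hg := mt (Module.forall_dual_apply_eq_zero_iff ℂ y).1 hy
  push Not at hf hg
  obtain ⟨f, hf⟩ := hf
  obtain ⟨g, hg⟩ := hg
  have h1 : TensorProduct.lid ℂ ℂ (TensorProduct.map f g (x ⊗ₜ[ℂ] y)) = f x * g y := by simp
  rw [h, map_zero, map_zero] at h1
  exact mul_ne_zero hf hg h1.symm

/-- The coordinate frame of Q is nonzero, so the scalar chosen in `elwCoef` is unique. -/
theorem elwCoef_const {H : Cn n → ExteriorAlgebra ℂ (AFib (Cn n))} {z : Cn n} (hH : CDiffAt H z)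
    (hH2 : ∀ᶠ y in nhds z, H y ∈ ⋀[ℂ]^2 (AFib (Cn n))) (α : ADual (Cn n)) :
    elwCoef H (fun _ => α) z = 2 * divSharp H α z := by
  have h := nablaQ_const hH hH2 α
  have h1 := Classical.epsilon_spec (p := fun c : ℂ =>
    nablaQ H (fun _ => α) (fun j _ => frameQ n j) (fun _ => volForm n) z =
      c • (ExteriorAlgebra.ιMulti ℂ (n + n) (frameQ n) ⊗ₜ[ℂ] volForm n)) ⟨_, h⟩
  have h0 : ExteriorAlgebra.ιMulti ℂ (n + n) (frameQ n) ⊗ₜ[ℂ] volForm n ≠ 0 :=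
    tmul_ne_zero frameQ_ιMulti_ne_zero volForm_ne_zero
  exact smul_left_injective ℂ h0 (h1.symm.trans h)

/-- Half of the factor 2 div(H^♯ α), summed against the frame of A: D^H of the frame is the
divergence of H. Without the square root the extra term in `tauFib_bdeeLoc` would be twice too
large. -/
theorem DLoc_holFrame {H : Cn n → ExteriorAlgebra ℂ (AFib (Cn n))} {z : Cn n} (hH : CDiffAt H z)
    (hH2 : ∀ᶠ y in nhds z, H y ∈ ⋀[ℂ]^2 (AFib (Cn n))) :
    DLoc H (fun _ => holFrame n) z = (∑ i, CliffordAlgebra.contractRight (wdv 1 i H z)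
      (pairA (coframeA n (.inl i)))) ⊗ₜ[ℂ] holFrame n := by
  have hd : ∀ i, wdv 1 i H z ∈ ⋀[ℂ]^2 (AFib (Cn n)) := fun i => wdv_mem _ _ hH _ hH2
  simp only [DLoc, nablaL, along_const, coefL_holFrame, elwCoef_const hH hH2, one_mul, zero_add,
    contractRight_eq_sum (hd _)]
  rw [Finset.sum_comm, TensorProduct.sum_tmul]
  refine Finset.sum_congr rfl fun j _ => ?_
  rw [TensorProduct.tmul_smul, TensorProduct.smul_tmul', ← Finset.sum_smul, divSharp]
  congr 2
  ring

/-! ### The intertwining relation in a chart. -/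

theorem ι_mul_of_mem {M : Type*} [AddCommGroup M] [Module ℂ M] {k : ℕ} {a : ExteriorAlgebra ℂ M}
    (ha : a ∈ ⋀[ℂ]^k M) (x : M) :
    ExteriorAlgebra.ι ℂ x * a = (-1 : ℂ) ^ k • (a * ExteriorAlgebra.ι ℂ x) := by
  induction k generalizing a with
  | zero =>
    obtain ⟨r, rfl⟩ := mem_exteriorPower_zero ha
    rw [pow_zero, one_smul, Algebra.commutes]
  | succ k ih =>
    refine exteriorPower_succ_induction (fun a ha y => ?_) (fun a b ha hb => ?_) ha
    · rw [← mul_assoc, ih ha, smul_mul_assoc, mul_assoc, ι_mul_ι_comm x y, pow_succ]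
      simp [mul_assoc]
    · simp only [mul_add, add_mul, ha, hb, smul_add]

/-- With G = ∂_i H and a = H ⌊ dz^i, dz^i is moved past G ∧ u and dies on σ, leaving (G ∧ u) ⌊ dz^i.
Its Leibniz expansion has two terms: the one with u ⌊ dz^i completes the Schouten bracket, and the
one with G ⌊ dz^i is the divergence term of D^H. -/
theorem clifford_schouten_term (i : Fin n) (k : ℕ) (a u' : ExteriorAlgebra ℂ (AFib (Cn n)))
    {G u : ExteriorAlgebra ℂ (AFib (Cn n))} (hG : G ∈ ⋀[ℂ]^2 (AFib (Cn n)))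
    (hu : u ∈ ⋀[ℂ]^k (AFib (Cn n))) {σ : ExteriorAlgebra ℂ (TCDual (Cn n))}
    (hσ : ExteriorAlgebra.ι ℂ (dzT n i) * σ = 0) :
    clifford (Cn n) (a * u' - -(-1 : ℂ) ^ k •
        (CliffordAlgebra.contractRight u (pairA (coframeA n (.inl i))) * G) +
      (-1 : ℂ) ^ k • (u * CliffordAlgebra.contractRight G (pairA (coframeA n (.inl i))))) σ =
    clifford (Cn n) a (clifford (Cn n) u' σ) -
      ExteriorAlgebra.ι ℂ (dzT n i) * clifford (Cn n) G (clifford (Cn n) u σ) := by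
  have huH : G * u ∈ ⋀[ℂ]^(2 + k) (AFib (Cn n)) := by
    rw [ExteriorAlgebra.exteriorPower, pow_add]
    exact Submodule.mul_mem_mul hG hu
  obtain ⟨x, hx⟩ := contractRight_mem_range (pairA (coframeA n (.inl i))) hG
  have c1 := contractRight_mul (pairA (coframeA n (.inl i))) G hu
  rw [(commute_of_mem_exteriorPower_two hG
    (CliffordAlgebra.contractRight u (pairA (coframeA n (.inl i))))).eq, ← hx,
    ι_mul_of_mem hu x] at c1
  have c2 := ι_dzT_mul_clifford i huH σ
  rw [hσ, map_zero, smul_zero, add_zero, c1, clifford_mul_apply G u] at c2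
  rw [c2, ← hx]
  simp only [map_add, map_sub, map_smul, LinearMap.add_apply, LinearMap.sub_apply,
    LinearMap.smul_apply, clifford_mul_apply]
  have e1 : (-1 : ℂ) ^ (2 + k + 1) = -(-1 : ℂ) ^ k := by
    rw [pow_succ, pow_add]
    norm_num
  have e2 : (-1 : ℂ) ^ k * (-1 : ℂ) ^ k = 1 := by
    rw [← mul_pow]
    norm_num
  rw [e1, smul_smul, e2]
  module

/-- Since σ is constant, differentiating u · σ only differentiates u. The ∂̄ parts then agree term
by term, and the rest is `clifford_schouten_term` for each i. -/
theorem tauFib_bdeeLoc {H : Cn n → ExteriorAlgebra ℂ (AFib (Cn n))} {k : ℕ}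
    {v : Cn n → ALFib (Cn n) n} {z : Cn n} (hH : CDiffAt H z)
    (hH2 : ∀ᶠ y in nhds z, H y ∈ ⋀[ℂ]^2 (AFib (Cn n))) (hv : CDiffAt v z)
    (hvk : v z ∈ alDegree (Cn n) n k) :
    tauFib (Cn n) n (bdeeLoc H k v z) =
      dolb false (fun y => tauFib (Cn n) n (v y)) z +
        brLoc H (fun y => tauFib (Cn n) n (v y)) z := by
  have hd : ∀ i, wdv 1 i H z ∈ ⋀[ℂ]^2 (AFib (Cn n)) := fun i => wdv_mem _ _ hH _ hH2
  set σ : ExteriorAlgebra ℂ (TCDual (Cn n)) := ExteriorAlgebra.map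
    (LinearMap.inl ℂ (Module.Dual ℂ (Cn n)) (ConjDual (Cn n))) (holFrame n) with hσ
  have hσ0 : ∀ i, ExteriorAlgebra.ι ℂ (dzT n i) * σ = 0 := by
    intro i
    have : σ = ExteriorAlgebra.ιMulti ℂ n (dzT n) := by
      rw [hσ, holFrame, exteriorPower.ιMulti_apply_coe, ExteriorAlgebra.map_apply_ιMulti]
      rfl
    rw [this, ι_mul_ιMulti_eq_zero]
  have hτ : ∀ x, tauFib (Cn n) n x = clifford (Cn n) (coefAL n x) σ := by
    intro x
    conv_lhs => rw [← coefAL_tmul n x]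
    exact tauFib_tmul _ _ _
  have hu : CDiffAt (fun y => coefAL n (v y)) z := hv.linear (coefAL n)
  have huk := coefAL_mem n hvk
  have hc := (cSmoothAt_const σ z).cDiffAt
  simp only [hτ]
  have hb : coefAL n (bdeeLoc H k v z) = dbarHLoc H k (fun y => coefAL n (v y)) z +
      (-1 : ℂ) ^ k • (coefAL n (v z) * ∑ i, CliffordAlgebra.contractRight (wdv 1 i H z)
      (pairA (coframeA n (.inl i)))) := by
    have h0 : ∀ a, coefAL n (a ⊗ₜ[ℂ] holFrame n) = a := by
      intro a
      simp [coefAL, coefL_holFrame]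
    rw [bdeeLoc, DLoc_holFrame hH hH2, LinearMap.rTensor_tmul, map_add, map_smul, h0, h0]
    rfl
  rw [hb, brLoc_eq hH hH2.self_of_nhds (hu.clifford hc), dbarHLoc, dbarMVLoc, schoutenLoc, dolb]
  simp only [pd_eq, pdBar_eq, wdv_clifford _ _ hu hc, wdv_const, map_zero, add_zero, sg, cof]
  set u := coefAL n (v z)
  -- The Schouten sign for p = 2, q = k.
  have hs : (-1 : ℂ) ^ ((2 + 1) * (k + 1)) = -(-1 : ℂ) ^ k := by
    rw [pow_mul, pow_succ]
    norm_num
  rw [hs, add_assoc, map_add, LinearMap.add_apply]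
  congr 1
  · rw [map_sum, LinearMap.sum_apply]
    refine Finset.sum_congr rfl fun i _ => ?_
    rw [map_mul, Module.End.mul_apply, clifford_ι_inr]
    rfl
  · rw [Finset.mul_sum, Finset.smul_sum, Finset.smul_sum, ← Finset.sum_sub_distrib,
      ← Finset.sum_add_distrib, map_sum, LinearMap.sum_apply]
    refine Finset.sum_congr rfl fun i _ => ?_
    exact clifford_schouten_term i k _ _ (hd i) huk (hσ0 i)

end ELW

/-! ## Functoriality of the fibre constructions -/

section Functoriality

variable {V W U : Type*} [AddCommGroup V] [Module ℂ V] [AddCommGroup W] [Module ℂ W]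
  [AddCommGroup U] [Module ℂ U]

theorem map_tMap_comp (h : W →ₗ[ℂ] V) (k : U →ₗ[ℂ] W) (w : ExteriorAlgebra ℂ (TCDual V)) :
    ExteriorAlgebra.map (tMap k) (ExteriorAlgebra.map (tMap h) w) =
      ExteriorAlgebra.map (tMap (h ∘ₗ k)) w := by
  rw [← AlgHom.comp_apply, ExteriorAlgebra.map_comp_map]
  rfl

theorem map_tMap_id (w : ExteriorAlgebra ℂ (TCDual V)) :
    ExteriorAlgebra.map (tMap (LinearMap.id : V →ₗ[ℂ] V)) w = w := by
  have : tMap (LinearMap.id : V →ₗ[ℂ] V) = LinearMap.id := rfl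
  rw [this, ExteriorAlgebra.map_id]
  rfl

theorem map_aMap_comp_of_inverse (g : V →ₗ[ℂ] W) (h : W →ₗ[ℂ] V) (hg : h ∘ₗ g = LinearMap.id)
    (u : ExteriorAlgebra ℂ (AFib V)) :
    ExteriorAlgebra.map (aMap h g) (ExteriorAlgebra.map (aMap g h) u) = u := by
  have : aMap h g ∘ₗ aMap g h = LinearMap.id := by
    refine LinearMap.ext fun x => Prod.ext ?_ ?_
    · exact LinearMap.congr_fun hg x.1
    · refine LinearMap.ext fun y => ?_
      exact congrArg x.2 (LinearMap.congr_fun hg y)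
  rw [← AlgHom.comp_apply, ExteriorAlgebra.map_comp_map, this, ExteriorAlgebra.map_id]
  rfl

theorem map_mem_exteriorPower {M N : Type*} [AddCommGroup M] [Module ℂ M] [AddCommGroup N]
    [Module ℂ N] (f : M →ₗ[ℂ] N) {k : ℕ} {a : ExteriorAlgebra ℂ M} (ha : a ∈ ⋀[ℂ]^k M) :
    ExteriorAlgebra.map f a ∈ ⋀[ℂ]^k N := by
  induction k generalizing a with
  | zero =>
    obtain ⟨r, rfl⟩ := mem_exteriorPower_zero ha
    rw [AlgHom.commutes, ExteriorAlgebra.exteriorPower, pow_zero]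
    exact Submodule.mem_one.2 ⟨r, rfl⟩
  | succ k ih =>
    refine exteriorPower_succ_induction (fun a ha x => ?_) (fun a b h h' => ?_) ha
    · rw [map_mul, ExteriorAlgebra.map_apply_ι, ExteriorAlgebra.exteriorPower, pow_succ]
      exact Submodule.mul_mem_mul (ih ha) ⟨_, rfl⟩
    · rw [map_add]
      exact add_mem h h'

theorem alMap_mem_alDegree (n k : ℕ) (g : V →ₗ[ℂ] W) (h : W →ₗ[ℂ] V) {v : ALFib V n}
    (hv : v ∈ alDegree V n k) : alMap n g h v ∈ alDegree W n k := by
  refine alDegree_induction (p := fun v => alMap n g h v ∈ alDegree W n k) ?_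
    (fun u hu s => ?_) (fun a b ha hb => ?_) hv
  · simp
  · exact tmul_mem_alDegree n (map_mem_exteriorPower _ hu) _
  · simp only [map_add]
    exact add_mem ha hb

end Functoriality

/-! ## Sections over a complex manifold -/

section Manifold

variable {n : ℕ} {X : Type*} [TopologicalSpace X] [ChartedSpace (Cn n) X]

theorem localize_apply {Fib : X → Type*} [∀ x, AddCommGroup (Fib x)] [∀ x, Module ℂ (Fib x)]
    {F : Type*} [AddCommGroup F] [Module ℂ F]
    (ρ : OpenPartialHomeomorph X (Cn n) → ∀ x : X, Fib x →ₗ[ℂ] F) (s : ∀ x, Fib x)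
    (φ : OpenPartialHomeomorph X (Cn n)) {x : X} (hx : x ∈ φ.source) :
    localize ρ s φ (φ x) = ρ φ x (s x) := by
  rw [localize, φ.left_inv hx]

theorem IsSmooth.cSmoothAt {Fib : X → Type*} [∀ x, AddCommGroup (Fib x)] [∀ x, Module ℂ (Fib x)]
    {F : Type*} [AddCommGroup F] [Module ℂ F]
    {ρ : OpenPartialHomeomorph X (Cn n) → ∀ x : X, Fib x →ₗ[ℂ] F} {s : ∀ x, Fib x}
    (hs : IsSmooth ρ s) {φ : OpenPartialHomeomorph X (Cn n)} (hφ : φ ∈ atlas (Cn n) X) {z : Cn n}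
    (hz : z ∈ φ.target) : CSmoothAt (localize ρ s φ) z :=
  fun ℓ => (hs φ hφ ℓ).contDiffAt (φ.open_target.mem_nhds hz)

theorem isSmooth_of_cSmoothAt {Fib : X → Type*} [∀ x, AddCommGroup (Fib x)]
    [∀ x, Module ℂ (Fib x)] {F : Type*} [AddCommGroup F] [Module ℂ F]
    {ρ : OpenPartialHomeomorph X (Cn n) → ∀ x : X, Fib x →ₗ[ℂ] F} {s : ∀ x, Fib x}
    (h : ∀ φ ∈ atlas (Cn n) X, ∀ z ∈ φ.target, ∃ f : Cn n → F, CSmoothAt f z ∧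
      ∀ y ∈ φ.target, localize ρ s φ y = f y) : IsSmooth ρ s := by
  intro φ hφ ℓ z hz
  obtain ⟨f, hf, he⟩ := h φ hφ z hz
  refine ((hf.congr ?_) ℓ).contDiffWithinAt
  filter_upwards [φ.open_target.mem_nhds hz] with y hy
  exact he y hy

/-- The operators `∂` (`true`) and `∂̄` (`false`) on forms. -/
def dolbeault (b : Bool) (w : FormField n X) : FormField n X := fun x =>
  formRepInv (chartAt (Cn n) x) x
    (dolb b (localize formRep w (chartAt (Cn n) x)) (chartAt (Cn n) x x))

theorem del_eq (w : FormField n X) : del w = dolbeault true w := by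
  funext x
  rw [del, delLoc_eq]
  rfl

theorem delbar_eq (w : FormField n X) : delbar w = dolbeault false w := by
  funext x
  rw [delbar, delbarLoc_eq]
  rfl

variable [IsManifold 𝓘(ℂ, Cn n) ω X]

theorem dchart_comp_dchartInv {φ : OpenPartialHomeomorph X (Cn n)}
    (hφ : φ ∈ atlas (Cn n) X) {x : X} (hx : x ∈ φ.source) :
    (dchart φ x : TX n x →ₗ[ℂ] Cn n) ∘ₗ (dchartInv φ x : Cn n →ₗ[ℂ] TX n x) =
      LinearMap.id := by
  have hd : φ.MDifferentiable 𝓘(ℂ, Cn n) 𝓘(ℂ, Cn n) := mdifferentiable_of_mem_atlas hφ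
  have hinv : (dchart φ x).IsInvertible := ⟨hd.mfderiv hx, rfl⟩
  refine LinearMap.ext fun v => ?_
  exact hinv.self_apply_inverse v

theorem formRepInv_formRep {φ : OpenPartialHomeomorph X (Cn n)} (hφ : φ ∈ atlas (Cn n) X) {x : X}
    (hx : x ∈ φ.source) (w : ExteriorAlgebra ℂ (TCDual (TX n x))) :
    formRepInv φ x (formRep φ x w) = w := by
  simp only [formRepInv, formRep, AlgHom.toLinearMap_apply]
  rw [map_tMap_comp, dchartInv_comp_dchart hφ hx, map_tMap_id]

theorem formRep_formRepInv {φ : OpenPartialHomeomorph X (Cn n)} (hφ : φ ∈ atlas (Cn n) X) {x : X}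
    (hx : x ∈ φ.source) (w : ExteriorAlgebra ℂ (TCDual (Cn n))) :
    formRep φ x (formRepInv φ x w) = w := by
  simp only [formRepInv, formRep, AlgHom.toLinearMap_apply]
  rw [map_tMap_comp, dchart_comp_dchartInv hφ hx, map_tMap_id]

theorem mvRep_mvRepInv {φ : OpenPartialHomeomorph X (Cn n)} (hφ : φ ∈ atlas (Cn n) X) {x : X}
    (hx : x ∈ φ.source) (u : ExteriorAlgebra ℂ (AFib (Cn n))) :
    mvRep φ x (mvRepInv φ x u) = u :=
  map_aMap_comp_of_inverse _ _ (dchart_comp_dchartInv hφ hx) u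

/-! ### Changes of charts -/

theorem contDiffAt_transition {φ ψ : OpenPartialHomeomorph X (Cn n)} (hφ : φ ∈ atlas (Cn n) X)
    (hψ : ψ ∈ atlas (Cn n) X) {x : X} (hx : x ∈ φ.source) (hx' : x ∈ ψ.source) :
    ContDiffAt ℂ ω (φ ∘ ψ.symm) (ψ x) := by
  rw [← contMDiffAt_iff_contDiffAt]
  have h1 : ContMDiffAt 𝓘(ℂ, Cn n) 𝓘(ℂ, Cn n) ω φ x :=
    (contMDiffOn_of_mem_maximalAtlas (IsManifold.subset_maximalAtlas hφ)).contMDiffAt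
      (φ.open_source.mem_nhds hx)
  have h2 : ContMDiffAt 𝓘(ℂ, Cn n) 𝓘(ℂ, Cn n) ω ψ.symm (ψ x) :=
    (contMDiffOn_symm_of_mem_maximalAtlas (IsManifold.subset_maximalAtlas hψ)).contMDiffAt
      (ψ.open_target.mem_nhds (ψ.map_source hx'))
  refine ContMDiffAt.comp (ψ x) ?_ h2
  rwa [ψ.left_inv hx']

theorem fderiv_transition {φ ψ : OpenPartialHomeomorph X (Cn n)} (hφ : φ ∈ atlas (Cn n) X)
    (hψ : ψ ∈ atlas (Cn n) X) {x : X} (hx : x ∈ φ.source) (hx' : x ∈ ψ.source) :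
    (fderiv ℂ (φ ∘ ψ.symm) (ψ x) : Cn n →ₗ[ℂ] Cn n) =
      (dchart φ x : TX n x →ₗ[ℂ] Cn n) ∘ₗ (dchartInv ψ x : Cn n →ₗ[ℂ] TX n x) := by
  have hd : MDifferentiableAt 𝓘(ℂ, Cn n) 𝓘(ℂ, Cn n) ψ x :=
    (mdifferentiable_of_mem_atlas hψ).mdifferentiableAt hx'
  have hF : DifferentiableAt ℂ (φ ∘ ψ.symm) (ψ x) :=
    (contDiffAt_transition hφ hψ hx hx').differentiableAt (by simp)
  have h1 : mfderiv 𝓘(ℂ, Cn n) 𝓘(ℂ, Cn n) ((φ ∘ ψ.symm) ∘ ψ) x =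
      (fderiv ℂ (φ ∘ ψ.symm) (ψ x)).comp (dchart ψ x) := by
    rw [mfderiv_comp x hF.mdifferentiableAt hd, mfderiv_eq_fderiv]
    rfl
  have h2 : mfderiv 𝓘(ℂ, Cn n) 𝓘(ℂ, Cn n) ((φ ∘ ψ.symm) ∘ ψ) x = dchart φ x := by
    refine Filter.EventuallyEq.mfderiv_eq ?_
    filter_upwards [ψ.open_source.mem_nhds hx'] with y hy
    simp [ψ.left_inv hy]
  have h3 := dchart_comp_dchartInv hψ hx'
  rw [h1] at h2
  refine LinearMap.ext fun v => ?_
  have h4 : dchart ψ x (dchartInv ψ x v) = v := LinearMap.congr_fun h3 v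
  have h5 : fderiv ℂ (φ ∘ ψ.symm) (ψ x) (dchart ψ x (dchartInv ψ x v)) =
      dchart φ x (dchartInv ψ x v) := DFunLike.congr_fun h2 (dchartInv ψ x v)
  rw [h4] at h5
  exact h5

/-- Local expressions in two charts differ by pullback along the transition map, whose differential
is the composite of the chart differentials. -/
theorem localize_eq_pull {φ ψ : OpenPartialHomeomorph X (Cn n)} (hφ : φ ∈ atlas (Cn n) X)
    (hψ : ψ ∈ atlas (Cn n) X) {x : X} (hx : x ∈ φ.source) (hx' : x ∈ ψ.source)
    (w : FormField n X) :
    localize formRep w ψ (ψ x) = pull (φ ∘ ψ.symm) (localize formRep w φ) (ψ x) := by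
  have e : (φ ∘ ψ.symm) (ψ x) = φ x := by simp [ψ.left_inv hx']
  rw [pull, e, localize_apply _ _ _ hx, localize_apply _ _ _ hx', fderiv_transition hφ hψ hx hx']
  simp only [formRep, AlgHom.toLinearMap_apply]
  rw [map_tMap_comp, ← LinearMap.comp_assoc, dchartInv_comp_dchart hφ hx, LinearMap.id_comp]

/-- At each point the operator uses that point's preferred chart. Invariance under holomorphic
pullback lets a single chart compute it on its whole target; smoothness of the result and iteration
follow. -/
theorem localize_dolbeault (b : Bool) {w : FormField n X} (hw : IsSmooth formRep w)
    {φ : OpenPartialHomeomorph X (Cn n)} (hφ : φ ∈ atlas (Cn n) X) {z : Cn n}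
    (hz : z ∈ φ.target) :
    localize formRep (dolbeault b w) φ z = dolb b (localize formRep w φ) z := by
  obtain ⟨x, hx, rfl⟩ : ∃ x ∈ φ.source, φ x = z := ⟨φ.symm z, φ.map_target hz, φ.right_inv hz⟩
  set ψ := chartAt (Cn n) x with hψdef
  have hψ : ψ ∈ atlas (Cn n) X := chart_mem_atlas _ _
  have hx' : x ∈ ψ.source := mem_chart_source _ _
  have e : (φ ∘ ψ.symm) (ψ x) = φ x := by simp [ψ.left_inv hx']
  have h1 : localize formRep w ψ =ᶠ[nhds (ψ x)] pull (φ ∘ ψ.symm) (localize formRep w φ) := by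
    have hopen : ψ '' (φ.source ∩ ψ.source) ∈ nhds (ψ x) := by
      refine (ψ.isOpen_image_of_subset_source (φ.open_source.inter ψ.open_source)
        Set.inter_subset_right).mem_nhds ⟨x, ⟨hx, hx'⟩, rfl⟩
    filter_upwards [hopen]
    rintro _ ⟨y, hy, rfl⟩
    exact localize_eq_pull hφ hψ hy.1 hy.2 w
  have h2 := dolb_pull b (contDiffAt_transition hφ hψ hx hx')
    (w := localize formRep w φ) (by rw [e]; exact (hw.cSmoothAt hφ (φ.map_source hx)).cDiffAt)
  rw [localize_apply _ _ _ hx, dolbeault, dolb_congr h1, h2, e, fderiv_transition hφ hψ hx hx']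
  simp only [formRep, formRepInv, AlgHom.toLinearMap_apply]
  rw [map_tMap_comp, map_tMap_comp]
  have : ((dchart φ x : TX n x →ₗ[ℂ] Cn n) ∘ₗ (dchartInv ψ x : Cn n →ₗ[ℂ] TX n x)) ∘ₗ
      (dchart ψ x : TX n x →ₗ[ℂ] Cn n) ∘ₗ (dchartInv φ x : Cn n →ₗ[ℂ] TX n x) =
      LinearMap.id := by
    rw [LinearMap.comp_assoc, ← LinearMap.comp_assoc (dchartInv φ x : Cn n →ₗ[ℂ] TX n x),
      dchartInv_comp_dchart hψ hx', LinearMap.id_comp, dchart_comp_dchartInv hφ hx]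
  rw [this, map_tMap_id]

theorem localize_iotaH (H : MVField n X) (w : FormField n X)
    {φ : OpenPartialHomeomorph X (Cn n)} (hφ : φ ∈ atlas (Cn n) X) {z : Cn n}
    (hz : z ∈ φ.target) :
    localize formRep (iotaH H w) φ z =
      -clifford (Cn n) (localize mvRep H φ z) (localize formRep w φ z) := by
  simp only [localize, iotaH, map_neg, neg_inj]
  exact (clifford_map _ _ (dchartInv_comp_dchart hφ (φ.map_target hz)) _ _).symm

theorem isSmooth_dolbeault (b : Bool) {w : FormField n X} (hw : IsSmooth formRep w) :
    IsSmooth formRep (dolbeault b w) :=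
  isSmooth_of_cSmoothAt fun _ hφ _ hz =>
    ⟨_, (hw.cSmoothAt hφ hz).dolb b, fun _ hy => localize_dolbeault b hw hφ hy⟩

theorem isSmooth_iotaH {H : MVField n X} (hH : IsSmooth mvRep H) {w : FormField n X}
    (hw : IsSmooth formRep w) : IsSmooth formRep (iotaH H w) :=
  isSmooth_of_cSmoothAt fun _ hφ _ hz =>
    ⟨_, CSmoothAt.bilin (-(clifford (Cn n)).toLinearMap) (hH.cSmoothAt hφ hz)
      (hw.cSmoothAt hφ hz), fun _ hy => localize_iotaH H w hφ hy⟩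

theorem formField_ext {w w' : FormField n X}
    (h : ∀ x : X, localize formRep w (chartAt (Cn n) x) (chartAt (Cn n) x x) =
      localize formRep w' (chartAt (Cn n) x) (chartAt (Cn n) x x)) : w = w' := by
  funext x
  have hx := h x
  rw [localize_apply _ _ _ (mem_chart_source _ _), localize_apply _ _ _ (mem_chart_source _ _)] at hx
  rw [← formRepInv_formRep (chart_mem_atlas (Cn n) x) (mem_chart_source _ _) (w x), hx,
    formRepInv_formRep (chart_mem_atlas (Cn n) x) (mem_chart_source _ _)]

theorem dolbeault_eventually (b : Bool) {w : FormField n X} (hw : IsSmooth formRep w) (x : X) :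
    localize formRep (dolbeault b w) (chartAt (Cn n) x) =ᶠ[nhds (chartAt (Cn n) x x)]
      dolb b (localize formRep w (chartAt (Cn n) x)) := by
  filter_upwards [(chartAt (Cn n) x).open_target.mem_nhds (mem_chart_target _ _)] with y hy
  exact localize_dolbeault b hw (chart_mem_atlas _ _) hy

theorem iotaH_eventually (H : MVField n X) (w : FormField n X) (x : X) :
    localize formRep (iotaH H w) (chartAt (Cn n) x) =ᶠ[nhds (chartAt (Cn n) x x)]
      fun y => -clifford (Cn n) (localize mvRep H (chartAt (Cn n) x) y)
        (localize formRep w (chartAt (Cn n) x) y) := by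
  filter_upwards [(chartAt (Cn n) x).open_target.mem_nhds (mem_chart_target _ _)] with y hy
  exact localize_iotaH H w (chart_mem_atlas _ _) hy

/-! ### The operators as endomorphisms of the space of smooth forms -/

variable (n X) in
/-- The smooth complex differential forms. -/
abbrev SmoothForms : Submodule ℂ (FormField n X) := smoothSections (formRep (n := n) (X := X))

theorem localize_sub (w w' : FormField n X) (φ : OpenPartialHomeomorph X (Cn n)) (z : Cn n) :
    localize formRep (w - w') φ z = localize formRep w φ z - localize formRep w' φ z := by
  simp [localize]

theorem localize_add' (w w' : FormField n X) (φ : OpenPartialHomeomorph X (Cn n)) (z : Cn n) :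
    localize formRep (w + w') φ z = localize formRep w φ z + localize formRep w' φ z := by
  simp [localize]

variable (n X) in
/-- `∂` and `∂̄` on smooth forms. -/
def dolbeaultLin (b : Bool) : SmoothForms n X →ₗ[ℂ] SmoothForms n X where
  toFun w := ⟨dolbeault b w.1, isSmooth_dolbeault b w.2⟩
  map_add' w w' := by
    refine Subtype.ext (funext fun x => ?_)
    simp only [dolbeault, Submodule.coe_add, localize_add, Pi.add_apply]
    rw [dolb_add (IsSmooth.cDiffAt w.2 x) (IsSmooth.cDiffAt w'.2 x), map_add]
  map_smul' c w := by
    refine Subtype.ext (funext fun x => ?_)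
    simp only [dolbeault, Submodule.coe_smul, localize_smul, Pi.smul_apply, RingHom.id_apply]
    rw [dolb_smul _ (IsSmooth.cDiffAt w.2 x), map_smul]

/-- `ι_H` on smooth forms. -/
def iotaLin (H : MVField n X) (hH : IsSmooth mvRep H) : SmoothForms n X →ₗ[ℂ] SmoothForms n X where
  toFun w := ⟨iotaH H w.1, isSmooth_iotaH hH w.2⟩
  map_add' w w' := Subtype.ext (iotaH_add H w.1 w'.1)
  map_smul' c w := Subtype.ext (iotaH_smul H c w.1)

theorem dolbeaultLin_anticomm (b b' : Bool) (w : SmoothForms n X) :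
    dolbeaultLin n X b (dolbeaultLin n X b' w) = -dolbeaultLin n X b' (dolbeaultLin n X b w) := by
  refine Subtype.ext ?_
  have key : ∀ b b' : Bool, ∀ x : X, localize formRep (dolbeault b (dolbeault b' w.1))
      (chartAt (Cn n) x) (chartAt (Cn n) x x) =
      dolb b (dolb b' (localize formRep w.1 (chartAt (Cn n) x))) (chartAt (Cn n) x x) := by
    intro b b' x
    rw [localize_dolbeault b (isSmooth_dolbeault b' w.2) (chart_mem_atlas _ _)
      (mem_chart_target _ _)]
    exact dolb_congr (dolbeault_eventually b' w.2 x)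
  change dolbeault b (dolbeault b' w.1) = -dolbeault b' (dolbeault b w.1)
  refine formField_ext fun x => ?_
  have hneg : localize formRep (-dolbeault b' (dolbeault b w.1)) (chartAt (Cn n) x)
      (chartAt (Cn n) x x) = -localize formRep (dolbeault b' (dolbeault b w.1)) (chartAt (Cn n) x)
      (chartAt (Cn n) x x) := by
    simp [localize]
  rw [hneg, key, key]
  exact dolb_anticomm b b' (IsSmooth.cSmoothAt w.2 (chart_mem_atlas _ _) (mem_chart_target _ _))

theorem dolbeaultLin_sq (b : Bool) (w : SmoothForms n X) :
    dolbeaultLin n X b (dolbeaultLin n X b w) = 0 :=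
  eq_zero_of_eq_neg_self (dolbeaultLin_anticomm b b w)

/-- The commutator `[∂, ι_H]` on forms. -/
def brField (H : MVField n X) (w : FormField n X) : FormField n X :=
  dolbeault true (iotaH H w) - iotaH H (dolbeault true w)

theorem koszul_eq (H : MVField n X) (w : FormField n X) :
    koszul H w = dolbeault false w + brField H w := by
  rw [koszul, delbar_eq, del_eq, del_eq]
  rfl

theorem isSmooth_brField {H : MVField n X} (hH : IsSmooth mvRep H) {w : FormField n X}
    (hw : IsSmooth formRep w) : IsSmooth formRep (brField H w) :=
  (SmoothForms n X).sub_mem (isSmooth_dolbeault true (isSmooth_iotaH hH hw))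
    (isSmooth_iotaH hH (isSmooth_dolbeault true hw))

theorem localize_brField {H : MVField n X} (hH : IsSmooth mvRep H) {w : FormField n X}
    (hw : IsSmooth formRep w) (x : X) :
    localize formRep (brField H w) (chartAt (Cn n) x) (chartAt (Cn n) x x) =
      brLoc (localize mvRep H (chartAt (Cn n) x)) (localize formRep w (chartAt (Cn n) x))
        (chartAt (Cn n) x x) := by
  rw [brField, localize_sub, localize_dolbeault true (isSmooth_iotaH hH hw) (chart_mem_atlas _ _)
    (mem_chart_target _ _), dolb_congr (iotaH_eventually H w x),
    localize_iotaH H _ (chart_mem_atlas _ _) (mem_chart_target _ _),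
    (dolbeault_eventually true hw x).self_of_nhds]
  rfl

theorem brLoc_congr {H : Cn n → ExteriorAlgebra ℂ (AFib (Cn n))}
    {w w' : Cn n → ExteriorAlgebra ℂ (TCDual (Cn n))} {z : Cn n} (h : w =ᶠ[nhds z] w') :
    brLoc H w z = brLoc H w' z := by
  rw [brLoc, brLoc, dolb_congr h]
  congr 1
  refine dolb_congr ?_
  filter_upwards [h] with y hy
  rw [hy]

/-! ### The Maurer-Cartan equation and the square of the Koszul operator. -/

theorem localize_mem_exteriorPower (H : ExtendedPoisson n X) (φ : OpenPartialHomeomorph X (Cn n))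
    (z : Cn n) : localize mvRep H.field φ z ∈ ⋀[ℂ]^2 (AFib (Cn n)) :=
  map_mem_exteriorPower _ (H.degree _)

theorem maurerCartan_localize (H : ExtendedPoisson n X) (x : X) :
    dbarMVLoc (localize mvRep H.field (chartAt (Cn n) x)) (chartAt (Cn n) x x) +
      (1 / 2 : ℂ) • schoutenLoc 2 2 (localize mvRep H.field (chartAt (Cn n) x))
        (localize mvRep H.field (chartAt (Cn n) x)) (chartAt (Cn n) x x) = 0 := by
  have h := congrFun H.maurerCartan x
  have h1 : mvRepInv (chartAt (Cn n) x) x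
      (dbarMVLoc (localize mvRep H.field (chartAt (Cn n) x)) (chartAt (Cn n) x x) +
      (1 / 2 : ℂ) • schoutenLoc 2 2 (localize mvRep H.field (chartAt (Cn n) x))
        (localize mvRep H.field (chartAt (Cn n) x)) (chartAt (Cn n) x x)) = 0 := by
    rw [map_add, map_smul]
    exact h
  rw [← mvRep_mvRepInv (chart_mem_atlas (Cn n) x) (mem_chart_source _ _) (dbarMVLoc _ _ + _), h1,
    map_zero]

/-- The Maurer-Cartan equation as an identity of operators on forms. -/
theorem maurerCartan_operator (H : ExtendedPoisson n X) {w : FormField n X}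
    (hw : IsSmooth formRep w) :
    (dolbeault false (iotaH H.field w) - iotaH H.field (dolbeault false w)) +
      (1 / 2 : ℂ) • (brField H.field (iotaH H.field w) - iotaH H.field (brField H.field w)) =
        0 := by
  refine formField_ext fun x => ?_
  have hx := mem_chart_target (Cn n) x
  have hc := chart_mem_atlas (Cn n) x
  have key := maurerCartan_commutator (H.smooth.cDiffAt x)
    (Filter.Eventually.of_forall (localize_mem_exteriorPower H (chartAt (Cn n) x)))
    (hw.cDiffAt x)
  rw [maurerCartan_localize H x, map_zero, LinearMap.zero_apply, neg_zero] at key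
  have hz : localize formRep (0 : FormField n X) (chartAt (Cn n) x)
      (chartAt (Cn n) x x) = 0 := by
    simp [localize]
  have hs : ∀ u : FormField n X, localize formRep ((1 / 2 : ℂ) • u) (chartAt (Cn n) x)
      (chartAt (Cn n) x x) = (1 / 2 : ℂ) •
        localize formRep u (chartAt (Cn n) x) (chartAt (Cn n) x x) := fun u =>
    congrFun (localize_smul _ _ _) _
  rw [hz, localize_add', hs, localize_sub, localize_sub,
    localize_dolbeault false (isSmooth_iotaH H.smooth hw) hc hx,
    dolb_congr (iotaH_eventually H.field w x), localize_iotaH H.field (dolbeault false w) hc hx,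
    localize_dolbeault false hw hc hx, localize_brField H.smooth (isSmooth_iotaH H.smooth hw),
    brLoc_congr (iotaH_eventually H.field w x), localize_iotaH H.field (brField H.field w) hc hx,
    localize_brField H.smooth hw, key]

/-- With B = [d, i], the hypotheses on d and d' give d'B + Bd' = -(d[d', i] + [d', i]d), and dB + Bd
= 0 gives 2B² = -(d[B, i] + [B, i]d). Hence (d' + B)² is minus the anticommutator of d with the
expression in `hC`. -/
theorem sq_eq_zero_of_commutator {R : Type*} [Ring R] [Algebra ℂ R] {d d' i : R} (hd : d * d = 0)
    (hd' : d' * d' = 0) (hdd' : d' * d = -(d * d'))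
    (hC : (d' * i - i * d') + (1 / 2 : ℂ) • ((d * i - i * d) * i - i * (d * i - i * d)) = 0) :
    (d' + (d * i - i * d)) * (d' + (d * i - i * d)) = 0 := by
  have hC2 : (2 : ℂ) • (d' * i - i * d') + ((d * i - i * d) * i - i * (d * i - i * d)) = 0 := by
    have := congrArg (fun x => (2 : ℂ) • x) hC
    simpa [smul_add, smul_smul] using this
  rw [two_smul] at hC2
  have h0 : d' * d + d * d' = 0 := by rw [hdd', neg_add_cancel]
  set C := (d' * i - i * d') + (d' * i - i * d') + ((d * i - i * d) * i - i * (d * i - i * d))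
    with hCdef
  -- Doubled to keep the coefficients integral: C is twice the expression in `hC`, and every
  -- remaining group contains a factor that vanishes.
  have h1 : (d' + (d * i - i * d)) * (d' + (d * i - i * d)) +
      (d' + (d * i - i * d)) * (d' + (d * i - i * d)) =
      -(d * C + C * d) + (d' * d' + d' * d') + ((d' * d + d * d') * i + (d' * d + d * d') * i) -
      (i * (d' * d + d * d') + i * (d' * d + d * d')) - (i * (d * d) * i + i * (d * d) * i) +
      d * d * (i * i) + i * i * (d * d) := by
    rw [hCdef]
    noncomm_ring
  rw [h0, hd, hd', hC2] at h1
  simp only [mul_zero, zero_mul, add_zero, sub_zero, neg_zero] at h1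
  exact eq_zero_of_eq_neg_self (eq_neg_of_add_eq_zero_left h1)

theorem apply_apply_eq_zero_of_commutator {M : Type*} [AddCommGroup M] [Module ℂ M]
    {d d' i k : M →ₗ[ℂ] M} (hd : ∀ w, d (d w) = 0) (hd' : ∀ w, d' (d' w) = 0)
    (hdd' : ∀ w, d' (d w) = -d (d' w)) (hk : ∀ w, k w = d (i w) - i (d w))
    (hC : ∀ w, (d' (i w) - i (d' w)) + (1 / 2 : ℂ) • (k (i w) - i (k w)) = 0) (w : M) :
    (d' + k) ((d' + k) w) = 0 := by
  obtain rfl : k = (d * i - i * d : Module.End ℂ M) := LinearMap.ext hk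
  exact LinearMap.congr_fun (sq_eq_zero_of_commutator (R := Module.End ℂ M) (d := d) (d' := d')
    (i := i) (LinearMap.ext hd) (LinearMap.ext hd') (LinearMap.ext hdd') (LinearMap.ext hC)) w

theorem isSmooth_koszul (H : ExtendedPoisson n X) {w : FormField n X} (hw : IsSmooth formRep w) :
    IsSmooth formRep (koszul H.field w) := by
  rw [koszul_eq]
  exact (SmoothForms n X).add_mem (isSmooth_dolbeault false hw) (isSmooth_brField H.smooth hw)

/-- `[∂, ι_H]` on smooth forms. -/
def brLin (H : MVField n X) (hH : IsSmooth mvRep H) : SmoothForms n X →ₗ[ℂ] SmoothForms n X where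
  toFun w := ⟨brField H w.1, isSmooth_brField hH w.2⟩
  map_add' w w' := by
    have h : ∀ w, (⟨brField H w.1, isSmooth_brField hH w.2⟩ : SmoothForms n X) =
      dolbeaultLin n X true (iotaLin H hH w) - iotaLin H hH (dolbeaultLin n X true w) :=
      fun _ => rfl
    simp only [h, map_add]
    abel
  map_smul' c w := by
    have h : ∀ w, (⟨brField H w.1, isSmooth_brField hH w.2⟩ : SmoothForms n X) =
      dolbeaultLin n X true (iotaLin H hH w) - iotaLin H hH (dolbeaultLin n X true w) :=
      fun _ => rfl
    simp only [h, map_smul, smul_sub, RingHom.id_apply]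

theorem koszul_koszul (H : ExtendedPoisson n X) {w : FormField n X} (hw : IsSmooth formRep w) :
    koszul H.field (koszul H.field w) = 0 := by
  have h := apply_apply_eq_zero_of_commutator (M := SmoothForms n X) (d := dolbeaultLin n X true)
    (d' := dolbeaultLin n X false) (i := iotaLin H.field H.smooth)
    (k := brLin H.field H.smooth) (dolbeaultLin_sq true) (dolbeaultLin_sq false)
    (dolbeaultLin_anticomm false true) (fun _ => rfl)
    (fun w => Subtype.ext (maurerCartan_operator H w.2)) ⟨w, hw⟩
  rw [koszul_eq, koszul_eq]
  exact congrArg Subtype.val h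

end Manifold

/-! ## `τ` on sections -/

section TauSections

variable {n : ℕ} {X : Type*} [TopologicalSpace X] [ChartedSpace (Cn n) X]

/-- The tangent space is the model space with its linear structure. -/
theorem tangent_of_model {P : ∀ (V : Type) [AddCommGroup V] [Module ℂ V], Prop}
    (h : P (Cn n)) (x : X) : P (TX n x) := h

theorem tauFib_tangent_bijective (x : X) : Function.Bijective (tauFib (TX n x) n) :=
  tangent_of_model (P := fun V _ _ => Function.Bijective (tauFib V n)) (tauFib_bijective n) x

theorem tauFib_tangent_bijOn (x : X) (k : ℕ) :
    Set.BijOn (tauFib (TX n x) n) (alDegree (TX n x) n k) (formDegree (TX n x) n k) :=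
  tangent_of_model (P := fun V _ _ => Set.BijOn (tauFib V n) (alDegree V n k) (formDegree V n k))
    (tauFib_bijOn n k) x

theorem tau_injective : Function.Injective (tau (n := n) (X := X)) := fun _ _ h =>
  funext fun x => (tauFib_tangent_bijective x).1 (congrFun h x)

theorem tau_surjective : Function.Surjective (tau (n := n) (X := X)) := fun w => by
  choose v hv using fun x => (tauFib_tangent_bijective x).2 (w x)
  exact ⟨v, funext hv⟩

variable (n X) in
/-- `τ` as a linear map on the space of all sections. -/
def tauLin : ALField n X →ₗ[ℂ] FormField n X where
  toFun := tau
  map_add' v w := funext fun x => map_add (tauFib (TX n x) n) (v x) (w x)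
  map_smul' c v := funext fun x => map_smul (tauFib (TX n x) n) c (v x)

variable (n X) in
/-- `τ` as a linear isomorphism of the spaces of all sections. -/
def tauSections : ALField n X ≃ₗ[ℂ] FormField n X :=
  LinearEquiv.ofBijective (tauLin n X) ⟨tau_injective, tau_surjective⟩

variable [IsManifold 𝓘(ℂ, Cn n) ω X]

theorem localize_tau (v : ALField n X) {φ : OpenPartialHomeomorph X (Cn n)}
    (hφ : φ ∈ atlas (Cn n) X) {z : Cn n} (hz : z ∈ φ.target) :
    localize formRep (tau v) φ z = tauFib (Cn n) n (localize alRep v φ z) := by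
  simp only [localize, tau]
  exact (tauFib_alMap n _ _ (dchartInv_comp_dchart hφ (φ.map_target hz)) _).symm

/-- In every chart `τ` is one fixed linear isomorphism, so it and its inverse preserve smoothness of
components. -/
theorem isSmooth_tau_iff (v : ALField n X) : IsSmooth formRep (tau v) ↔ IsSmooth alRep v := by
  constructor <;> intro h
  · refine isSmooth_of_cSmoothAt fun φ hφ z hz => ⟨_, (h.cSmoothAt hφ hz).linear
      (tauEquiv n).symm.toLinearMap, fun y hy => ?_⟩
    rw [localize_tau v hφ hy]
    exact ((tauEquiv n).symm_apply_apply _).symm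
  · exact isSmooth_of_cSmoothAt fun φ hφ z hz => ⟨_, (h.cSmoothAt hφ hz).linear
      (tauFib (Cn n) n), fun y hy => localize_tau v hφ hy⟩

/-- The converse direction on degrees combines surjectivity within each degree with injectivity of
`τ` on the whole fibre. -/
theorem tau_mem_iff (k : ℕ) (v : ALField n X) : tau v ∈ formSections n X k ↔ v ∈ alSections n X k := by
  have h : ∀ x, tau v x ∈ formDegree (TX n x) n k ↔ v x ∈ alDegree (TX n x) n k := fun x => by
    refine ⟨fun hx => ?_, fun hx => (tauFib_tangent_bijOn x k).mapsTo hx⟩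
    obtain ⟨u, hu, he⟩ := (tauFib_tangent_bijOn x k).surjOn hx
    rwa [← (tauFib_tangent_bijective x).1 he]
  have h1 : tau v ∈ smoothSections (formRep (n := n) (X := X)) ↔
      v ∈ smoothSections (alRep (n := n) (X := X)) := isSmooth_tau_iff v
  simp only [formSections, alSections, Submodule.mem_inf, Submodule.mem_pi, Set.mem_univ,
    true_imp_iff, h, h1]

theorem tau_bijOn (k : ℕ) :
    Set.BijOn (tau (n := n) (X := X)) (alSections n X k) (formSections n X k) := by
  refine ⟨fun v hv => (tau_mem_iff k v).2 hv, tau_injective.injOn, fun w hw => ?_⟩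
  obtain ⟨v, rfl⟩ := tau_surjective w
  exact ⟨v, (tau_mem_iff k v).1 hw, rfl⟩

/-! ### Degrees -/

theorem dolbeault_true_mem {m : ℤ} {w : FormField n X} (hw : IsSmooth formRep w)
    (h : ∀ x, w x ∈ formDegZ (TX n x) m) (x : X) :
    dolbeault true w x ∈ formDegZ (TX n x) (m + 1) :=
  map_tMap_mem _ (sum_mem fun _ _ => ι_inl_mul_mem _
    (wdv_mem _ _ (hw.cDiffAt x) _ (Filter.Eventually.of_forall fun _ => map_tMap_mem _ (h _))))

theorem dolbeault_false_mem {m : ℤ} {w : FormField n X} (hw : IsSmooth formRep w)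
    (h : ∀ x, w x ∈ formDegZ (TX n x) m) (x : X) :
    dolbeault false w x ∈ formDegZ (TX n x) (m - 1) :=
  map_tMap_mem _ (sum_mem fun _ _ => ι_inr_mul_mem _
    (wdv_mem _ _ (hw.cDiffAt x) _ (Filter.Eventually.of_forall fun _ => map_tMap_mem _ (h _))))

theorem iotaH_mem (H : ExtendedPoisson n X) {m : ℤ} {w : FormField n X}
    (h : ∀ x, w x ∈ formDegZ (TX n x) m) (x : X) :
    iotaH H.field w x ∈ formDegZ (TX n x) (m - 2) :=
  neg_mem (clifford_mem (H.degree x) (h x))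

/-- ∂ raises i - j by one, ∂̄ lowers it by one and ι_H lowers it by two; every term thus changes n -
k into n - k - 1. -/
theorem koszul_mem (H : ExtendedPoisson n X) {k : ℕ} {w : FormField n X}
    (hw : w ∈ formSections n X k) : koszul H.field w ∈ formSections n X (k + 1) := by
  have hs : IsSmooth formRep w := hw.1
  have hd : ∀ x, w x ∈ formDegZ (TX n x) ((n : ℤ) - k) := fun x => hw.2 x trivial
  refine ⟨isSmooth_koszul H hs, fun x _ => ?_⟩
  have h1 := dolbeault_false_mem hs hd x
  have h2 := dolbeault_true_mem (isSmooth_iotaH H.smooth hs) (iotaH_mem H hd) x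
  have h3 := iotaH_mem H (dolbeault_true_mem hs hd) x
  have e : (n : ℤ) - ((k + 1 : ℕ) : ℤ) = n - k - 1 := by push_cast; ring
  rw [show (n : ℤ) - k - 2 + 1 = n - k - 1 by ring] at h2
  rw [show (n : ℤ) - k + 1 - 2 = n - k - 1 by ring] at h3
  change koszul H.field w x ∈ formDegZ (TX n x) ((n : ℤ) - ((k + 1 : ℕ) : ℤ))
  rw [e, koszul_eq, brField]
  exact add_mem h1 (sub_mem h2 h3)

/-! ### The intertwining relation -/

/-- Both sides at x are read in the preferred chart at x, so the local identity `tauFib_bdeeLoc`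
applies directly. -/
theorem tau_bdee (H : ExtendedPoisson n X) {k : ℕ} {v : ALField n X}
    (hv : v ∈ alSections n X k) : tau (bdee H.field k v) = koszul H.field (tau v) := by
  refine formField_ext fun x => ?_
  have hx := mem_chart_target (Cn n) x
  have hc := chart_mem_atlas (Cn n) x
  have hs := mem_chart_source (Cn n) x
  have hsm : IsSmooth alRep v := hv.1
  have hτ : IsSmooth formRep (tau v) := (isSmooth_tau_iff v).2 hsm
  have hloc : (fun y => tauFib (Cn n) n (localize alRep v (chartAt (Cn n) x) y))
      =ᶠ[nhds (chartAt (Cn n) x x)] localize formRep (tau v) (chartAt (Cn n) x) := by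
    filter_upwards [(chartAt (Cn n) x).open_target.mem_nhds hx] with y hy
    exact (localize_tau v hc hy).symm
  have hdeg : localize alRep v (chartAt (Cn n) x) (chartAt (Cn n) x x) ∈ alDegree (Cn n) n k :=
    alMap_mem_alDegree _ _ _ _ (hv.2 _ trivial)
  have key := tauFib_bdeeLoc (H.smooth.cDiffAt x)
    (Filter.Eventually.of_forall (localize_mem_exteriorPower H (chartAt (Cn n) x)))
    (hsm.cDiffAt x) hdeg
  rw [dolb_congr hloc, brLoc_congr hloc] at key
  have h1 : tau (bdee H.field k v) x = formRepInv (chartAt (Cn n) x) x (tauFib (Cn n) n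
      (bdeeLoc (localize mvRep H.field (chartAt (Cn n) x)) k
        (localize alRep v (chartAt (Cn n) x)) (chartAt (Cn n) x x))) :=
    tauFib_alMap n _ _ (dchart_comp_dchartInv hc hs) _
  rw [localize_apply _ _ _ hs, h1, formRep_formRepInv hc hs, key, koszul_eq, localize_add',
    localize_dolbeault false hτ hc hx, localize_brField H.smooth hτ]

theorem bdee_mem (H : ExtendedPoisson n X) {k : ℕ} {v : ALField n X}
    (hv : v ∈ alSections n X k) : bdee H.field k v ∈ alSections n X (k + 1) := by
  rw [← tau_mem_iff, tau_bdee H hv]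
  exact koszul_mem H ((tau_mem_iff k v).2 hv)

/-- Transported from the Koszul operator by injectivity of `τ`. The image of `bdee` must first be
known to be a smooth section of degree k + 1 for the intertwining relation to apply a second time.
-/
theorem bdee_bdee (H : ExtendedPoisson n X) {k : ℕ} {v : ALField n X}
    (hv : v ∈ alSections n X k) : bdee H.field (k + 1) (bdee H.field k v) = 0 := by
  apply tau_injective
  rw [tau_bdee H (bdee_mem H hv), tau_bdee H hv,
    koszul_koszul H ((isSmooth_tau_iff v).2 hv.1)]
  exact ((tauSections n X).map_zero).symm

end TauSections

/-! ## Isomorphic complexes have isomorphic cohomology -/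

section CohomologyEquiv

variable {E E' : Type*} [AddCommGroup E] [Module ℂ E] [AddCommGroup E'] [Module ℂ E']

/-- An isomorphism of the ambient spaces that matches the subspaces in both directions carries
cocycles onto cocycles and coboundaries onto coboundaries. The square of the differential is not
involved, since boundaries are intersected with cocycles before the quotient. -/
theorem exists_cohomology_equiv (T : E ≃ₗ[ℂ] E') {C : ℕ → Submodule ℂ E}
    {C' : ℕ → Submodule ℂ E'} (d : ∀ k, C k →ₗ[ℂ] E) (d' : ∀ k, C' k →ₗ[ℂ] E')
    (hC : ∀ k v, T v ∈ C' k ↔ v ∈ C k)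
    (hd : ∀ k (v : C k), d' k ⟨T v, (hC k v).2 v.2⟩ = T (d k v)) (k : ℕ) :
    ∃ e : Cohomology C d k ≃ₗ[ℂ] Cohomology C' d' k, ∀ v : cocycles C d k,
      ∃ w : cocycles C' d' k, (w : E') = T (v : E) ∧
        e (Submodule.Quotient.mk v) = Submodule.Quotient.mk w := by
  have hz : ∀ k, (cocycles C d k).map (T : E →ₗ[ℂ] E') = cocycles C' d' k := by
    intro k
    ext w
    constructor
    · rintro ⟨_, ⟨v, hv, rfl⟩, rfl⟩
      refine ⟨⟨T v, (hC k v).2 v.2⟩, ?_, rfl⟩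
      have hv0 : d k v = 0 := hv
      change d' k _ = 0
      rw [hd, hv0, map_zero]
    · rintro ⟨w, hw, rfl⟩
      obtain ⟨v, hv⟩ := T.surjective w.1
      have hvC : v ∈ C k := (hC k v).1 (hv ▸ w.2)
      refine ⟨v, ⟨⟨v, hvC⟩, ?_, rfl⟩, hv⟩
      have hw0 : d' k w = 0 := hw
      have h1 := hd k ⟨v, hvC⟩
      have h2 : (⟨T v, (hC k v).2 hvC⟩ : C' k) = w := Subtype.ext hv
      rw [h2, hw0] at h1
      exact T.injective (h1.symm.trans (map_zero T).symm)
  have hb : ∀ k, (coboundaries C d k).map (T : E →ₗ[ℂ] E') = coboundaries C' d' k := by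
    intro k
    cases k with
    -- In degree 0 the coboundaries are zero by definition.
    | zero => exact Submodule.map_bot _
    | succ k =>
      ext w
      constructor
      · rintro ⟨_, ⟨v, rfl⟩, rfl⟩
        exact ⟨⟨T v, (hC k v).2 v.2⟩, hd k v⟩
      · rintro ⟨w, rfl⟩
        obtain ⟨v, hv⟩ := T.surjective w.1
        have hvC : v ∈ C k := (hC k v).1 (hv ▸ w.2)
        refine ⟨_, ⟨⟨v, hvC⟩, rfl⟩, ?_⟩
        have h2 : (⟨T v, (hC k v).2 hvC⟩ : C' k) = w := Subtype.ext hv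
        rw [← h2]
        exact (hd k ⟨v, hvC⟩).symm
  let f : cocycles C d k ≃ₗ[ℂ] cocycles C' d' k :=
    (T.submoduleMap (cocycles C d k)).trans (LinearEquiv.ofEq _ _ (hz k))
  have hf : ∀ v, ((f v : cocycles C' d' k) : E') = T (v : E) := fun _ => rfl
  have hq : ((coboundaries C d k).submoduleOf (cocycles C d k)).map
      (f : cocycles C d k →ₗ[ℂ] cocycles C' d' k) =
      (coboundaries C' d' k).submoduleOf (cocycles C' d' k) := by
    ext w
    constructor
    · rintro ⟨v, hv, rfl⟩
      change ((f v : cocycles C' d' k) : E') ∈ coboundaries C' d' k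
      rw [← hb, hf]
      exact Submodule.mem_map_of_mem hv
    · intro hw
      obtain ⟨v, rfl⟩ := f.surjective w
      refine ⟨v, ?_, rfl⟩
      change ((f v : cocycles C' d' k) : E') ∈ coboundaries C' d' k at hw
      rw [← hb, hf] at hw
      obtain ⟨u, hu, he⟩ := hw
      change (v : E) ∈ coboundaries C d k
      rwa [← T.injective he]
  exact ⟨Submodule.Quotient.equiv _ _ f hq, fun v => ⟨f v, hf v, rfl⟩⟩

end CohomologyEquiv

end

end ExtPoisson

theorem mainTheorem2 (n : ℕ) (X : Type*) [TopologicalSpace X] [ChartedSpace (Cn n) X]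
    [IsManifold 𝓘(ℂ, Cn n) ω X] (H : ExtendedPoisson n X) :
    (∀ (k : ℕ) (x : X), Set.BijOn (tauFib (TX n x) n)
      (alDegree (TX n x) n k) (formDegree (TX n x) n k)) ∧
    (∀ k : ℕ, Set.BijOn (tau (n := n) (X := X)) (alSections n X k) (formSections n X k)) ∧
    (∀ k : ℕ, Set.MapsTo (bdee H.field k) (alSections n X k) (alSections n X (k + 1))) ∧
    (∀ k : ℕ, Set.MapsTo (koszul H.field) (formSections n X k) (formSections n X (k + 1))) ∧
    (∀ (k : ℕ), ∀ v ∈ alSections n X k, tau (bdee H.field k v) = koszul H.field (tau v)) ∧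
    (∀ (k : ℕ), ∀ v ∈ alSections n X k, bdee H.field (k + 1) (bdee H.field k v) = 0) ∧
    (∀ (k : ℕ), ∀ w ∈ formSections n X k, koszul H.field (koszul H.field w) = 0) ∧
    (∀ k : ℕ, ∃ e : ELWCohomology H k ≃ₗ[ℂ] KBHomology H k,
      ∀ v : cocycles (alSections n X) (bdeeLin H) k,
        ∃ w : cocycles (formSections n X) (koszulLin H) k,
          (w : FormField n X) = tau (v : ALField n X) ∧
            e (Submodule.Quotient.mk v) = Submodule.Quotient.mk w) := by
  refine ⟨fun k x => tauFib_tangent_bijOn x k, tau_bijOn, fun k v hv => bdee_mem H hv,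
    fun k w hw => koszul_mem H hw, fun k v hv => tau_bdee H hv, fun k v hv => bdee_bdee H hv,
    fun k w hw => koszul_koszul H hw.1, ?_⟩
  exact exists_cohomology_equiv (tauSections n X) (bdeeLin H) (koszulLin H)
    (fun k v => tau_mem_iff k v) fun k v => (tau_bdee H v.2).symm
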